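/- **Conventions.** A metric language consists of sorts (each with a diameter bound), sorted function symbols with uniform continuity moduli $[0,1]\to[0,1]$, and sorted relation symbols with bounds and moduli. A metric structure interprets each sort by a non-empty complete metric space obeying the diameter bound, and the symbols by functions obeying the moduli and bounds. Basic formulas are built from the metric and relation symbols by arbitrary continuous connectives $\mathbb R^n\to\mathbb R$ and by $\sup_x$, $\inf_x$ over sorts. A structure satisfies a set of sentences if each takes the value $0$ in it. A homomorphism of structures commutes with the function symbols and does not increase the values of the relation symbols, the metrics included; it is an isomorphism if it preserves these values and is surjective on every sort. For $\lambda\in\mathbb C$ and an integer $n\ge1$ put $m(\lambda,n)=\max(1,\lceil|\lambda| n\rceil)$. **C\*-algebras.** C\*-algebras are complex and not necessarily unital. Consider families $q=(q^n_k)_{n\ge 1,k\ge 0}$ of $*$-polynomials over $\mathbb C$ in one variable, without constant term, such that in every C\*-algebra $\|a\|\le n$ implies $\|q^n_k(a)\|\le1$ for all $k$, and $\|a\|\le1$ implies $q^n_k(a)\to a$ as $k\to\infty$ (for every $n$). The language $\mathcal L_{C^*}$ has sorts $S_n$ ($n\ge1$) with diameter bound $2n$ and function symbols $+_n:S_n^2\to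 S_{2n}$, $\cdot_n:S_n^2\to S_{n^2}$, $*_n:S_n\to S_n$, $0_n\in S_n$, $\lambda_n:S_n\to S_{m(\lambda,n)}$ ($\lambda\in\mathbb C$), $i_{m,n}:S_m\to S_n$ ($m<n$) and $\mathbf q^n_k:S_n\to S_1$, with moduli $\epsilon/2$, $\epsilon/2n$, $\epsilon$, $\epsilon$, $\epsilon/m(\lambda,n)$, $\epsilon$ and $\epsilon/K$, where $K\ge1$ is a Lipschitz constant of $q^n_k$ on the ball of radius $n$ computed from its expression. The dissection $D(A)$ of a C\*-algebra $A$ interprets $S_n$ by $\{a\in A:\|a\|\le n\}$, the metrics by $\|x-y\|$, and the symbols by the operations of $A$, the inclusions, and the polynomials; a $*$-homomorphism is sent to its restrictions to balls. Write $\|x\|=d_n(x,0_n)$ for $x$ of sort $S_n$. Terms of different sorts are added, multiplied and compared after applying inclusions into a common larger sort. The theory $T_{C^*}$ consists of the sentences that express, for all sorts $S_n$: * the axioms of a complex vector space, of a complex associative algebra, and of a conjugate-linear involution with $(xy)^*=y^*x^*$; * $d(x,y)=\|x-y\|$, $\|x+y\|\le\|x\|+\|y\|$, $\|\lambda x\|=|\lambda|\,\|x\|$,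 $\|xy\|\le\|x\|\,\|y\|$, $\|x^*x\|=\|x\|^2$; * $i_{n,k}i_{m,n}=i_{m,k}$; each $i_{m,n}$ is isometric and preserves $+,\cdot,{}^*,0$ and scalar multiplication; * $\|x\|\le n$ on $S_n$; * $\mathbf q^n_k(x)=q^n_k(x)$ on $S_n$, the right side being the term built from the algebraic symbols. **Hilbert spaces.** $\mathcal L_{HS}$ has the sorts $S_n$ and the symbols $+_n,0_n,\lambda_n,i_{m,n}$ as above, and binary relation symbols $\mathrm{Re}\langle\cdot,\cdot\rangle_n,\mathrm{Im}\langle\cdot,\cdot\rangle_n$ on $S_n$ with bound $n^2$ and modulus $\epsilon/2n$. $T_{HS}$ consists of the sentences that express the complex vector space axioms; conjugate symmetry of the inner product and its linearity in the second variable; $\|x\|^2=\mathrm{Re}\langle x,x\rangle$ and $d(x,y)=\|x-y\|$; that the $i_{m,n}$ are compatible, isometric, and preserve $+$, $0$, scalar multiplication and the inner product; and the sentences $\sup_{x\in S_1}\max(\|x\|-1,0)$ and, for $n>1$, $\sup_{x\in S_n}\min\{\max(1-\|x\|,0),\ \inf_{y\in S_1}d_n(x,i_{1,n}(y))\}$.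 Dissections $D(H)$ of complex Hilbert spaces $H$ are defined by balls as before. Morphisms of Hilbert spaces are the linear maps that preserve the inner product. **Theorem.** 1. Families $q$ as above exist. For every such family, an $\mathcal L_{C^*}$-structure satisfies $T_{C^*}$ if and only if it is isomorphic to $D(A)$ for some C\*-algebra $A$. Moreover $D$ is an equivalence from the category of C\*-algebras and $*$-homomorphisms to the category of models of $T_{C^*}$ and homomorphisms. 2. An $\mathcal L_{HS}$-structure satisfies $T_{HS}$ if and only if it is isomorphic to $D(H)$ for some complex Hilbert space $H$. Moreover $D$ is an equivalence from the category of Hilbert spaces (with the above morphisms) to the category of models of $T_{HS}$ and homomorphisms. -/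

import Mathlib

open CategoryTheory Topology Filter

universe u

namespace ContModel

/-! ### Metric languages and metric structures -/

/-- A uniform continuity modulus: an increasing continuous function `[0,1] → [0,1]` that tends
to `0` at `0`. -/
structure Modulus where
  toFun : unitInterval → unitInterval
  strictMono : StrictMono toFun
  continuous : Continuous toFun
  tendsto_zero : Tendsto toFun (𝓝[>] 0) (𝓝 0)

/-- The modulus `ε ↦ ε / K`, for a real number `K ≥ 1`. -/
noncomputable def Modulus.lin (K : ℝ) (hK : 1 ≤ K) : Modulus where
  toFun ε := ⟨ε / K, div_nonneg ε.2.1 (by linarith), by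
    rw [div_le_one (by linarith)]; exact ε.2.2.trans hK⟩
  strictMono a b hab := by
    have h : (a : ℝ) / K < b / K := div_lt_div_of_pos_right hab (by linarith)
    exact h
  continuous := by fun_prop
  tendsto_zero := by
    have h : Continuous (fun ε : unitInterval => (⟨ε / K, div_nonneg ε.2.1 (by linarith), by
      rw [div_le_one (by linarith)]; exact ε.2.2.trans hK⟩ : unitInterval)) := by fun_prop
    have h0 := h.tendsto 0
    refine (tendsto_nhdsWithin_of_tendsto_nhds h0).trans (le_of_eq ?_)
    congr 1
    exact Subtype.ext (by simp)

/-- A metric language: sorts with diameter bounds, sorted function symbols with moduli, and sorted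
relation symbols with bounds and moduli.  The metric symbol of every sort is built into structures
and formulas. -/
structure MetricLanguage where
  Srt : Type
  bound : Srt → ℝ
  bound_pos : ∀ s, 0 < bound s
  Func : Type
  arity : Func → ℕ
  dom : (f : Func) → Fin (arity f) → Srt
  cod : Func → Srt
  modulus : Func → Modulus
  Rel : Type
  relArity : Rel → ℕ
  relDom : (R : Rel) → Fin (relArity R) → Srt
  relBound : Rel → ℝ
  relBound_pos : ∀ R, 0 < relBound R
  relModulus : Rel → Modulus

/-- A metric structure for the language `L`. -/
structure MetricStructure (L : MetricLanguage) where
  Carrier : L.Srt → Type u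
  [metric : ∀ s, MetricSpace (Carrier s)]
  [complete : ∀ s, CompleteSpace (Carrier s)]
  [nonempty : ∀ s, Nonempty (Carrier s)]
  dist_le : ∀ s (x y : Carrier s), dist x y ≤ L.bound s
  func : (f : L.Func) → (∀ i, Carrier (L.dom f i)) → Carrier (L.cod f)
  func_uc : ∀ (f : L.Func) (ε : unitInterval), 0 < ε → ∀ a b : (∀ i, Carrier (L.dom f i)),
    (∀ i, dist (a i) (b i) < (L.modulus f).toFun ε) → dist (func f a) (func f b) ≤ ε
  rel : (R : L.Rel) → (∀ i, Carrier (L.relDom R i)) → ℝ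
  rel_bound : ∀ (R : L.Rel) (a : ∀ i, Carrier (L.relDom R i)), |rel R a| ≤ L.relBound R
  rel_uc : ∀ (R : L.Rel) (ε : unitInterval), 0 < ε → ∀ a b : (∀ i, Carrier (L.relDom R i)),
    (∀ i, dist (a i) (b i) < (L.relModulus R).toFun ε) → |rel R a - rel R b| ≤ ε

attribute [instance] MetricStructure.metric MetricStructure.complete MetricStructure.nonempty

variable {L : MetricLanguage}

/-- Homomorphisms of metric structures: they commute with the function symbols and do not increase
the values of the relation symbols (the metric symbols included). -/
@[ext]
structure Hom (M N : MetricStructure.{u} L) where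
  toFun : ∀ s, M.Carrier s → N.Carrier s
  map_func : ∀ (f : L.Func) (a : ∀ i, M.Carrier (L.dom f i)),
    toFun _ (M.func f a) = N.func f (fun i => toFun _ (a i))
  map_rel : ∀ (R : L.Rel) (a : ∀ i, M.Carrier (L.relDom R i)),
    N.rel R (fun i => toFun _ (a i)) ≤ M.rel R a
  map_dist : ∀ s (x y : M.Carrier s), dist (toFun s x) (toFun s y) ≤ dist x y

/-- An isomorphism is a homomorphism that preserves the values of all relation symbols (an
embedding) and is surjective on every sort. -/
structure Hom.IsIsomorphism {M N : MetricStructure.{u} L} (ρ : Hom M N) : Prop where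
  rel_eq : ∀ (R : L.Rel) (a : ∀ i, M.Carrier (L.relDom R i)),
    N.rel R (fun i => ρ.toFun _ (a i)) = M.rel R a
  dist_eq : ∀ s (x y : M.Carrier s), dist (ρ.toFun s x) (ρ.toFun s y) = dist x y
  surjective : ∀ s, Function.Surjective (ρ.toFun s)

/-- Isomorphism of metric structures. -/
def Isomorphic (M N : MetricStructure.{u} L) : Prop := ∃ ρ : Hom M N, ρ.IsIsomorphism

/-- The category of `L`-structures and homomorphisms. -/
instance : Category.{u} (MetricStructure.{u} L) where
  Hom := Hom
  id M := ⟨fun _ x => x, fun _ _ => rfl, fun _ _ => le_rfl, fun _ _ _ => le_rfl⟩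
  comp ρ σ := ⟨fun s x => σ.toFun s (ρ.toFun s x),
    fun f a => by rw [ρ.map_func, σ.map_func],
    fun R a => (σ.map_rel R _).trans (ρ.map_rel R a),
    fun s x y => (σ.map_dist s _ _).trans (ρ.map_dist s x y)⟩

/-! ### Terms, basic formulas, sentences, theories -/

/-- Terms, indexed by their co-domain; `var s k` is the `k`-th variable of sort `s`. -/
inductive Term (L : MetricLanguage) : L.Srt → Type
  | var (s : L.Srt) (k : ℕ) : Term L s
  | app (f : L.Func) (τ : ∀ i, Term L (L.dom f i)) : Term L (L.cod f)

/-- Basic formulas of continuous logic; the connectives are all continuous functions `ℝⁿ → ℝ`. -/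
inductive Formula (L : MetricLanguage) : Type
  | dist {s : L.Srt} (τ σ : Term L s) : Formula L
  | rel (R : L.Rel) (τ : ∀ i, Term L (L.relDom R i)) : Formula L
  | conn (n : ℕ) (f : (Fin n → ℝ) → ℝ) (hf : Continuous f) (φ : Fin n → Formula L) : Formula L
  | sup (s : L.Srt) (k : ℕ) (φ : Formula L) : Formula L
  | inf (s : L.Srt) (k : ℕ) (φ : Formula L) : Formula L

/-- The variables of a term. -/
def Term.freeVars : {s : L.Srt} → Term L s → Set (L.Srt × ℕ)
  | _, .var s k => {(s, k)}
  | _, .app _ τ => ⋃ i, (τ i).freeVars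

/-- The free variables of a formula. -/
def Formula.freeVars : Formula L → Set (L.Srt × ℕ)
  | .dist τ σ => τ.freeVars ∪ σ.freeVars
  | .rel _ τ => ⋃ i, (τ i).freeVars
  | .conn _ _ _ φ => ⋃ i, (φ i).freeVars
  | .sup s k φ => φ.freeVars \ {(s, k)}
  | .inf s k φ => φ.freeVars \ {(s, k)}

/-- An assignment of elements of the structure to all variables. -/
abbrev Assignment (M : MetricStructure.{u} L) := ∀ s : L.Srt, ℕ → M.Carrier s

open Classical in
/-- Change the value of the `k`-th variable of sort `s` to `b`. -/
noncomputable def Assignment.update {M : MetricStructure.{u} L} (v : Assignment M) (s : L.Srt)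
    (k : ℕ) (b : M.Carrier s) : Assignment M :=
  Function.update v s (Function.update (v s) k b)

/-- The interpretation of a term. -/
def Term.eval (M : MetricStructure.{u} L) (v : Assignment M) :
    {s : L.Srt} → Term L s → M.Carrier s
  | _, .var s k => v s k
  | _, .app f τ => M.func f (fun i => (τ i).eval M v)

/-- The interpretation of a basic formula.  The suprema and infima are those of bounded, nonempty
sets of reals. -/
noncomputable def Formula.eval (M : MetricStructure.{u} L) : Formula L → Assignment M → ℝ
  | .dist τ σ, v => Dist.dist (τ.eval M v) (σ.eval M v)
  | .rel R τ, v => M.rel R (fun i => (τ i).eval M v)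
  | .conn _ f _ φ, v => f (fun i => (φ i).eval M v)
  | .sup s k φ, v => ⨆ b : M.Carrier s, φ.eval M (v.update s k b)
  | .inf s k φ, v => ⨅ b : M.Carrier s, φ.eval M (v.update s k b)

/-- Sentences: basic formulas without free variables. -/
def Sentence (L : MetricLanguage) : Type := {φ : Formula L // φ.freeVars = ∅}

/-- A set of sentences. -/
abbrev Theory (L : MetricLanguage) := Set (Sentence L)

/-- `M` satisfies `T`: every sentence of `T` takes the value `0` in `M`. -/
def Satisfies (M : MetricStructure.{u} L) (T : Theory L) : Prop :=
  ∀ φ ∈ T, ∀ v : Assignment M, φ.1.eval M v = 0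

/-- The models of `T`, as a property of objects of the category of `L`-structures. -/
def isModel (T : Theory L) : ObjectProperty (MetricStructure.{u} L) := fun M => Satisfies M T

lemma iUnion_zero {α : Type} (f : Fin 0 → Set α) : ⋃ i, f i = ∅ := by simp

lemma iUnion_one {α : Type} (f : Fin 1 → Set α) : ⋃ i, f i = f 0 := iSup_unique (ι := Fin 1) f

lemma iUnion_two {α : Type} (f : Fin 2 → Set α) : ⋃ i, f i = f 0 ∪ f 1 := by
  ext x; simp [Fin.exists_fin_two]

namespace Formula

/-- The constant `r`. -/
def const (r : ℝ) : Formula L :=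
  conn 0 (fun _ => r) continuous_const Fin.elim0

/-- `φ + ψ` -/
def add (φ ψ : Formula L) : Formula L :=
  conn 2 (fun t => t 0 + t 1) (by fun_prop) ![φ, ψ]

/-- `r φ` for a real number `r` -/
def scale (r : ℝ) (φ : Formula L) : Formula L :=
  conn 1 (fun t => r * t 0) (by fun_prop) ![φ]

/-- `φ ψ` -/
def mul (φ ψ : Formula L) : Formula L :=
  conn 2 (fun t => t 0 * t 1) (by fun_prop) ![φ, ψ]

/-- `|φ - ψ|` -/
def absDiff (φ ψ : Formula L) : Formula L :=
  conn 2 (fun t => |t 0 - t 1|) (by fun_prop) ![φ, ψ]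

/-- Truncated subtraction `max (φ - ψ) 0`. -/
def dotminus (φ ψ : Formula L) : Formula L :=
  conn 2 (fun t => max (t 0 - t 1) 0) (by fun_prop) ![φ, ψ]

/-- `min φ ψ` -/
def min (φ ψ : Formula L) : Formula L :=
  conn 2 (fun t => Min.min (t 0) (t 1)) (by fun_prop) ![φ, ψ]

/-- `sup_{x, y, z ∈ s} φ`, where `x, y, z` are the variables number `0, 1, 2` of sort `s`. -/
def sup₃ (s : L.Srt) (φ : Formula L) : Formula L := sup s 0 (sup s 1 (sup s 2 φ))

lemma fv_const (r : ℝ) : (const r : Formula L).freeVars = ∅ := iUnion_zero _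

lemma fv_add (φ ψ : Formula L) : (add φ ψ).freeVars = φ.freeVars ∪ ψ.freeVars := iUnion_two _

lemma fv_scale (r : ℝ) (φ : Formula L) : (scale r φ).freeVars = φ.freeVars := iUnion_one _

lemma fv_mul (φ ψ : Formula L) : (mul φ ψ).freeVars = φ.freeVars ∪ ψ.freeVars := iUnion_two _

lemma fv_absDiff (φ ψ : Formula L) : (absDiff φ ψ).freeVars = φ.freeVars ∪ ψ.freeVars :=
  iUnion_two _

lemma fv_dotminus (φ ψ : Formula L) : (dotminus φ ψ).freeVars = φ.freeVars ∪ ψ.freeVars :=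
  iUnion_two _

lemma fv_min (φ ψ : Formula L) : (min φ ψ).freeVars = φ.freeVars ∪ ψ.freeVars := iUnion_two _

/-- The variables number `0, 1, 2` of sort `s`. -/
def xyz (s : L.Srt) : Set (L.Srt × ℕ) := {(s, 0), (s, 1), (s, 2)}

lemma fv_sup₃ {s : L.Srt} {φ : Formula L} (h : φ.freeVars ⊆ xyz s) :
    (sup₃ s φ).freeVars = ∅ := by
  rw [Set.eq_empty_iff_forall_notMem]
  rintro x ⟨⟨⟨hx, h2⟩, h1⟩, h0⟩
  rcases h hx with h | h | h
  exacts [h0 h, h1 h, h2 h]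

end Formula

/-- The co-domain of multiplication by `lam` on the ball of radius `n`: the least positive integer
radius `m ≥ |lam| n`. -/
noncomputable def scalCod (lam : ℂ) (n : ℕ+) : ℕ+ :=
  ⟨max 1 ⌈‖lam‖ * n⌉₊, by positivity⟩

lemma le_scalCod (lam : ℂ) (n : ℕ+) : ‖lam‖ * n ≤ scalCod lam n := by
  have h : ((⌈‖lam‖ * n⌉₊ : ℕ) : ℝ) ≤ ((scalCod lam n : ℕ) : ℝ) :=
    Nat.cast_le.2 (le_max_right 1 _)
  exact (Nat.le_ceil _).trans h

lemma norm_le_scalCod (lam : ℂ) (n : ℕ+) : ‖lam‖ ≤ scalCod lam n := by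
  refine le_trans ?_ (le_scalCod lam n)
  have : (1 : ℝ) ≤ n := by exact_mod_cast n.pos
  nlinarith [norm_nonneg lam]

lemma one_le_pnat (n : ℕ+) : (1 : ℝ) ≤ n := by exact_mod_cast n.pos

/-! ### The language of C*-algebras -/

/-- Formal `*`-polynomials in one variable over `ℂ`, without constant term. -/
inductive StarPoly : Type
  | X : StarPoly
  | zero : StarPoly
  | add (p q : StarPoly) : StarPoly
  | mul (p q : StarPoly) : StarPoly
  | star (p : StarPoly) : StarPoly
  | smul (c : ℂ) (p : StarPoly) : StarPoly

namespace StarPoly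

/-- The value of a `*`-polynomial at an element of a C*-algebra. -/
def eval {A : Type u} [NonUnitalCStarAlgebra A] (a : A) : StarPoly → A
  | X => a
  | zero => 0
  | add p q => p.eval a + q.eval a
  | mul p q => p.eval a * q.eval a
  | star p => Star.star (p.eval a)
  | smul c p => c • p.eval a

/-- A bound for the norm of the `*`-polynomial on the ball of radius `r`. -/
noncomputable def bd (r : ℝ) : StarPoly → ℝ
  | X => r
  | zero => 0
  | add p q => p.bd r + q.bd r
  | mul p q => p.bd r * q.bd r
  | star p => p.bd r
  | smul c p => ‖c‖ * p.bd r

/-- A Lipschitz constant of the `*`-polynomial on the ball of radius `r`. -/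
noncomputable def lip (r : ℝ) : StarPoly → ℝ
  | X => 1
  | zero => 0
  | add p q => p.lip r + q.lip r
  | mul p q => p.bd r * q.lip r + p.lip r * q.bd r
  | star p => p.lip r
  | smul c p => ‖c‖ * p.lip r

lemma norm_eval_le {A : Type u} [NonUnitalCStarAlgebra A] {a : A} {r : ℝ} (ha : ‖a‖ ≤ r)
    (p : StarPoly) : ‖p.eval a‖ ≤ p.bd r := by
  induction p with
  | X => exact ha
  | zero => simp [eval, bd]
  | add p q hp hq => exact norm_add_le_of_le hp hq
  | mul p q hp hq =>
    exact (norm_mul_le _ _).trans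
      (mul_le_mul hp hq (norm_nonneg _) ((norm_nonneg _).trans hp))
  | star p hp => simpa [eval, bd] using hp
  | smul c p hp =>
    simp only [eval, bd, norm_smul]
    exact mul_le_mul_of_nonneg_left hp (norm_nonneg _)

lemma norm_eval_sub_le {A : Type u} [NonUnitalCStarAlgebra A] {a b : A} {r : ℝ} (ha : ‖a‖ ≤ r)
    (hb : ‖b‖ ≤ r) (p : StarPoly) : ‖p.eval a - p.eval b‖ ≤ p.lip r * ‖a - b‖ := by
  induction p with
  | X => simp [eval, lip]
  | zero => simp [eval, lip]
  | add p q hp hq =>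
    simp only [eval, lip, add_sub_add_comm, add_mul]
    exact norm_add_le_of_le hp hq
  | mul p q hp hq =>
    have e : (mul p q).eval a - (mul p q).eval b
        = p.eval a * (q.eval a - q.eval b) + (p.eval a - p.eval b) * q.eval b := by
      simp only [eval]; noncomm_ring
    rw [e]
    have h1 : ‖p.eval a * (q.eval a - q.eval b)‖ ≤ p.bd r * (q.lip r * ‖a - b‖) :=
      (norm_mul_le _ _).trans (mul_le_mul (norm_eval_le ha p) hq (norm_nonneg _)
        ((norm_nonneg _).trans (norm_eval_le ha p)))
    have h2 : ‖(p.eval a - p.eval b) * q.eval b‖ ≤ (p.lip r * ‖a - b‖) * q.bd r :=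
      (norm_mul_le _ _).trans (mul_le_mul hp (norm_eval_le hb q) (norm_nonneg _)
        ((norm_nonneg _).trans hp))
    refine (norm_add_le_of_le h1 h2).trans (le_of_eq ?_)
    simp only [lip]; ring
  | star p hp =>
    simp only [eval, lip]
    rw [← star_sub, norm_star]; exact hp
  | smul c p hp =>
    simp only [eval, lip]
    rw [← smul_sub, norm_smul, mul_assoc]
    exact mul_le_mul_of_nonneg_left hp (norm_nonneg _)

end StarPoly

/-- The property of the `*`-polynomials `q^n_k`: in every C*-algebra they map the ball of radius `n`
to the unit ball, and `q^n_k(a) → a` as `k → ∞` for every `a` in the unit ball. -/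
structure IsRetractingFamily (Q : ℕ+ → ℕ → StarPoly) : Prop where
  norm_le : ∀ (n : ℕ+) (k : ℕ) (A : Type u) [NonUnitalCStarAlgebra A] (a : A),
    ‖a‖ ≤ n → ‖(Q n k).eval a‖ ≤ 1
  tendsto : ∀ (n : ℕ+) (A : Type u) [NonUnitalCStarAlgebra A] (a : A),
    ‖a‖ ≤ 1 → Tendsto (fun k => (Q n k).eval a) atTop (𝓝 a)

/-- Function symbols for C*-algebras; the sorts are the positive integers. -/
inductive CStarFunc : Type
  | add (n : ℕ+)
  | mul (n : ℕ+)
  | star (n : ℕ+)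
  | zero (n : ℕ+)
  | smul (lam : ℂ) (n : ℕ+)
  | incl (m n : ℕ+) (h : m < n)
  | poly (n : ℕ+) (k : ℕ)

namespace CStarFunc

/-- Number of arguments. -/
def arity : CStarFunc → ℕ
  | add _ => 2
  | mul _ => 2
  | star _ => 1
  | zero _ => 0
  | smul _ _ => 1
  | incl _ _ _ => 1
  | poly _ _ => 1

/-- The sort of all arguments. -/
def argSort : CStarFunc → ℕ+
  | add n => n
  | mul n => n
  | star n => n
  | zero n => n
  | smul _ n => n
  | incl m _ _ => m
  | poly n _ => n

/-- Co-domain. -/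
noncomputable def cod : CStarFunc → ℕ+
  | add n => 2 * n
  | mul n => n ^ 2
  | star n => n
  | zero n => n
  | smul lam n => scalCod lam n
  | incl _ n _ => n
  | poly _ _ => 1

/-- Uniform continuity modulus. -/
noncomputable def modulus (Q : ℕ+ → ℕ → StarPoly) : CStarFunc → Modulus
  | add _ => .lin 2 (by norm_num)
  | mul n => .lin (2 * n) (by linarith [one_le_pnat n])
  | star _ => .lin 1 le_rfl
  | zero _ => .lin 1 le_rfl
  | smul lam n => .lin (scalCod lam n) (one_le_pnat _)
  | incl _ _ _ => .lin 1 le_rfl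
  | poly n k => .lin (max 1 ((Q n k).lip n)) (le_max_left _ _)

end CStarFunc

/-- The language of C*-algebras, for a given choice `Q` of the `*`-polynomials `q^n_k`. -/
noncomputable def CStarLang (Q : ℕ+ → ℕ → StarPoly) : MetricLanguage where
  Srt := ℕ+
  bound n := 2 * (n : ℝ)
  bound_pos n := by linarith [one_le_pnat n]
  Func := CStarFunc
  arity := CStarFunc.arity
  dom f _ := f.argSort
  cod := CStarFunc.cod
  modulus := CStarFunc.modulus Q
  Rel := Empty
  relArity := Empty.elim
  relDom R := R.elim
  relBound := Empty.elim
  relBound_pos R := R.elim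
  relModulus := Empty.elim

/-! ### The theory of C*-algebras -/

namespace CStarLang

variable {Q : ℕ+ → ℕ → StarPoly}

/-- Terms of the language of C*-algebras. -/
abbrev Tm (Q : ℕ+ → ℕ → StarPoly) (n : ℕ+) : Type := Term (CStarLang Q) n

/-- Formulas of the language of C*-algebras. -/
abbrev Fm (Q : ℕ+ → ℕ → StarPoly) : Type := Formula (CStarLang Q)

/-- The variable number `k` of sort `n`. -/
def tvar (n : ℕ+) (k : ℕ) : Tm Q n := .var (L := CStarLang Q) n k

/-- `σ +_n τ` -/
def tadd {n : ℕ+} (σ τ : Tm Q n) : Tm Q (2 * n) :=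
  .app (L := CStarLang Q) (CStarFunc.add n) ![σ, τ]

/-- `σ ·_n τ` -/
def tmul {n : ℕ+} (σ τ : Tm Q n) : Tm Q (n ^ 2) :=
  .app (L := CStarLang Q) (CStarFunc.mul n) ![σ, τ]

/-- `τ^*` -/
def tstar {n : ℕ+} (τ : Tm Q n) : Tm Q n :=
  .app (L := CStarLang Q) (CStarFunc.star n) ![τ]

/-- `0_n` -/
def tzero (n : ℕ+) : Tm Q n :=
  .app (L := CStarLang Q) (CStarFunc.zero n) (fun i => Fin.elim0 i)

/-- `lam_n(τ)` -/
def tsmul (lam : ℂ) {n : ℕ+} (τ : Tm Q n) : Tm Q (scalCod lam n) :=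
  .app (L := CStarLang Q) (CStarFunc.smul lam n) ![τ]

/-- `i_{m,n}(τ)` -/
def tincl {m n : ℕ+} (h : m < n) (τ : Tm Q m) : Tm Q n :=
  .app (L := CStarLang Q) (CStarFunc.incl m n h) ![τ]

/-- The function symbol of `q^n_k`, applied to `τ`. -/
def tpoly {n : ℕ+} (k : ℕ) (τ : Tm Q n) : Tm Q 1 :=
  .app (L := CStarLang Q) (CStarFunc.poly n k) ![τ]

/-- Sum of two terms of arbitrary sorts: both are first included into a common larger sort. -/
def tadd' {m n : ℕ+} (σ : Tm Q m) (τ : Tm Q n) : Tm Q (2 * (m + n)) :=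
  tadd (tincl (PNat.lt_add_right m n) σ) (tincl (PNat.lt_add_left n m) τ)

/-- Product of two terms of arbitrary sorts. -/
def tmul' {m n : ℕ+} (σ : Tm Q m) (τ : Tm Q n) : Tm Q ((m + n) ^ 2) :=
  tmul (tincl (PNat.lt_add_right m n) σ) (tincl (PNat.lt_add_left n m) τ)

/-- Distance of two terms of arbitrary sorts, measured in a common larger sort. -/
def dst {m n : ℕ+} (σ : Tm Q m) (τ : Tm Q n) : Fm Q :=
  .dist (L := CStarLang Q) (s := m + n)
    (tincl (PNat.lt_add_right m n) σ) (tincl (PNat.lt_add_left n m) τ)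

/-- `‖τ‖ = d_n(τ, 0_n)` -/
def nrm {n : ℕ+} (τ : Tm Q n) : Fm Q := .dist (L := CStarLang Q) (s := n) τ (tzero n)

/-- The co-domain of the term that represents a `*`-polynomial in a variable of sort `n`. -/
noncomputable def polyCod (n : ℕ+) : StarPoly → ℕ+
  | .X => n
  | .zero => n
  | .add p q => 2 * (polyCod n p + polyCod n q)
  | .mul p q => (polyCod n p + polyCod n q) ^ 2
  | .star p => polyCod n p
  | .smul c p => scalCod c (polyCod n p)

/-- The term that represents a `*`-polynomial in the variable number `0` of sort `n`, built from
the algebraic function symbols. -/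
noncomputable def polyTerm (n : ℕ+) : (p : StarPoly) → Tm Q (polyCod n p)
  | .X => tvar n 0
  | .zero => tzero n
  | .add p q => tadd' (polyTerm n p) (polyTerm n q)
  | .mul p q => tmul' (polyTerm n p) (polyTerm n q)
  | .star p => tstar (polyTerm n p)
  | .smul c p => tsmul c (polyTerm n p)

/-- `sup_{x, y, z ∈ S_n} φ` -/
noncomputable def all (n : ℕ+) (φ : Fm Q) : Fm Q := Formula.sup₃ (L := CStarLang Q) n φ

/-- The axioms of C*-algebras (in each of them, `x, y, z` are the variables number `0, 1, 2` of
the sort `S_n`, respectively `S_m`, and all of them are bound by suprema). -/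
inductive Axioms (Q : ℕ+ → ℕ → StarPoly) : Fm Q → Prop
  -- complex vector space
  | add_comm (n : ℕ+) : Axioms Q (all n (dst (tadd (tvar n 0) (tvar n 1))
      (tadd (tvar n 1) (tvar n 0))))
  | add_assoc (n : ℕ+) : Axioms Q (all n (dst
      (tadd' (tadd (tvar n 0) (tvar n 1)) (tvar n 2))
      (tadd' (tvar n 0) (tadd (tvar n 1) (tvar n 2)))))
  | add_zero (n : ℕ+) : Axioms Q (all n (dst (tadd (tvar n 0) (tzero n)) (tvar n 0)))
  | add_neg (n : ℕ+) : Axioms Q (all n (dst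
      (tadd' (tvar n 0) (tsmul (-1) (tvar n 0))) (tzero n)))
  | one_smul (n : ℕ+) : Axioms Q (all n (dst (tsmul 1 (tvar n 0)) (tvar n 0)))
  | mul_smul (lam mu : ℂ) (n : ℕ+) : Axioms Q (all n (dst
      (tsmul (lam * mu) (tvar n 0)) (tsmul lam (tsmul mu (tvar n 0)))))
  | smul_add (lam : ℂ) (n : ℕ+) : Axioms Q (all n (dst
      (tsmul lam (tadd (tvar n 0) (tvar n 1)))
      (tadd (tsmul lam (tvar n 0)) (tsmul lam (tvar n 1)))))
  | add_smul (lam mu : ℂ) (n : ℕ+) : Axioms Q (all n (dst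
      (tsmul (lam + mu) (tvar n 0))
      (tadd' (tsmul lam (tvar n 0)) (tsmul mu (tvar n 0)))))
  -- complex algebra
  | mul_assoc (n : ℕ+) : Axioms Q (all n (dst
      (tmul' (tmul (tvar n 0) (tvar n 1)) (tvar n 2))
      (tmul' (tvar n 0) (tmul (tvar n 1) (tvar n 2)))))
  | mul_add (n : ℕ+) : Axioms Q (all n (dst
      (tmul' (tvar n 0) (tadd (tvar n 1) (tvar n 2)))
      (tadd (tmul (tvar n 0) (tvar n 1)) (tmul (tvar n 0) (tvar n 2)))))
  | add_mul (n : ℕ+) : Axioms Q (all n (dst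
      (tmul' (tadd (tvar n 0) (tvar n 1)) (tvar n 2))
      (tadd (tmul (tvar n 0) (tvar n 2)) (tmul (tvar n 1) (tvar n 2)))))
  | smul_mul (lam : ℂ) (n : ℕ+) : Axioms Q (all n (dst
      (tmul' (tsmul lam (tvar n 0)) (tvar n 1))
      (tsmul lam (tmul (tvar n 0) (tvar n 1)))))
  | mul_smul_comm (lam : ℂ) (n : ℕ+) : Axioms Q (all n (dst
      (tmul' (tvar n 0) (tsmul lam (tvar n 1)))
      (tsmul lam (tmul (tvar n 0) (tvar n 1)))))
  -- involution
  | star_star (n : ℕ+) : Axioms Q (all n (dst (tstar (tstar (tvar n 0))) (tvar n 0)))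
  | star_add (n : ℕ+) : Axioms Q (all n (dst
      (tstar (tadd (tvar n 0) (tvar n 1)))
      (tadd (tstar (tvar n 0)) (tstar (tvar n 1)))))
  | star_smul (lam : ℂ) (n : ℕ+) : Axioms Q (all n (dst
      (tstar (tsmul lam (tvar n 0)))
      (tsmul ((starRingEnd ℂ) lam) (tstar (tvar n 0)))))
  | star_mul (n : ℕ+) : Axioms Q (all n (dst
      (tstar (tmul (tvar n 0) (tvar n 1)))
      (tmul (tstar (tvar n 1)) (tstar (tvar n 0)))))
  -- normed algebra, with the metric induced by the norm
  | dist_eq (n : ℕ+) : Axioms Q (all n (.absDiff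
      (.dist (L := CStarLang Q) (s := n) (tvar n 0) (tvar n 1))
      (nrm (tadd' (tvar n 0) (tsmul (-1) (tvar n 1))))))
  | norm_add (n : ℕ+) : Axioms Q (all n (.dotminus
      (nrm (tadd (tvar n 0) (tvar n 1)))
      (.add (nrm (tvar n 0)) (nrm (tvar n 1)))))
  | norm_smul (lam : ℂ) (n : ℕ+) : Axioms Q (all n (.absDiff
      (nrm (tsmul lam (tvar n 0))) (.scale ‖lam‖ (nrm (tvar n 0)))))
  | norm_mul (n : ℕ+) : Axioms Q (all n (.dotminus
      (nrm (tmul (tvar n 0) (tvar n 1)))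
      (.mul (nrm (tvar n 0)) (nrm (tvar n 1)))))
  -- the C*-identity
  | cstar (n : ℕ+) : Axioms Q (all n (.absDiff
      (nrm (tmul (tstar (tvar n 0)) (tvar n 0)))
      (.mul (nrm (tvar n 0)) (nrm (tvar n 0)))))
  -- the inclusions are compatible isometric embeddings that preserve the algebraic structure
  | incl_incl (m n k : ℕ+) (h : m < n) (h' : n < k) : Axioms Q (all m
      (.dist (L := CStarLang Q) (s := k)
        (tincl h' (tincl h (tvar m 0))) (tincl (h.trans h') (tvar m 0))))
  | incl_dist (m n : ℕ+) (h : m < n) : Axioms Q (all m (.absDiff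
      (.dist (L := CStarLang Q) (s := n) (tincl h (tvar m 0)) (tincl h (tvar m 1)))
      (.dist (L := CStarLang Q) (s := m) (tvar m 0) (tvar m 1))))
  | incl_add (m n : ℕ+) (h : m < n) : Axioms Q (all m (dst
      (tadd (tvar m 0) (tvar m 1))
      (tadd (tincl h (tvar m 0)) (tincl h (tvar m 1)))))
  | incl_mul (m n : ℕ+) (h : m < n) : Axioms Q (all m (dst
      (tmul (tvar m 0) (tvar m 1))
      (tmul (tincl h (tvar m 0)) (tincl h (tvar m 1)))))
  | incl_star (m n : ℕ+) (h : m < n) : Axioms Q (all m (dst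
      (tstar (tvar m 0)) (tstar (tincl h (tvar m 0)))))
  | incl_zero (m n : ℕ+) (h : m < n) : Axioms Q (all m (
      .dist (L := CStarLang Q) (s := n) (tincl h (tzero m)) (tzero n)))
  | incl_smul (lam : ℂ) (m n : ℕ+) (h : m < n) : Axioms Q (all m (dst
      (tsmul lam (tvar m 0)) (tsmul lam (tincl h (tvar m 0)))))
  -- the sorts are the norm balls
  | norm_le (n : ℕ+) : Axioms Q (all n (.dotminus (nrm (tvar n 0)) (.const n)))
  | poly (n : ℕ+) (k : ℕ) : Axioms Q (all n (dst
      (tpoly k (tvar n 0)) (polyTerm n (Q n k))))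

lemma fv_tvar_0 (n : ℕ+) :
    (tvar n 0 : Tm Q n).freeVars ⊆ Formula.xyz (L := CStarLang Q) n :=
  fun _ h => Or.inl h

lemma fv_tvar_1 (n : ℕ+) :
    (tvar n 1 : Tm Q n).freeVars ⊆ Formula.xyz (L := CStarLang Q) n :=
  fun _ h => Or.inr (Or.inl h)

lemma fv_tvar_2 (n : ℕ+) :
    (tvar n 2 : Tm Q n).freeVars ⊆ Formula.xyz (L := CStarLang Q) n :=
  fun _ h => Or.inr (Or.inr h)


lemma fv_tadd {n : ℕ+} (σ τ : Tm Q n) : (tadd σ τ).freeVars = σ.freeVars ∪ τ.freeVars :=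
  iUnion_two _

lemma fv_tmul {n : ℕ+} (σ τ : Tm Q n) : (tmul σ τ).freeVars = σ.freeVars ∪ τ.freeVars :=
  iUnion_two _

lemma fv_tstar {n : ℕ+} (τ : Tm Q n) : (tstar τ).freeVars = τ.freeVars := iUnion_one _

lemma fv_tzero (n : ℕ+) : (tzero n : Tm Q n).freeVars = ∅ := iUnion_zero _

lemma fv_tsmul (lam : ℂ) {n : ℕ+} (τ : Tm Q n) : (tsmul lam τ).freeVars = τ.freeVars :=
  iUnion_one _

lemma fv_tincl {m n : ℕ+} (h : m < n) (τ : Tm Q m) : (tincl h τ).freeVars = τ.freeVars :=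
  iUnion_one _

lemma fv_tpoly {n : ℕ+} (k : ℕ) (τ : Tm Q n) : (tpoly k τ).freeVars = τ.freeVars :=
  iUnion_one _

lemma fv_tadd' {m n : ℕ+} (σ : Tm Q m) (τ : Tm Q n) :
    (tadd' σ τ).freeVars = σ.freeVars ∪ τ.freeVars := by
  rw [tadd', fv_tadd, fv_tincl, fv_tincl]

lemma fv_tmul' {m n : ℕ+} (σ : Tm Q m) (τ : Tm Q n) :
    (tmul' σ τ).freeVars = σ.freeVars ∪ τ.freeVars := by
  rw [tmul', fv_tmul, fv_tincl, fv_tincl]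

lemma fv_dist {n : ℕ+} (σ τ : Tm Q n) :
    (Formula.dist (L := CStarLang Q) (s := n) σ τ).freeVars = σ.freeVars ∪ τ.freeVars := rfl

lemma fv_dst {m n : ℕ+} (σ : Tm Q m) (τ : Tm Q n) :
    (dst σ τ).freeVars = σ.freeVars ∪ τ.freeVars := by
  rw [dst, fv_dist, fv_tincl, fv_tincl]

lemma fv_nrm {n : ℕ+} (τ : Tm Q n) : (nrm τ).freeVars = τ.freeVars := by
  rw [nrm, fv_dist, fv_tzero, Set.union_empty]

lemma fv_polyTerm (n : ℕ+) (p : StarPoly) :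
    (polyTerm n p : Tm Q _).freeVars ⊆ Formula.xyz (L := CStarLang Q) n := by
  induction p with
  | X => exact fv_tvar_0 n
  | zero => exact (subset_of_eq (fv_tzero n)).trans (Set.empty_subset _)
  | add p q hp hq => exact (subset_of_eq (fv_tadd' _ _)).trans (Set.union_subset hp hq)
  | mul p q hp hq => exact (subset_of_eq (fv_tmul' _ _)).trans (Set.union_subset hp hq)
  | star p hp => exact (subset_of_eq (fv_tstar _)).trans hp
  | smul c p hp => exact (subset_of_eq (fv_tsmul c _)).trans hp

/-- The axioms are sentences. -/
lemma Axioms.closed {φ : Fm Q} (h : Axioms Q φ) : φ.freeVars = ∅ := by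
  cases h with
  | poly n k =>
    refine Formula.fv_sup₃ ?_
    rw [fv_dst, fv_tpoly]
    exact Set.union_subset (fv_tvar_0 n) (fv_polyTerm n _)
  | _ =>
    refine Formula.fv_sup₃ ?_
    simp [fv_dst, fv_nrm, fv_dist, fv_tadd, fv_tmul, fv_tadd', fv_tmul', fv_tstar, fv_tsmul,
      fv_tincl, fv_tzero, fv_tvar_0, fv_tvar_1, fv_tvar_2, Formula.fv_absDiff, Formula.fv_dotminus, Formula.fv_add,
      Formula.fv_mul, Formula.fv_scale, Formula.fv_const,
      Set.union_subset_iff]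

end CStarLang

/-- The theory `T_{C*}`. -/
def TCStar (Q : ℕ+ → ℕ → StarPoly) : Theory (CStarLang Q) := {φ | CStarLang.Axioms Q φ.1}

/-! ### Dissections of C*-algebras -/

/-- C*-algebras (not necessarily unital). -/
structure CStarCat where
  carrier : Type u
  [str : NonUnitalCStarAlgebra carrier]

attribute [instance] CStarCat.str

/-- The category of C*-algebras and `*`-homomorphisms. -/
instance : Category.{u} CStarCat.{u} where
  Hom A B := A.carrier →⋆ₙₐ[ℂ] B.carrier
  id A := NonUnitalStarAlgHom.id ℂ A.carrier
  comp f g := NonUnitalStarAlgHom.comp g f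

/-- The ball of radius `n`. -/
abbrev Ball (A : Type u) [SeminormedAddCommGroup A] (n : ℕ+) : Type u := {a : A // ‖a‖ ≤ n}

lemma completeSpace_ball (A : Type u) [NormedAddCommGroup A] [CompleteSpace A] (n : ℕ+) :
    CompleteSpace (Ball A n) :=
  (isClosed_le continuous_norm continuous_const).completeSpace_coe

lemma dist_ball_le (A : Type u) [NormedAddCommGroup A] (n : ℕ+) (x y : Ball A n) :
    dist x y ≤ 2 * (n : ℝ) := by
  have h : dist x y = ‖x.1 - y.1‖ := by rw [Subtype.dist_eq, dist_eq_norm]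
  rw [h]
  linarith [norm_sub_le x.1 y.1, x.2, y.2]

section

variable {Q : ℕ+ → ℕ → StarPoly} (hQ : IsRetractingFamily.{u} Q)

/-- The interpretation of the function symbols in the dissection of a C*-algebra. -/
def dissFunc (A : Type u) [NonUnitalCStarAlgebra A] :
    (f : CStarFunc) → (Fin f.arity → Ball A f.argSort) → Ball A f.cod
  | .add n, a => ⟨(a (0 : Fin 2)).1 + (a (1 : Fin 2)).1, by
      have h0 : ‖(a (0 : Fin 2)).1‖ ≤ (n : ℝ) := (a (0 : Fin 2)).2
      have h1 : ‖(a (1 : Fin 2)).1‖ ≤ (n : ℝ) := (a (1 : Fin 2)).2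
      refine (norm_add_le_of_le h0 h1).trans (le_of_eq ?_)
      simp [CStarFunc.cod, two_mul]⟩
  | .mul n, a => ⟨(a (0 : Fin 2)).1 * (a (1 : Fin 2)).1, by
      have h0 : ‖(a (0 : Fin 2)).1‖ ≤ (n : ℝ) := (a (0 : Fin 2)).2
      have h1 : ‖(a (1 : Fin 2)).1‖ ≤ (n : ℝ) := (a (1 : Fin 2)).2
      refine (norm_mul_le_of_le h0 h1).trans (le_of_eq ?_)
      simp [CStarFunc.cod, sq]⟩
  | .star _, a => ⟨star (a (0 : Fin 1)).1, by rw [norm_star]; exact (a (0 : Fin 1)).2⟩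
  | .zero _, _ => ⟨0, by rw [norm_zero]; positivity⟩
  | .smul lam n, a => ⟨lam • (a (0 : Fin 1)).1, by
      rw [norm_smul]
      exact (mul_le_mul_of_nonneg_left (a (0 : Fin 1)).2 (norm_nonneg lam)).trans
        (le_scalCod lam n)⟩
  | .incl m n h, a => ⟨(a (0 : Fin 1)).1, by
      have h' : ((m : ℕ) : ℝ) ≤ ((n : ℕ) : ℝ) := Nat.cast_le.2 (PNat.coe_le_coe _ _ |>.2 h.le)
      exact (a (0 : Fin 1)).2.trans h'⟩
  | .poly n k, a => ⟨(Q n k).eval (a (0 : Fin 1)).1, by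
      refine (hQ.norm_le n k A _ (a (0 : Fin 1)).2).trans (le_of_eq ?_)
      simp [CStarFunc.cod]⟩

lemma dissFunc_uc (A : Type u) [NonUnitalCStarAlgebra A] (f : CStarFunc) (ε : unitInterval)
    (hε : 0 < ε) (a b : Fin f.arity → Ball A f.argSort)
    (h : ∀ i, dist (a i) (b i) < (f.modulus Q).toFun ε) :
    dist (dissFunc hQ A f a) (dissFunc hQ A f b) ≤ ε := by
  have hε' : (0 : ℝ) < ε := hε
  rw [Subtype.dist_eq, dist_eq_norm]
  simp only [Subtype.dist_eq, dist_eq_norm] at h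
  cases f with
  | add n =>
    have h0 : ‖(a (0 : Fin 2)).1 - (b (0 : Fin 2)).1‖ < ε / 2 := h (0 : Fin 2)
    have h1 : ‖(a (1 : Fin 2)).1 - (b (1 : Fin 2)).1‖ < ε / 2 := h (1 : Fin 2)
    simp only [dissFunc, add_sub_add_comm]
    refine (norm_add_le_of_le h0.le h1.le).trans (le_of_eq ?_)
    ring
  | mul n =>
    have hn := one_le_pnat n
    have h0 : ‖(a (0 : Fin 2)).1 - (b (0 : Fin 2)).1‖ < ε / (2 * n) := h (0 : Fin 2)
    have h1 : ‖(a (1 : Fin 2)).1 - (b (1 : Fin 2)).1‖ < ε / (2 * n) := h (1 : Fin 2)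
    have ha : ‖(a (0 : Fin 2)).1‖ ≤ (n : ℝ) := (a (0 : Fin 2)).2
    have hb : ‖(b (1 : Fin 2)).1‖ ≤ (n : ℝ) := (b (1 : Fin 2)).2
    have e : (dissFunc hQ A (.mul n) a).1 - (dissFunc hQ A (.mul n) b).1
        = (a (0 : Fin 2)).1 * ((a (1 : Fin 2)).1 - (b (1 : Fin 2)).1)
          + ((a (0 : Fin 2)).1 - (b (0 : Fin 2)).1) * (b (1 : Fin 2)).1 := by
      simp only [dissFunc]; noncomm_ring
    rw [e]
    refine (norm_add_le_of_le (norm_mul_le_of_le ha h1.le) (norm_mul_le_of_le h0.le hb)).trans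
      (le_of_eq ?_)
    field_simp; ring
  | star n =>
    have h0 : ‖(a (0 : Fin 1)).1 - (b (0 : Fin 1)).1‖ < ε / 1 := h (0 : Fin 1)
    simp only [dissFunc, ← star_sub, norm_star]
    exact h0.le.trans (by simp)
  | zero n => simpa [dissFunc] using hε'.le
  | smul lam n =>
    have hc := one_le_pnat (scalCod lam n)
    have h0 : ‖(a (0 : Fin 1)).1 - (b (0 : Fin 1)).1‖ < ε / (scalCod lam n : ℝ) := h (0 : Fin 1)
    simp only [dissFunc, ← smul_sub, norm_smul]
    refine (mul_le_mul (norm_le_scalCod lam n) h0.le (norm_nonneg _) (by positivity)).trans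
      (le_of_eq ?_)
    field_simp
  | incl m n hmn =>
    have h0 : ‖(a (0 : Fin 1)).1 - (b (0 : Fin 1)).1‖ < ε / 1 := h (0 : Fin 1)
    simp only [dissFunc]
    exact h0.le.trans (by simp)
  | poly n k =>
    have hc : (0 : ℝ) < max 1 ((Q n k).lip n) := lt_of_lt_of_le one_pos (le_max_left _ _)
    have h0 : ‖(a (0 : Fin 1)).1 - (b (0 : Fin 1)).1‖ < ε / max 1 ((Q n k).lip n) :=
      h (0 : Fin 1)
    simp only [dissFunc]
    refine (StarPoly.norm_eval_sub_le (a (0 : Fin 1)).2 (b (0 : Fin 1)).2 (Q n k)).trans ?_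
    refine (mul_le_mul (le_max_right 1 _) h0.le (norm_nonneg _) hc.le).trans (le_of_eq ?_)
    field_simp

/-- The dissection `D(A)` of a C*-algebra `A`: the sort `S_n` is the ball of radius `n`. -/
def dissObj (A : CStarCat.{u}) : MetricStructure.{u} (CStarLang Q) where
  Carrier n := Ball A.carrier n
  complete n := completeSpace_ball A.carrier n
  nonempty n := ⟨⟨0, by rw [norm_zero]; positivity⟩⟩
  dist_le n := dist_ball_le A.carrier n
  func := dissFunc hQ A.carrier
  func_uc := dissFunc_uc hQ A.carrier
  rel R := R.elim
  rel_bound R := R.elim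
  rel_uc R := R.elim

lemma StarPoly.map_eval {A B : Type u} [NonUnitalCStarAlgebra A] [NonUnitalCStarAlgebra B]
    (φ : A →⋆ₙₐ[ℂ] B) (a : A) (p : StarPoly) : φ (p.eval a) = p.eval (φ a) := by
  induction p <;> simp_all [StarPoly.eval, map_star]

/-- The homomorphism of dissections induced by a `*`-homomorphism, by restriction to balls. -/
def dissMap {A B : CStarCat.{u}} (φ : A.carrier →⋆ₙₐ[ℂ] B.carrier) :
    Hom (dissObj hQ A) (dissObj hQ B) where
  toFun n x := ⟨φ x.1, (NonUnitalStarAlgHom.norm_apply_le φ x.1).trans x.2⟩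
  map_func f a := by
    cases f with
    | add n => exact Subtype.ext (map_add φ _ _)
    | mul n => exact Subtype.ext (map_mul φ _ _)
    | star n => exact Subtype.ext (map_star φ _)
    | zero n => exact Subtype.ext (map_zero φ)
    | smul lam n => exact Subtype.ext (map_smul φ lam _)
    | incl m n h => rfl
    | poly n k => exact Subtype.ext (StarPoly.map_eval φ _ _)
  map_rel R := R.elim
  map_dist n x y := by
    change dist (φ x.1) (φ y.1) ≤ dist x.1 y.1
    rw [dist_eq_norm, dist_eq_norm, ← map_sub]
    exact NonUnitalStarAlgHom.norm_apply_le φ _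

/-- The dissection functor from C*-algebras to metric structures. -/
def dissection : CStarCat.{u} ⥤ MetricStructure.{u} (CStarLang Q) where
  obj A := dissObj hQ A
  map φ := dissMap hQ φ

end


/-! ### The language of Hilbert spaces -/

/-- Function symbols for Hilbert spaces; the sorts are the positive integers. -/
inductive HilbFunc : Type
  | add (n : ℕ+)
  | zero (n : ℕ+)
  | smul (lam : ℂ) (n : ℕ+)
  | incl (m n : ℕ+) (h : m < n)

namespace HilbFunc

/-- Number of arguments. -/
def arity : HilbFunc → ℕ
  | add _ => 2
  | zero _ => 0
  | smul _ _ => 1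
  | incl _ _ _ => 1

/-- The sort of all arguments. -/
def argSort : HilbFunc → ℕ+
  | add n => n
  | zero n => n
  | smul _ n => n
  | incl m _ _ => m

/-- Co-domain. -/
noncomputable def cod : HilbFunc → ℕ+
  | add n => 2 * n
  | zero n => n
  | smul lam n => scalCod lam n
  | incl _ n _ => n

/-- Uniform continuity modulus. -/
noncomputable def modulus : HilbFunc → Modulus
  | add _ => .lin 2 (by norm_num)
  | zero _ => .lin 1 le_rfl
  | smul lam n => .lin (scalCod lam n) (one_le_pnat _)
  | incl _ _ _ => .lin 1 le_rfl

end HilbFunc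

/-- Relation symbols for Hilbert spaces: real and imaginary part of the inner product. -/
inductive HilbRel : Type
  | re (n : ℕ+)
  | im (n : ℕ+)

/-- The sort of both arguments. -/
def HilbRel.argSort : HilbRel → ℕ+
  | re n => n
  | im n => n

/-- The language of Hilbert spaces. -/
noncomputable def HilbLang : MetricLanguage where
  Srt := ℕ+
  bound n := 2 * (n : ℝ)
  bound_pos n := by linarith [one_le_pnat n]
  Func := HilbFunc
  arity := HilbFunc.arity
  dom f _ := f.argSort
  cod := HilbFunc.cod
  modulus := HilbFunc.modulus
  Rel := HilbRel
  relArity _ := 2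
  relDom R _ := R.argSort
  relBound R := (R.argSort : ℝ) ^ 2
  relBound_pos R := by positivity
  relModulus R := .lin (2 * (R.argSort : ℝ)) (by linarith [one_le_pnat R.argSort])

/-! ### The theory of Hilbert spaces -/

namespace HilbLang

/-- Terms of the language of Hilbert spaces. -/
abbrev Tm (n : ℕ+) : Type := Term HilbLang n

/-- Formulas of the language of Hilbert spaces. -/
abbrev Fm : Type := Formula HilbLang

/-- The variable number `k` of sort `n`. -/
def tvar (n : ℕ+) (k : ℕ) : Tm n := .var (L := HilbLang) n k

/-- `σ +_n τ` -/
def tadd {n : ℕ+} (σ τ : Tm n) : Tm (2 * n) :=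
  .app (L := HilbLang) (HilbFunc.add n) ![σ, τ]

/-- `0_n` -/
def tzero (n : ℕ+) : Tm n :=
  .app (L := HilbLang) (HilbFunc.zero n) (fun i => Fin.elim0 i)

/-- `lam_n(τ)` -/
def tsmul (lam : ℂ) {n : ℕ+} (τ : Tm n) : Tm (scalCod lam n) :=
  .app (L := HilbLang) (HilbFunc.smul lam n) ![τ]

/-- `i_{m,n}(τ)` -/
def tincl {m n : ℕ+} (h : m < n) (τ : Tm m) : Tm n :=
  .app (L := HilbLang) (HilbFunc.incl m n h) ![τ]

/-- Sum of two terms of arbitrary sorts: both are first included into a common larger sort. -/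
def tadd' {m n : ℕ+} (σ : Tm m) (τ : Tm n) : Tm (2 * (m + n)) :=
  tadd (tincl (PNat.lt_add_right m n) σ) (tincl (PNat.lt_add_left n m) τ)

/-- Distance of two terms of the same sort. -/
def dst₀ {n : ℕ+} (σ τ : Tm n) : Fm := .dist (L := HilbLang) (s := n) σ τ

/-- Distance of two terms of arbitrary sorts, measured in a common larger sort. -/
def dst {m n : ℕ+} (σ : Tm m) (τ : Tm n) : Fm :=
  dst₀ (tincl (PNat.lt_add_right m n) σ) (tincl (PNat.lt_add_left n m) τ)

/-- `‖τ‖ = d_n(τ, 0_n)` -/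
def nrm {n : ℕ+} (τ : Tm n) : Fm := dst₀ τ (tzero n)

/-- `Re ⟨σ, τ⟩_n` -/
def re₀ {n : ℕ+} (σ τ : Tm n) : Fm := .rel (L := HilbLang) (HilbRel.re n) ![σ, τ]

/-- `Im ⟨σ, τ⟩_n` -/
def im₀ {n : ℕ+} (σ τ : Tm n) : Fm := .rel (L := HilbLang) (HilbRel.im n) ![σ, τ]

/-- Real part of the inner product of two terms of arbitrary sorts. -/
def re {m n : ℕ+} (σ : Tm m) (τ : Tm n) : Fm :=
  re₀ (tincl (PNat.lt_add_right m n) σ) (tincl (PNat.lt_add_left n m) τ)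

/-- Imaginary part of the inner product of two terms of arbitrary sorts. -/
def im {m n : ℕ+} (σ : Tm m) (τ : Tm n) : Fm :=
  im₀ (tincl (PNat.lt_add_right m n) σ) (tincl (PNat.lt_add_left n m) τ)

/-- `sup_{x, y, z ∈ S_n} φ` -/
noncomputable def all (n : ℕ+) (φ : Fm) : Fm := Formula.sup₃ (L := HilbLang) n φ

/-- The axioms of Hilbert spaces (in each of them, `x, y, z` are the variables number `0, 1, 2` of
the sort `S_n`, respectively `S_m`, and all of them are bound by suprema).  The inner product is
linear in the second variable. -/
inductive Axioms : Fm → Prop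
  -- complex vector space
  | add_comm (n : ℕ+) : Axioms (all n (dst (tadd (tvar n 0) (tvar n 1))
      (tadd (tvar n 1) (tvar n 0))))
  | add_assoc (n : ℕ+) : Axioms (all n (dst
      (tadd' (tadd (tvar n 0) (tvar n 1)) (tvar n 2))
      (tadd' (tvar n 0) (tadd (tvar n 1) (tvar n 2)))))
  | add_zero (n : ℕ+) : Axioms (all n (dst (tadd (tvar n 0) (tzero n)) (tvar n 0)))
  | add_neg (n : ℕ+) : Axioms (all n (dst
      (tadd' (tvar n 0) (tsmul (-1) (tvar n 0))) (tzero n)))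
  | one_smul (n : ℕ+) : Axioms (all n (dst (tsmul 1 (tvar n 0)) (tvar n 0)))
  | mul_smul (lam mu : ℂ) (n : ℕ+) : Axioms (all n (dst
      (tsmul (lam * mu) (tvar n 0)) (tsmul lam (tsmul mu (tvar n 0)))))
  | smul_add (lam : ℂ) (n : ℕ+) : Axioms (all n (dst
      (tsmul lam (tadd (tvar n 0) (tvar n 1)))
      (tadd (tsmul lam (tvar n 0)) (tsmul lam (tvar n 1)))))
  | add_smul (lam mu : ℂ) (n : ℕ+) : Axioms (all n (dst
      (tsmul (lam + mu) (tvar n 0))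
      (tadd' (tsmul lam (tvar n 0)) (tsmul mu (tvar n 0)))))
  -- inner product, inducing the metric
  | re_symm (n : ℕ+) : Axioms (all n (.absDiff
      (re₀ (tvar n 0) (tvar n 1)) (re₀ (tvar n 1) (tvar n 0))))
  | im_symm (n : ℕ+) : Axioms (all n (.absDiff
      (im₀ (tvar n 0) (tvar n 1)) (.scale (-1) (im₀ (tvar n 1) (tvar n 0)))))
  | re_add (n : ℕ+) : Axioms (all n (.absDiff
      (re (tvar n 0) (tadd (tvar n 1) (tvar n 2)))
      (.add (re₀ (tvar n 0) (tvar n 1)) (re₀ (tvar n 0) (tvar n 2)))))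
  | im_add (n : ℕ+) : Axioms (all n (.absDiff
      (im (tvar n 0) (tadd (tvar n 1) (tvar n 2)))
      (.add (im₀ (tvar n 0) (tvar n 1)) (im₀ (tvar n 0) (tvar n 2)))))
  | re_smul (lam : ℂ) (n : ℕ+) : Axioms (all n (.absDiff
      (re (tvar n 0) (tsmul lam (tvar n 1)))
      (.add (.scale lam.re (re₀ (tvar n 0) (tvar n 1)))
        (.scale (-lam.im) (im₀ (tvar n 0) (tvar n 1))))))
  | im_smul (lam : ℂ) (n : ℕ+) : Axioms (all n (.absDiff
      (im (tvar n 0) (tsmul lam (tvar n 1)))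
      (.add (.scale lam.re (im₀ (tvar n 0) (tvar n 1)))
        (.scale lam.im (re₀ (tvar n 0) (tvar n 1))))))
  | norm_sq (n : ℕ+) : Axioms (all n (.absDiff
      (.mul (nrm (tvar n 0)) (nrm (tvar n 0))) (re₀ (tvar n 0) (tvar n 0))))
  | dist_eq (n : ℕ+) : Axioms (all n (.absDiff (dst₀ (tvar n 0) (tvar n 1))
      (nrm (tadd' (tvar n 0) (tsmul (-1) (tvar n 1))))))
  -- the inclusions are compatible isometric embeddings that preserve the structure
  | incl_incl (m n k : ℕ+) (h : m < n) (h' : n < k) : Axioms (all m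
      (dst₀ (tincl h' (tincl h (tvar m 0))) (tincl (h.trans h') (tvar m 0))))
  | incl_dist (m n : ℕ+) (h : m < n) : Axioms (all m (.absDiff
      (dst₀ (tincl h (tvar m 0)) (tincl h (tvar m 1))) (dst₀ (tvar m 0) (tvar m 1))))
  | incl_add (m n : ℕ+) (h : m < n) : Axioms (all m (dst
      (tadd (tvar m 0) (tvar m 1))
      (tadd (tincl h (tvar m 0)) (tincl h (tvar m 1)))))
  | incl_zero (m n : ℕ+) (h : m < n) : Axioms (all m (dst₀ (tincl h (tzero m)) (tzero n)))
  | incl_smul (lam : ℂ) (m n : ℕ+) (h : m < n) : Axioms (all m (dst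
      (tsmul lam (tvar m 0)) (tsmul lam (tincl h (tvar m 0)))))
  | incl_re (m n : ℕ+) (h : m < n) : Axioms (all m (.absDiff
      (re₀ (tincl h (tvar m 0)) (tincl h (tvar m 1))) (re₀ (tvar m 0) (tvar m 1))))
  | incl_im (m n : ℕ+) (h : m < n) : Axioms (all m (.absDiff
      (im₀ (tincl h (tvar m 0)) (tincl h (tvar m 1))) (im₀ (tvar m 0) (tvar m 1))))
  -- the sorts are the balls; in the second axiom `x = x_0` is of sort `S_n`, `y = x_1` of sort `S_1`
  | norm_le : Axioms (all 1 (.dotminus (nrm (tvar 1 0)) (.const 1)))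
  | unit_ball (n : ℕ+) (h : 1 < n) : Axioms (all n (.min
      (.dotminus (.const 1) (nrm (tvar n 0)))
      (.inf (L := HilbLang) (1 : ℕ+) 1 (dst₀ (tvar n 0) (tincl h (tvar 1 1))))))

lemma fv_tvar_0 (n : ℕ+) :
    (tvar n 0).freeVars ⊆ Formula.xyz (L := HilbLang) n :=
  fun _ h => Or.inl h

lemma fv_tvar_1 (n : ℕ+) :
    (tvar n 1).freeVars ⊆ Formula.xyz (L := HilbLang) n :=
  fun _ h => Or.inr (Or.inl h)

lemma fv_tvar_2 (n : ℕ+) :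
    (tvar n 2).freeVars ⊆ Formula.xyz (L := HilbLang) n :=
  fun _ h => Or.inr (Or.inr h)


lemma fv_tadd {n : ℕ+} (σ τ : Tm n) : (tadd σ τ).freeVars = σ.freeVars ∪ τ.freeVars :=
  iUnion_two _

lemma fv_tzero (n : ℕ+) : (tzero n).freeVars = ∅ := iUnion_zero _

lemma fv_tsmul (lam : ℂ) {n : ℕ+} (τ : Tm n) : (tsmul lam τ).freeVars = τ.freeVars :=
  iUnion_one _

lemma fv_tincl {m n : ℕ+} (h : m < n) (τ : Tm m) : (tincl h τ).freeVars = τ.freeVars :=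
  iUnion_one _

lemma fv_tadd' {m n : ℕ+} (σ : Tm m) (τ : Tm n) :
    (tadd' σ τ).freeVars = σ.freeVars ∪ τ.freeVars := by
  rw [tadd', fv_tadd, fv_tincl, fv_tincl]

lemma fv_dst₀ {n : ℕ+} (σ τ : Tm n) : (dst₀ σ τ).freeVars = σ.freeVars ∪ τ.freeVars := rfl

lemma fv_dst {m n : ℕ+} (σ : Tm m) (τ : Tm n) :
    (dst σ τ).freeVars = σ.freeVars ∪ τ.freeVars := by
  rw [dst, fv_dst₀, fv_tincl, fv_tincl]

lemma fv_nrm {n : ℕ+} (τ : Tm n) : (nrm τ).freeVars = τ.freeVars := by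
  rw [nrm, fv_dst₀, fv_tzero, Set.union_empty]

lemma fv_re₀ {n : ℕ+} (σ τ : Tm n) : (re₀ σ τ).freeVars = σ.freeVars ∪ τ.freeVars :=
  iUnion_two _

lemma fv_im₀ {n : ℕ+} (σ τ : Tm n) : (im₀ σ τ).freeVars = σ.freeVars ∪ τ.freeVars :=
  iUnion_two _

lemma fv_re {m n : ℕ+} (σ : Tm m) (τ : Tm n) : (re σ τ).freeVars = σ.freeVars ∪ τ.freeVars := by
  rw [re, fv_re₀, fv_tincl, fv_tincl]

lemma fv_im {m n : ℕ+} (σ : Tm m) (τ : Tm n) : (im σ τ).freeVars = σ.freeVars ∪ τ.freeVars := by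
  rw [im, fv_im₀, fv_tincl, fv_tincl]

/-- The axioms are sentences. -/
lemma Axioms.closed {φ : Fm} (h : Axioms φ) : φ.freeVars = ∅ := by
  cases h with
  | unit_ball n h =>
    refine Formula.fv_sup₃ ?_
    rw [Formula.fv_min, Formula.fv_dotminus, Formula.fv_const, fv_nrm]
    rintro p ((hp | hp) | ⟨hp, hp'⟩)
    · exact hp.elim
    · exact fv_tvar_0 n hp
    · rw [fv_dst₀, fv_tincl] at hp
      exact hp.elim (fun h => fv_tvar_0 n h) (fun h => (hp' h).elim)
  | _ =>
    refine Formula.fv_sup₃ ?_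
    simp [fv_dst, fv_dst₀, fv_nrm, fv_re, fv_re₀, fv_im, fv_im₀, fv_tadd, fv_tadd', fv_tsmul,
      fv_tincl, fv_tzero, fv_tvar_0, fv_tvar_1, fv_tvar_2, Formula.fv_absDiff, Formula.fv_dotminus, Formula.fv_add,
      Formula.fv_mul, Formula.fv_scale, Formula.fv_const,
      Set.union_subset_iff]

end HilbLang

/-- The theory `T_{HS}`. -/
def THilb : Theory HilbLang := {φ | HilbLang.Axioms φ.1}

/-! ### Dissections of Hilbert spaces -/

/-- Complex Hilbert spaces. -/
structure HilbCat where
  carrier : Type u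
  [group : NormedAddCommGroup carrier]
  [inner : InnerProductSpace ℂ carrier]
  [complete : CompleteSpace carrier]

attribute [instance] HilbCat.group HilbCat.inner HilbCat.complete

/-- The category of Hilbert spaces and linear maps that preserve the inner product. -/
instance : Category.{u} HilbCat.{u} where
  Hom H K := H.carrier →ₗᵢ[ℂ] K.carrier
  id H := LinearIsometry.id
  comp f g := g.comp f

section

variable (H : Type u) [NormedAddCommGroup H] [InnerProductSpace ℂ H]

/-- The interpretation of the function symbols in the dissection of a Hilbert space. -/
def hilbFunc : (f : HilbFunc) → (Fin f.arity → Ball H f.argSort) → Ball H f.cod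
  | .add n, a => ⟨(a (0 : Fin 2)).1 + (a (1 : Fin 2)).1, by
      have h0 : ‖(a (0 : Fin 2)).1‖ ≤ (n : ℝ) := (a (0 : Fin 2)).2
      have h1 : ‖(a (1 : Fin 2)).1‖ ≤ (n : ℝ) := (a (1 : Fin 2)).2
      refine (norm_add_le_of_le h0 h1).trans (le_of_eq ?_)
      simp [HilbFunc.cod, two_mul]⟩
  | .zero _, _ => ⟨0, by rw [norm_zero]; positivity⟩
  | .smul lam n, a => ⟨lam • (a (0 : Fin 1)).1, by
      rw [norm_smul]
      exact (mul_le_mul_of_nonneg_left (a (0 : Fin 1)).2 (norm_nonneg lam)).trans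
        (le_scalCod lam n)⟩
  | .incl m n h, a => ⟨(a (0 : Fin 1)).1, by
      have h' : ((m : ℕ) : ℝ) ≤ ((n : ℕ) : ℝ) := Nat.cast_le.2 (PNat.coe_le_coe _ _ |>.2 h.le)
      exact (a (0 : Fin 1)).2.trans h'⟩

lemma hilbFunc_uc (f : HilbFunc) (ε : unitInterval)
    (hε : 0 < ε) (a b : Fin f.arity → Ball H f.argSort)
    (h : ∀ i, dist (a i) (b i) < f.modulus.toFun ε) :
    dist (hilbFunc H f a) (hilbFunc H f b) ≤ ε := by
  have hε' : (0 : ℝ) < ε := hε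
  rw [Subtype.dist_eq, dist_eq_norm]
  simp only [Subtype.dist_eq, dist_eq_norm] at h
  cases f with
  | add n =>
    have h0 : ‖(a (0 : Fin 2)).1 - (b (0 : Fin 2)).1‖ < ε / 2 := h (0 : Fin 2)
    have h1 : ‖(a (1 : Fin 2)).1 - (b (1 : Fin 2)).1‖ < ε / 2 := h (1 : Fin 2)
    simp only [hilbFunc, add_sub_add_comm]
    refine (norm_add_le_of_le h0.le h1.le).trans (le_of_eq ?_)
    ring
  | zero n => simpa [hilbFunc] using hε'.le
  | smul lam n =>
    have hc := one_le_pnat (scalCod lam n)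
    have h0 : ‖(a (0 : Fin 1)).1 - (b (0 : Fin 1)).1‖ < ε / (scalCod lam n : ℝ) := h (0 : Fin 1)
    simp only [hilbFunc, ← smul_sub, norm_smul]
    refine (mul_le_mul (norm_le_scalCod lam n) h0.le (norm_nonneg _) (by positivity)).trans
      (le_of_eq ?_)
    field_simp
  | incl m n hmn =>
    have h0 : ‖(a (0 : Fin 1)).1 - (b (0 : Fin 1)).1‖ < ε / 1 := h (0 : Fin 1)
    simp only [hilbFunc]
    exact h0.le.trans (by simp)

/-- The interpretation of the relation symbols in the dissection of a Hilbert space. -/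
noncomputable def hilbRel : (R : HilbRel) → (Fin 2 → Ball H R.argSort) → ℝ
  | .re _, a => (inner ℂ (a 0).1 (a 1).1).re
  | .im _, a => (inner ℂ (a 0).1 (a 1).1).im

lemma norm_inner_ball_le {n : ℕ+} (x y : Ball H n) : ‖inner ℂ x.1 y.1‖ ≤ (n : ℝ) ^ 2 := by
  refine (norm_inner_le_norm _ _).trans ?_
  rw [sq]
  exact mul_le_mul x.2 y.2 (norm_nonneg _) (by positivity)

lemma norm_inner_sub_ball_le {n : ℕ+} {ε : ℝ} (x y x' y' : Ball H n)
    (h0 : dist x x' < ε / (2 * n)) (h1 : dist y y' < ε / (2 * n)) :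
    ‖inner ℂ x.1 y.1 - inner ℂ x'.1 y'.1‖ ≤ ε := by
  rw [Subtype.dist_eq, dist_eq_norm] at h0 h1
  have hn := one_le_pnat n
  have e : inner ℂ x.1 y.1 - inner ℂ x'.1 y'.1
      = inner ℂ x.1 (y.1 - y'.1) + inner ℂ (x.1 - x'.1) y'.1 := by
    rw [inner_sub_right, inner_sub_left]; ring
  rw [e]
  have i0 : ‖inner ℂ x.1 (y.1 - y'.1)‖ ≤ n * (ε / (2 * n)) :=
    (norm_inner_le_norm _ _).trans (mul_le_mul x.2 h1.le (norm_nonneg _) (by positivity))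
  have i1 : ‖inner ℂ (x.1 - x'.1) y'.1‖ ≤ ε / (2 * n) * n :=
    (norm_inner_le_norm _ _).trans
      (mul_le_mul h0.le y'.2 (norm_nonneg _) ((norm_nonneg _).trans h0.le))
  refine (norm_add_le_of_le i0 i1).trans (le_of_eq ?_)
  field_simp; ring

end

/-- The dissection `D(H)` of a Hilbert space `H`: the sort `S_n` is the ball of radius `n`. -/
noncomputable def hilbObj (H : HilbCat.{u}) : MetricStructure.{u} HilbLang where
  Carrier n := Ball H.carrier n
  complete n := completeSpace_ball H.carrier n
  nonempty n := ⟨⟨0, by rw [norm_zero]; positivity⟩⟩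
  dist_le n := dist_ball_le H.carrier n
  func := hilbFunc H.carrier
  func_uc := hilbFunc_uc H.carrier
  rel := hilbRel H.carrier
  rel_bound R a := by
    cases R with
    | re n => exact (Complex.abs_re_le_norm _).trans (norm_inner_ball_le H.carrier _ _)
    | im n => exact (Complex.abs_im_le_norm _).trans (norm_inner_ball_le H.carrier _ _)
  rel_uc R ε _ a b h := by
    cases R with
    | re n =>
      simp only [hilbRel, ← Complex.sub_re]
      exact (Complex.abs_re_le_norm _).trans
        (norm_inner_sub_ball_le H.carrier _ _ _ _ (h (0 : Fin 2)) (h (1 : Fin 2)))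
    | im n =>
      simp only [hilbRel, ← Complex.sub_im]
      exact (Complex.abs_im_le_norm _).trans
        (norm_inner_sub_ball_le H.carrier _ _ _ _ (h (0 : Fin 2)) (h (1 : Fin 2)))

/-- The homomorphism of dissections induced by a linear isometry, by restriction to balls. -/
noncomputable def hilbMap {H K : HilbCat.{u}} (φ : H.carrier →ₗᵢ[ℂ] K.carrier) :
    Hom (hilbObj H) (hilbObj K) where
  toFun n x := ⟨φ x.1, (φ.norm_map x.1).le.trans x.2⟩
  map_func f a := by
    cases f with
    | add n => exact Subtype.ext (map_add φ _ _)
    | zero n => exact Subtype.ext (map_zero φ)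
    | smul lam n => exact Subtype.ext (map_smul φ lam _)
    | incl m n h => rfl
  map_rel R a := by
    cases R with
    | re n => exact (congrArg Complex.re (φ.inner_map_map _ _)).le
    | im n => exact (congrArg Complex.im (φ.inner_map_map _ _)).le
  map_dist n x y := (φ.dist_map x.1 y.1).le

/-- The dissection functor from Hilbert spaces to metric structures. -/
noncomputable def hilbDissection : HilbCat.{u} ⥤ MetricStructure.{u} HilbLang where
  obj H := hilbObj H
  map φ := hilbMap φ

end ContModel

namespace ContModel

/-! ### Assignments and values of basic formulas. -/

variable {L : MetricLanguage}

/-! The heart of the matter is that the sorts of a model are the balls of a C*-algebra, respectively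
of a Hilbert space. The inclusion symbols make the sorts a chain of isometric embeddings
(`BallChain`). Any three elements of its colimit come from one sort, and an axiom for that sort,
carried along the embeddings (`Realization`), becomes a law of the colimit; the operations are well
defined because the inclusions preserve them. So the union of the sorts is a normed *-algebra with
the C*-identity, respectively an inner product space, and its completion is a C*-algebra,
respectively a Hilbert space.

It remains to see that S_n fills the ball of radius n of the completion
(`exists_completionRealization_eq`, in both namespaces). The sorts are complete, so their images are
closed. Multiplication by n maps S_1 to S_n, which reduces the claim to n = 1, and density reduces
it to elements b of the union with ‖b‖ < 1. Such a b comes from some S_n, and an axiom beyond the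
algebra is needed to place it in S_1. For C*-algebras, the symbol of q^n_k has co-domain S_1, so the
elements q^n_k(b) lie in the image of S_1, and they converge to b. For Hilbert spaces, the last
axiom says that b has distance 0 from the image of S_1.

Conversely, a dissection is realized in its own space and hence satisfies the axioms
(`Realization.satisfies`), and satisfaction passes along isomorphisms by induction on formulas
(`eval_formula`).

A homomorphism of dissections commutes with the inclusions, so its components glue to one map
(`exists_map_of_balls`), which respects the operations. For Hilbert spaces the inner product is not
increased in real part; comparing the pairs (a, a) and (a, -a) turns this into preservation of the
norm.

For the existence of the q^n_k, the Weierstrass theorem gives a real polynomial p close to 1 /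
max(1, √t) on [0, n²], and a p(a*a) is a *-polynomial without constant term. By the C*-identity and
the functional calculus in the unitization, the square of its norm is at most the supremum of t
p(t)² (`norm_mul_aeval_le`), and on the unit ball its distance from a is at most the supremum of |p
- 1| on [0, 1]. -/

@[simp] lemma Assignment.update_same {M : MetricStructure.{u} L} (v : Assignment M) (s : L.Srt)
    (k : ℕ) (b : M.Carrier s) : v.update s k b s k = b := by
  simp [Assignment.update]

lemma Assignment.update_of_ne {M : MetricStructure.{u} L} (v : Assignment M) (s : L.Srt)
    {j k : ℕ} (h : j ≠ k) (b : M.Carrier s) : v.update s k b s j = v s j := by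
  simp [Assignment.update, h]

lemma Assignment.update_of_sort_ne {M : MetricStructure.{u} L} (v : Assignment M) {s t : L.Srt}
    (h : t ≠ s) (k : ℕ) (b : M.Carrier s) (j : ℕ) : v.update s k b t j = v t j := by
  simp [Assignment.update, h]

@[simp] lemma Assignment.update_self {M : MetricStructure.{u} L} (v : Assignment M) (s : L.Srt)
    (k : ℕ) : v.update s k (v s k) = v := by
  simp [Assignment.update]

/-- Three elements of a sort are the values of its variables number `0, 1, 2`. -/
lemma exists_assignment (M : MetricStructure.{u} L) (s : L.Srt) (x y z : M.Carrier s) :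
    ∃ v : Assignment M, v s 0 = x ∧ v s 1 = y ∧ v s 2 = z := by
  classical
  let w : Assignment M := fun _ _ => Classical.arbitrary _
  refine ⟨Assignment.update (Assignment.update (w.update s 0 x) s 1 y) s 2 z, ?_⟩
  simp [Assignment.update_of_ne]

namespace Formula

/-- The value of a basic formula is bounded uniformly in the assignment. -/
lemma exists_abs_eval_le (M : MetricStructure.{u} L) (φ : Formula L) :
    ∃ C, ∀ v, |φ.eval M v| ≤ C := by
  induction φ with
  | @dist s τ σ =>
    exact ⟨L.bound s, fun v => by
      rw [Formula.eval, abs_of_nonneg dist_nonneg]; exact M.dist_le _ _ _⟩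
  | rel R τ => exact ⟨L.relBound R, fun v => M.rel_bound _ _⟩
  -- The arguments of the connective stay in a compact box, on which a continuous function is
  -- bounded.
  | conn n f hf φ ih =>
    choose C hC using ih
    obtain ⟨D, hD⟩ := (isCompact_univ_pi (fun i => isCompact_Icc (a := -C i) (b := C i))
      ).exists_bound_of_continuousOn hf.continuousOn
    refine ⟨D, fun v => ?_⟩
    exact hD _ fun i _ => abs_le.1 (hC i v)
  | sup s k φ ih =>
    obtain ⟨C, hC⟩ := ih
    refine ⟨C, fun v => abs_le.2 ⟨?_, ciSup_le fun b => (abs_le.1 (hC _)).2⟩⟩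
    exact (abs_le.1 (hC _)).1.trans (le_ciSup (f := fun b => φ.eval M (v.update s k b))
      ⟨C, by rintro _ ⟨b, rfl⟩; exact (abs_le.1 (hC _)).2⟩ (Classical.arbitrary _))
  | inf s k φ ih =>
    obtain ⟨C, hC⟩ := ih
    refine ⟨C, fun v => abs_le.2 ⟨le_ciInf fun b => (abs_le.1 (hC _)).1, ?_⟩⟩
    exact (ciInf_le (f := fun b => φ.eval M (v.update s k b))
      ⟨-C, by rintro _ ⟨b, rfl⟩; exact (abs_le.1 (hC _)).1⟩
      (Classical.arbitrary _)).trans (abs_le.1 (hC _)).2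

/-- Boundedness makes each value at most the supremum; the real supremum of an unbounded family is 0
by default and would say nothing. The value at `v` itself is reached by updating the variable with
its own value. -/
lemma eval_sup_eq_zero_iff {M : MetricStructure.{u} L} {φ : Formula L} {s : L.Srt} {k : ℕ}
    (h0 : ∀ v, 0 ≤ φ.eval M v) :
    (∀ v, (sup s k φ).eval M v = 0) ↔ ∀ v, φ.eval M v = 0 := by
  refine ⟨fun h v => le_antisymm ?_ (h0 v), fun h v => ?_⟩
  · obtain ⟨C, hC⟩ := exists_abs_eval_le M φ
    have := le_ciSup (f := fun b => φ.eval M (v.update s k b))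
      ⟨C, by rintro _ ⟨b, rfl⟩; exact (abs_le.1 (hC _)).2⟩ (v s k)
    rw [Assignment.update_self] at this
    exact this.trans (h v).le
  · simp [Formula.eval, h]

lemma eval_sup_nonneg {M : MetricStructure.{u} L} {φ : Formula L} {s : L.Srt} {k : ℕ}
    (h0 : ∀ v, 0 ≤ φ.eval M v) (v : Assignment M) : 0 ≤ (sup s k φ).eval M v :=
  Real.iSup_nonneg fun _ => h0 _

/-- A nonnegative formula that is bound by suprema vanishes if and only if it does so under every
assignment. -/
lemma eval_sup₃_eq_zero_iff {M : MetricStructure.{u} L} {φ : Formula L} {s : L.Srt}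
    (h0 : ∀ v, 0 ≤ φ.eval M v) :
    (∀ v, (sup₃ s φ).eval M v = 0) ↔ ∀ v, φ.eval M v = 0 := by
  rw [sup₃, eval_sup_eq_zero_iff (eval_sup_nonneg (eval_sup_nonneg h0)),
    eval_sup_eq_zero_iff (eval_sup_nonneg h0), eval_sup_eq_zero_iff h0]

section connectives

variable (M : MetricStructure.{u} L) (v : Assignment M) (φ ψ : Formula L)

@[simp] lemma eval_const (r : ℝ) : (const r : Formula L).eval M v = r := rfl
@[simp] lemma eval_add : (add φ ψ).eval M v = φ.eval M v + ψ.eval M v := rfl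
@[simp] lemma eval_scale (r : ℝ) : (scale r φ).eval M v = r * φ.eval M v := rfl
@[simp] lemma eval_mul : (mul φ ψ).eval M v = φ.eval M v * ψ.eval M v := rfl
@[simp] lemma eval_absDiff : (absDiff φ ψ).eval M v = |φ.eval M v - ψ.eval M v| := rfl
@[simp] lemma eval_dotminus :
    (dotminus φ ψ).eval M v = Max.max (φ.eval M v - ψ.eval M v) 0 := rfl
@[simp] lemma eval_min : (min φ ψ).eval M v = Min.min (φ.eval M v) (ψ.eval M v) := rfl

end connectives

end Formula

/-! ### Homomorphisms and the transfer of satisfaction along isomorphisms. -/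

namespace Hom

variable {M N : MetricStructure.{u} L} (ρ : Hom M N)

/-- The image of an assignment under a homomorphism. -/
def mapAssignment (v : Assignment M) : Assignment N := fun s k => ρ.toFun s (v s k)

lemma mapAssignment_update (v : Assignment M) (s : L.Srt) (k : ℕ) (b : M.Carrier s) :
    ρ.mapAssignment (v.update s k b) = (ρ.mapAssignment v).update s k (ρ.toFun s b) := by
  classical
  ext t j
  by_cases ht : t = s
  · subst ht
    by_cases hj : j = k
    · subst hj; simp [mapAssignment]
    · simp [mapAssignment, Assignment.update_of_ne, hj]
  · simp [mapAssignment, Assignment.update, ht]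

lemma eval_term (v : Assignment M) {s : L.Srt} (τ : Term L s) :
    τ.eval N (ρ.mapAssignment v) = ρ.toFun s (τ.eval M v) := by
  induction τ with
  | var s k => rfl
  | app f τ ih => simp only [Term.eval, ih, ρ.map_func]

namespace IsIsomorphism

variable {ρ}

/-- Induction on the formula. Surjectivity enters at the quantifiers: a supremum or infimum over a
sort of `N` may be taken over the images of the elements of `M`. -/
lemma eval_formula (hρ : ρ.IsIsomorphism) (φ : Formula L) (v : Assignment M) :
    φ.eval N (ρ.mapAssignment v) = φ.eval M v := by
  induction φ generalizing v with
  | dist τ σ => simp only [Formula.eval, eval_term, hρ.dist_eq]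
  | rel R τ => simp only [Formula.eval, eval_term, hρ.rel_eq]
  | conn n f hf φ ih => simp only [Formula.eval, ih]
  | sup s k φ ih =>
    simp only [Formula.eval]
    rw [← (hρ.surjective s).iSup_comp]
    simp only [← mapAssignment_update, ih]
  | inf s k φ ih =>
    simp only [Formula.eval]
    rw [← (hρ.surjective s).iInf_comp]
    simp only [← mapAssignment_update, ih]

lemma satisfies (hρ : ρ.IsIsomorphism) {T : Theory L} (h : Satisfies N T) :
    Satisfies M T := fun φ hφ v => by
  rw [← hρ.eval_formula]
  exact h φ hφ _

lemma bijective (hρ : ρ.IsIsomorphism) (s : L.Srt) : Function.Bijective (ρ.toFun s) :=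
  ⟨fun x y h => by rw [← dist_eq_zero, ← hρ.dist_eq, h, dist_self], hρ.surjective s⟩

/-- The isomorphism in the category of structures given by an isomorphism of structures. -/
noncomputable def toIso (hρ : ρ.IsIsomorphism) : M ≅ N :=
  let e s := Equiv.ofBijective _ (hρ.bijective s)
  have he : ∀ s y, ρ.toFun s ((e s).symm y) = y := fun s y => (e s).apply_symm_apply y
  { hom := ρ
    inv :=
      { toFun := fun s => (e s).symm
        map_func := fun f a => (hρ.bijective _).1 (by rw [ρ.map_func, he]; simp only [he])
        map_rel := fun R a => by rw [← hρ.rel_eq]; simp only [he]; exact le_rfl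
        map_dist := fun s x y => by rw [← hρ.dist_eq, he, he] }
    hom_inv_id := Hom.ext (funext fun s => funext fun x => (e s).symm_apply_apply x)
    inv_hom_id := Hom.ext (funext fun s => funext fun x => he s x) }

end IsIsomorphism

end Hom

lemma Isomorphic.satisfies {M N : MetricStructure.{u} L} (h : Isomorphic M N) {T : Theory L}
    (hN : Satisfies N T) : Satisfies M T := h.choose_spec.satisfies hN

/-- A fully faithful functor to models of `T`, such that every model is isomorphic to a value,
restricts to an equivalence to the category of models. -/
lemma isEquivalence_lift {C : Type*} [Category.{u} C] {T : Theory L}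
    (F : C ⥤ MetricStructure.{u} L) [F.Full] [F.Faithful] (h : ∀ X, isModel T (F.obj X))
    (hs : ∀ M : MetricStructure.{u} L, Satisfies M T → ∃ X, Isomorphic M (F.obj X)) :
    ((isModel T).lift F h).IsEquivalence where
  full := inferInstance
  faithful := inferInstance
  essSurj := ⟨fun M => by
    obtain ⟨X, ρ, hρ⟩ := hs M.obj M.property
    exact ⟨X, ⟨(isModel T).isoMk hρ.toIso.symm⟩⟩⟩

/-! ### Colimits of chains of isometric inclusions -/

/-- Metric spaces, indexed by the positive integers, with compatible isometric embeddings. -/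
structure BallChain where
  C : ℕ+ → Type u
  [metric : ∀ n, MetricSpace (C n)]
  incl : ∀ {m n : ℕ+}, m < n → C m → C n
  incl_incl : ∀ {m n k : ℕ+} (h : m < n) (h' : n < k) (x : C m),
    incl h' (incl h x) = incl (h.trans h') x
  dist_incl : ∀ {m n : ℕ+} (h : m < n) (x y : C m), dist (incl h x) (incl h y) = dist x y

namespace BallChain

attribute [instance] BallChain.metric

/-- The disjoint union of the members of a chain. -/
structure Pre (S : BallChain.{u}) : Type u where
  idx : ℕ+
  val : S.C idx

variable {S : BallChain.{u}}

/-- The distance of the images in a common larger member of the chain. -/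
def Pre.distance (a b : S.Pre) : ℝ :=
  dist (S.incl (PNat.lt_add_right a.idx b.idx) a.val)
    (S.incl (PNat.lt_add_left b.idx a.idx) b.val)

/-- Any two common larger members embed isometrically into a third one, so the distance does not
depend on where it is measured. -/
lemma Pre.distance_eq (a b : S.Pre) {k : ℕ+} (ha : a.idx < k) (hb : b.idx < k) :
    a.distance b = dist (S.incl ha a.val) (S.incl hb b.val) := by
  have h1 := PNat.lt_add_right (a.idx + b.idx) k
  have h2 := PNat.lt_add_left k (a.idx + b.idx)
  rw [Pre.distance, ← S.dist_incl h1, ← S.dist_incl h2, S.incl_incl, S.incl_incl, S.incl_incl,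
    S.incl_incl]

/-- Each metric axiom is that of a single member of the chain. Inclusions exist only for strict
inequalities, so sums of indices serve as common larger indices. An element and its inclusions have
distance 0, hence the separation quotient below. -/
noncomputable instance : PseudoMetricSpace S.Pre where
  dist := Pre.distance
  dist_self a := dist_self _
  dist_comm a b := by
    rw [a.distance_eq b (PNat.lt_add_right _ _) (PNat.lt_add_left _ _),
      b.distance_eq a (PNat.lt_add_left _ _) (PNat.lt_add_right _ _), dist_comm]
  dist_triangle a b c := by
    have ha : a.idx < a.idx + b.idx + c.idx :=
      (PNat.lt_add_right _ _).trans (PNat.lt_add_right _ _)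
    have hb : b.idx < a.idx + b.idx + c.idx :=
      (PNat.lt_add_left _ _).trans (PNat.lt_add_right _ _)
    have hc : c.idx < a.idx + b.idx + c.idx := PNat.lt_add_left _ _
    rw [a.distance_eq c ha hc, a.distance_eq b ha hb, b.distance_eq c hb hc]
    exact dist_triangle _ _ _

variable (S) in
/-- The colimit of a chain. -/
def Lim : Type u := SeparationQuotient S.Pre

noncomputable instance : MetricSpace S.Lim :=
  inferInstanceAs (MetricSpace (SeparationQuotient S.Pre))

/-- The embeddings into the colimit. -/
noncomputable def ι (n : ℕ+) (x : S.C n) : S.Lim := SeparationQuotient.mk ⟨n, x⟩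

lemma ι_incl {m n : ℕ+} (h : m < n) (x : S.C m) : ι n (S.incl h x) = ι m x := by
  refine dist_eq_zero.1 ?_
  change Pre.distance (S := S) ⟨n, S.incl h x⟩ ⟨m, x⟩ = 0
  have h1 : n < n + m := PNat.lt_add_right _ _
  rw [Pre.distance_eq _ _ h1 (h.trans h1), S.incl_incl, dist_self]

lemma dist_ι {n : ℕ+} (x y : S.C n) : dist (ι n x) (ι n y) = dist x y := by
  change Pre.distance (S := S) ⟨n, x⟩ ⟨n, y⟩ = _
  have h1 : n < n + n := PNat.lt_add_right _ _
  rw [Pre.distance_eq _ _ h1 h1, S.dist_incl]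

lemma ι_injective (n : ℕ+) : Function.Injective (ι n : S.C n → S.Lim) := fun x y h => by
  rw [← dist_eq_zero, ← dist_ι, h, dist_self]

lemma exists_ι (a : S.Lim) : ∃ n x, ι n x = a := by
  obtain ⟨⟨n, x⟩, rfl⟩ := SeparationQuotient.surjective_mk a
  exact ⟨n, x, rfl⟩

/-- Finitely many elements of the colimit come from a common member of the chain. -/
lemma exists_ι₃ (a b c : S.Lim) : ∃ n x y z, ι n x = a ∧ ι n y = b ∧ ι n z = c := by
  obtain ⟨i, x, rfl⟩ := exists_ι a
  obtain ⟨j, y, rfl⟩ := exists_ι b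
  obtain ⟨k, z, rfl⟩ := exists_ι c
  exact ⟨i + j + k, S.incl ((PNat.lt_add_right _ _).trans (PNat.lt_add_right _ _)) x,
    S.incl ((PNat.lt_add_left _ _).trans (PNat.lt_add_right _ _)) y,
    S.incl (PNat.lt_add_left _ _) z, ι_incl _ _, ι_incl _ _, ι_incl _ _⟩

lemma exists_ι₂ (a b : S.Lim) : ∃ n x y, ι n x = a ∧ ι n y = b := by
  obtain ⟨n, x, y, -, hx, hy, -⟩ := exists_ι₃ a b b
  exact ⟨n, x, y, hx, hy⟩

section lift

variable {T : Type u}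

/-- The map on the colimit induced by a compatible family of maps. -/
noncomputable def lift₁ (f : ∀ n, S.C n → T) (a : S.Lim) : T :=
  f _ (exists_ι a).choose_spec.choose

/-- The chosen representative of a point may live at another index `m`; it and `x` become equal at
index `m + n`, because the embeddings into the colimit are injective, and compatibility moves `f`
there. -/
lemma lift₁_ι {f : ∀ n, S.C n → T}
    (hf : ∀ {m n : ℕ+} (h : m < n) (x : S.C m), f m x = f n (S.incl h x))
    (n : ℕ+) (x : S.C n) : lift₁ f (ι n x) = f n x := by
  have e := (exists_ι (ι n x)).choose_spec.choose_spec
  rw [lift₁]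
  generalize (exists_ι (ι n x)).choose_spec.choose = x' at e
  generalize (exists_ι (ι n x)).choose = m at x' e
  rw [hf (PNat.lt_add_right m n), hf (PNat.lt_add_left n m)]
  congr 1
  exact ι_injective _ (by rw [ι_incl, ι_incl, e])

end lift

section lift₂

variable {T : Sort*}

/-- The binary map on the colimit induced by a compatible family of binary maps. -/
noncomputable def lift₂ (f : ∀ n, S.C n → S.C n → T) (a b : S.Lim) : T :=
  f _ (exists_ι₂ a b).choose_spec.choose (exists_ι₂ a b).choose_spec.choose_spec.choose

lemma lift₂_ι {f : ∀ n, S.C n → S.C n → T}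
    (hf : ∀ {m n : ℕ+} (h : m < n) (x y : S.C m), f m x y = f n (S.incl h x) (S.incl h y))
    (n : ℕ+) (x y : S.C n) : lift₂ f (ι n x) (ι n y) = f n x y := by
  have e := (exists_ι₂ (ι n x) (ι n y)).choose_spec.choose_spec.choose_spec
  rw [lift₂]
  generalize (exists_ι₂ (ι n x) (ι n y)).choose_spec.choose_spec.choose = y' at e
  generalize (exists_ι₂ (ι n x) (ι n y)).choose_spec.choose = x' at e
  generalize (exists_ι₂ (ι n x) (ι n y)).choose = m at x' y' e
  rw [hf (PNat.lt_add_right m n), hf (PNat.lt_add_left n m)]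
  congr 1
  exacts [ι_injective _ (by rw [ι_incl, ι_incl, e.1]), ι_injective _ (by rw [ι_incl, ι_incl, e.2])]

end lift₂

end BallChain

/-! ### Normed spaces from the laws -/

/-- The laws of a complex vector space with a translation invariant metric. -/
structure VectorLaws (V : Type u) [MetricSpace V] [Add V] [Zero V] [SMul ℂ V] : Prop where
  add_comm : ∀ a b : V, a + b = b + a
  add_assoc : ∀ a b c : V, a + b + c = a + (b + c)
  add_zero : ∀ a : V, a + 0 = a
  add_neg : ∀ a : V, a + (-1 : ℂ) • a = 0
  one_smul : ∀ a : V, (1 : ℂ) • a = a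
  mul_smul : ∀ (l m : ℂ) (a : V), (l * m) • a = l • m • a
  smul_add : ∀ (l : ℂ) (a b : V), l • (a + b) = l • a + l • b
  add_smul : ∀ (l m : ℂ) (a : V), (l + m) • a = l • a + m • a
  dist_eq : ∀ a b : V, dist a b = dist (a + (-1 : ℂ) • b) 0

namespace VectorLaws

variable {V : Type u} [MetricSpace V] [Add V] [Zero V] [SMul ℂ V]

/-- The normed group given by the laws; the norm is the distance from `0`. -/
noncomputable abbrev normedAddCommGroup (h : VectorLaws V) : NormedAddCommGroup V :=
  letI : Neg V := ⟨fun a => (-1 : ℂ) • a⟩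
  { norm a := dist a 0
    add_assoc := h.add_assoc
    zero_add a := by rw [h.add_comm, h.add_zero]
    add_zero := h.add_zero
    nsmul := nsmulRec
    zsmul := zsmulRec
    neg_add_cancel a := by
      change (-1 : ℂ) • a + a = 0
      rw [h.add_comm, h.add_neg]
    add_comm := h.add_comm
    dist_eq a b := by
      change dist a b = dist ((-1 : ℂ) • a + b) 0
      -- The norm of `-a + b` is wanted, while the law speaks of `a - b`; symmetry of the metric
      -- exchanges the two.
      rw [dist_comm, h.dist_eq, h.add_comm] }

/-- The vector space given by the laws. -/
abbrev module (h : VectorLaws V) :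
    letI := h.normedAddCommGroup
    Module ℂ V :=
  letI := h.normedAddCommGroup
  { one_smul := h.one_smul
    mul_smul := h.mul_smul
    smul_add := h.smul_add
    add_smul := h.add_smul
    smul_zero := fun l => by
      -- From `l • (0 + 0) = l • 0 + l • 0` by cancellation in the additive group.
      have := h.smul_add l 0 0
      rwa [_root_.add_zero, left_eq_add] at this
    zero_smul := fun a => by
      have := h.add_smul 0 0 a
      rwa [_root_.add_zero, left_eq_add] at this }

end VectorLaws

/-! ### Completions of normed `*`-algebras with the C*-identity -/

section Completion

open UniformSpace UniformSpace.Completion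

variable (A : Type u) [NonUnitalNormedRing A]

/-- The multiplication of the completion of a non-unital normed ring. -/
noncomputable abbrev completionMul : Mul (Completion A) :=
  ⟨Function.curry <| (isDenseInducing_coe.prodMap isDenseInducing_coe).extend
    ((↑) ∘ Function.uncurry (· * ·))⟩

lemma completion_coe_mul (a b : A) :
    letI := completionMul A
    ((a * b : A) : Completion A) = a * b :=
  ((isDenseInducing_coe.prodMap isDenseInducing_coe).extend_eq
    ((continuous_coe A).comp (@continuous_mul A _ _ _)) (a, b)).symm

/-- Multiplication is in general not uniformly continuous, so functoriality of the completion does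
not apply; instead, a continuous biadditive map on dense subgroups extends continuously. -/
lemma completion_continuousMul :
    letI := completionMul A
    ContinuousMul (Completion A) :=
  letI := completionMul A
  { continuous_mul := by
      let m := (AddMonoidHom.mul : A →+ A →+ A).compr₂ toCompl
      have : Continuous fun p : A × A => m p.1 p.2 := (continuous_coe A).comp continuous_mul
      have di : IsDenseInducing (toCompl : A → Completion A) := isDenseInducing_coe
      exact (di.extend_Z_bilin di this :) }

/-- The completion of a non-unital normed ring. -/
noncomputable abbrev completionRing : NonUnitalNormedRing (Completion A) :=
  let := completionMul A
  have := completion_continuousMul A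
  { (inferInstance : NormedAddCommGroup (Completion A)), completionMul A with
    -- This and the following laws are closed conditions, so they need checking only on the dense
    -- image of `A`.
    zero_mul := fun a => by
      induction a using induction_on with
      | hp => exact isClosed_eq (by fun_prop) continuous_const
      | ih a => rw [← coe_zero, ← completion_coe_mul, zero_mul]
    mul_zero := fun a => by
      induction a using induction_on with
      | hp => exact isClosed_eq (by fun_prop) continuous_const
      | ih a => rw [← coe_zero, ← completion_coe_mul, mul_zero]
    mul_assoc := fun a b c => by
      induction a, b, c using induction_on₃ with
      | hp => exact isClosed_eq (by fun_prop) (by fun_prop)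
      | ih a b c => simp only [← completion_coe_mul, mul_assoc]
    left_distrib := fun a b c => by
      induction a, b, c using induction_on₃ with
      | hp => exact isClosed_eq (by fun_prop) (by fun_prop)
      | ih a b c => simp only [← completion_coe_mul, ← coe_add, mul_add]
    right_distrib := fun a b c => by
      induction a, b, c using induction_on₃ with
      | hp => exact isClosed_eq (by fun_prop) (by fun_prop)
      | ih a b c => simp only [← completion_coe_mul, ← coe_add, add_mul]
    norm_mul_le := fun a b => by
      induction a, b using induction_on₂ with
      | hp => exact isClosed_le (by fun_prop) (by fun_prop)
      | ih a b => simpa only [← completion_coe_mul, norm_coe] using norm_mul_le a b }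

section

variable [NormedSpace ℂ A]

lemma completion_smul_mul [IsScalarTower ℂ A A] (l : ℂ) (a b : Completion A) :
    letI := completionMul A
    (l • a) * b = l • (a * b) := by
  let := completionMul A
  have := completion_continuousMul A
  induction a, b using induction_on₂ with
  | hp =>
    exact isClosed_eq ((continuous_fst.const_smul l).mul continuous_snd)
      ((continuous_fst.mul continuous_snd).const_smul l)
  | ih a b =>
    rw [← completion_coe_mul, ← coe_smul, ← coe_smul, ← completion_coe_mul, smul_mul_assoc]

lemma completion_mul_smul [SMulCommClass ℂ A A] (l : ℂ) (a b : Completion A) :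
    letI := completionMul A
    a * (l • b) = l • (a * b) := by
  let := completionMul A
  have := completion_continuousMul A
  induction a, b using induction_on₂ with
  | hp =>
    exact isClosed_eq (continuous_fst.mul (continuous_snd.const_smul l))
      ((continuous_fst.mul continuous_snd).const_smul l)
  | ih a b =>
    rw [← completion_coe_mul, ← coe_smul, ← coe_smul, ← completion_coe_mul, mul_smul_comm]

end

variable [StarRing A]

/-- The involution of the completion of a normed `*`-ring. -/
noncomputable abbrev completionStar : Star (Completion A) := ⟨Completion.map star⟩

variable [CStarRing A]

/-- By the C*-identity the involution is isometric, hence uniformly continuous, which is what makes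
its extension agree with it on `A`. -/
lemma completion_coe_star (a : A) :
    letI := completionStar A
    ((star a : A) : Completion A) = star (a : Completion A) :=
  (map_coe (starNormedAddGroupHom (E := A)).uniformContinuous a).symm

variable [NormedSpace ℂ A] [StarModule ℂ A]

lemma completion_star_smul (l : ℂ) (a : Completion A) :
    letI := completionStar A
    star (l • a) = star l • star a := by
  let := completionStar A
  induction a using induction_on with
  | hp =>
    have h : Continuous (Completion.map (star : A → A)) := continuous_map
    exact isClosed_eq (h.comp (continuous_const_smul l)) (h.const_smul (star l))
  | ih a => rw [← coe_smul, ← completion_coe_star, ← completion_coe_star, star_smul, coe_smul]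

variable [IsScalarTower ℂ A A] [SMulCommClass ℂ A A]

/-- The completion of a normed `*`-algebra with the C*-identity is a C*-algebra. -/
noncomputable abbrev completionCStar : NonUnitalCStarAlgebra (Completion A) :=
  letI := completionRing A
  letI := completionStar A
  haveI : ContinuousStar (Completion A) := ⟨continuous_map⟩
  { completionRing A, completionStar A, (inferInstance : CompleteSpace (Completion A)),
    (inferInstance : NormedSpace ℂ (Completion A)) with
    star_involutive := fun a => by
      induction a using induction_on with
      | hp => exact isClosed_eq (by fun_prop) (by fun_prop)
      | ih a => rw [← completion_coe_star, ← completion_coe_star, star_star]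
    star_mul := fun a b => by
      induction a, b using induction_on₂ with
      | hp => exact isClosed_eq (by fun_prop) (by fun_prop)
      | ih a b => simp only [← completion_coe_mul, ← completion_coe_star, star_mul]
    star_add := fun a b => by
      induction a, b using induction_on₂ with
      | hp => exact isClosed_eq (by fun_prop) (by fun_prop)
      | ih a b => simp only [← coe_add, ← completion_coe_star, star_add]
    norm_mul_self_le := fun a => by
      induction a using induction_on with
      | hp => exact isClosed_le (by fun_prop) (by fun_prop)
      | ih a =>
        simpa only [← completion_coe_mul, ← completion_coe_star, norm_coe] using
          CStarRing.norm_mul_self_le a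
    smul_assoc := completion_smul_mul A
    smul_comm := fun l a b => (completion_mul_smul A l a b).symm
    star_smul := completion_star_smul A }

end Completion

/-! ### Realizations of structures for the language of C*-algebras -/

namespace CStarLang

variable {Q : ℕ+ → ℕ → StarPoly}

section func

variable (M : MetricStructure.{u} (CStarLang Q))

/-- The interpretation of a sort. -/
abbrev Car (n : ℕ+) : Type u := M.Carrier (n : (CStarLang Q).Srt)

instance (n : ℕ+) : MetricSpace (Car M n) := M.metric n

instance (n : ℕ+) : CompleteSpace (Car M n) := M.complete n

variable {M}

/-- The interpretation of `+_n`. -/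
def fadd {n : ℕ+} (x y : Car M n) : Car M (2 * n) :=
  M.func (CStarFunc.add n) (![x, y] : Fin 2 → Car M n)

/-- The interpretation of `·_n`. -/
def fmul {n : ℕ+} (x y : Car M n) : Car M (n ^ 2) :=
  M.func (CStarFunc.mul n) (![x, y] : Fin 2 → Car M n)

/-- The interpretation of `*_n`. -/
def fstar {n : ℕ+} (x : Car M n) : Car M n := M.func (CStarFunc.star n) fun _ => x

variable (M) in
/-- The interpretation of `0_n`. -/
def fzero (n : ℕ+) : Car M n := M.func (CStarFunc.zero n) fun i => Fin.elim0 i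

/-- The interpretation of `lam_n`. -/
def fsmul (lam : ℂ) {n : ℕ+} (x : Car M n) : Car M (scalCod lam n) :=
  M.func (CStarFunc.smul lam n) fun _ => x

/-- The interpretation of `i_{m,n}`. -/
def fincl {m n : ℕ+} (h : m < n) (x : Car M m) : Car M n :=
  M.func (CStarFunc.incl m n h) fun _ => x

/-- The interpretation of `q^n_k`. -/
def fpoly {n : ℕ+} (k : ℕ) (x : Car M n) : Car M 1 := M.func (CStarFunc.poly n k) fun _ => x

/-- A term supplies its arguments as an arbitrary function on `Fin 2`; this and the next lemmas
bring such arguments into the explicit form used by `fadd` and its companions. -/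
lemma func_add (n : ℕ+) (a : Fin 2 → Car M n) :
    M.func (CStarFunc.add n) a = fadd (a 0) (a 1) :=
  congrArg (M.func (CStarFunc.add n)) (funext fun i : Fin 2 => by fin_cases i <;> rfl)

lemma func_mul (n : ℕ+) (a : Fin 2 → Car M n) :
    M.func (CStarFunc.mul n) a = fmul (a 0) (a 1) :=
  congrArg (M.func (CStarFunc.mul n)) (funext fun i : Fin 2 => by fin_cases i <;> rfl)

lemma func_star (n : ℕ+) (a : Fin 1 → Car M n) : M.func (CStarFunc.star n) a = fstar (a 0) :=
  congrArg (M.func (CStarFunc.star n)) (funext fun i : Fin 1 => by fin_cases i; rfl)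

lemma func_zero (n : ℕ+) (a : Fin 0 → Car M n) : M.func (CStarFunc.zero n) a = fzero M n :=
  congrArg (M.func (CStarFunc.zero n)) (funext fun i : Fin 0 => i.elim0)

lemma func_smul (lam : ℂ) (n : ℕ+) (a : Fin 1 → Car M n) :
    M.func (CStarFunc.smul lam n) a = fsmul lam (a 0) :=
  congrArg (M.func (CStarFunc.smul lam n)) (funext fun i : Fin 1 => by fin_cases i; rfl)

lemma func_incl {m n : ℕ+} (h : m < n) (a : Fin 1 → Car M m) :
    M.func (CStarFunc.incl m n h) a = fincl h (a 0) :=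
  congrArg (M.func (CStarFunc.incl m n h)) (funext fun i : Fin 1 => by fin_cases i; rfl)

lemma func_poly (n : ℕ+) (k : ℕ) (a : Fin 1 → Car M n) :
    M.func (CStarFunc.poly n k) a = fpoly k (a 0) :=
  congrArg (M.func (CStarFunc.poly n k)) (funext fun i : Fin 1 => by fin_cases i; rfl)

end func

/-- Compatible isometric maps of the sorts of a structure to a space with operations, under which
the algebraic function symbols become the operations. -/
structure Realization (M : MetricStructure.{u} (CStarLang Q)) (A : Type u) [MetricSpace A] [Add A]
    [Mul A] [Star A] [Zero A] [SMul ℂ A] where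
  toFun : ∀ n, Car M n → A
  dist_eq : ∀ {n : ℕ+} (x y : Car M n), dist (toFun n x) (toFun n y) = dist x y
  add : ∀ {n : ℕ+} (x y : Car M n), toFun _ (fadd x y) = toFun n x + toFun n y
  mul : ∀ {n : ℕ+} (x y : Car M n), toFun _ (fmul x y) = toFun n x * toFun n y
  star : ∀ {n : ℕ+} (x : Car M n), toFun _ (fstar x) = star (toFun n x)
  zero : ∀ n : ℕ+, toFun n (fzero M n) = 0
  smul : ∀ (lam : ℂ) {n : ℕ+} (x : Car M n), toFun _ (fsmul lam x) = lam • toFun n x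
  incl : ∀ {m n : ℕ+} (h : m < n) (x : Car M m), toFun n (fincl h x) = toFun m x

namespace Realization

variable {M : MetricStructure.{u} (CStarLang Q)} {A : Type u} [MetricSpace A] [Add A]
    [Mul A] [Star A] [Zero A] [SMul ℂ A] (r : Realization M A) (v : Assignment M)

/-- The realization of the value of a term. -/
noncomputable def val {n : ℕ+} (τ : Tm Q n) : A := r.toFun n (τ.eval M v)

@[simp] lemma val_tvar (n : ℕ+) (k : ℕ) : r.val v (tvar n k) = r.toFun n (v n k) := rfl

@[simp] lemma val_tadd {n : ℕ+} (σ τ : Tm Q n) :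
    r.val v (tadd σ τ) = r.val v σ + r.val v τ :=
  (congrArg _ (func_add n _)).trans (r.add _ _)

@[simp] lemma val_tmul {n : ℕ+} (σ τ : Tm Q n) :
    r.val v (tmul σ τ) = r.val v σ * r.val v τ :=
  (congrArg _ (func_mul n _)).trans (r.mul _ _)

@[simp] lemma val_tstar {n : ℕ+} (τ : Tm Q n) : r.val v (tstar τ) = Star.star (r.val v τ) :=
  (congrArg _ (func_star n _)).trans (r.star _)

@[simp] lemma val_tzero (n : ℕ+) : r.val v (tzero n) = 0 :=
  (congrArg _ (func_zero n _)).trans (r.zero n)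

@[simp] lemma val_tsmul (lam : ℂ) {n : ℕ+} (τ : Tm Q n) :
    r.val v (tsmul lam τ) = lam • r.val v τ :=
  (congrArg _ (func_smul lam n _)).trans (r.smul lam _)

@[simp] lemma val_tincl {m n : ℕ+} (h : m < n) (τ : Tm Q m) :
    r.val v (tincl h τ) = r.val v τ :=
  (congrArg _ (func_incl h _)).trans (r.incl h _)

/-- A realization does not require that the symbols q^n_k act as polynomials, so the value cannot be
reduced further here; that step is the axiom `poly`. -/
lemma val_tpoly {n : ℕ+} (k : ℕ) (τ : Tm Q n) :
    r.val v (tpoly k τ) = r.toFun 1 (fpoly k (τ.eval M v)) :=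
  congrArg _ (func_poly n k _)

@[simp] lemma val_tadd' {m n : ℕ+} (σ : Tm Q m) (τ : Tm Q n) :
    r.val v (tadd' σ τ) = r.val v σ + r.val v τ := by
  rw [tadd', val_tadd, val_tincl, val_tincl]

@[simp] lemma val_tmul' {m n : ℕ+} (σ : Tm Q m) (τ : Tm Q n) :
    r.val v (tmul' σ τ) = r.val v σ * r.val v τ := by
  rw [tmul', val_tmul, val_tincl, val_tincl]

lemma eval_dist {n : ℕ+} (σ τ : Tm Q n) :
    (Formula.dist (L := CStarLang Q) (s := n) σ τ).eval M v = dist (r.val v σ) (r.val v τ) :=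
  (r.dist_eq _ _).symm

/-- Inclusions disappear in `A`, so the comparison of terms of different sorts becomes a plain
distance in `A`. Thereby each equational axiom becomes an identity in `A`. -/
lemma eval_dst {m n : ℕ+} (σ : Tm Q m) (τ : Tm Q n) :
    (dst σ τ).eval M v = dist (r.val v σ) (r.val v τ) := by
  rw [dst, r.eval_dist, val_tincl, val_tincl]

lemma eval_nrm {n : ℕ+} (τ : Tm Q n) : (nrm τ).eval M v = dist (r.val v τ) 0 := by
  rw [nrm, r.eval_dist, val_tzero]

end Realization

lemma Realization.val_polyTerm {M : MetricStructure.{u} (CStarLang Q)} {A : Type u}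
    [NonUnitalCStarAlgebra A] (r : Realization M A) (v : Assignment M) (n : ℕ+) (p : StarPoly) :
    r.val v (polyTerm n p) = p.eval (r.toFun n (v n 0)) := by
  induction p with
  | X => rfl
  | zero => exact r.val_tzero v n
  | add p q hp hq => exact (r.val_tadd' v _ _).trans (congrArg₂ _ hp hq)
  | mul p q hp hq => exact (r.val_tmul' v _ _).trans (congrArg₂ _ hp hq)
  | star p hp => exact (r.val_tstar v _).trans (congrArg _ hp)
  | smul c p hp => exact (r.val_tsmul v c _).trans (congrArg _ hp)

lemma eval_all_eq_zero {M : MetricStructure.{u} (CStarLang Q)} {n : ℕ+} {φ : Fm Q}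
    (h0 : ∀ v, 0 ≤ φ.eval M v) (h : ∀ v, φ.eval M v = 0) (v : Assignment M) :
    (all n φ).eval M v = 0 := (Formula.eval_sup₃_eq_zero_iff h0).2 h v

/-- A structure realized in the balls of a C*-algebra is a model of the theory. -/
theorem Realization.satisfies {M : MetricStructure.{u} (CStarLang Q)} {A : Type u}
    [NonUnitalCStarAlgebra A] (r : Realization M A)
    (norm_le : ∀ (n : ℕ+) (x : Car M n), ‖r.toFun n x‖ ≤ n)
    (poly : ∀ (n : ℕ+) (k : ℕ) (x : Car M n), r.toFun 1 (fpoly k x) = (Q n k).eval (r.toFun n x)) :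
    Satisfies M (TCStar Q) := by
  rintro ⟨φ, hφ⟩ (h : Axioms Q φ)
  change ∀ v, φ.eval M v = 0
  -- Every axiom binds a distance, an absolute difference or a truncated difference, all
  -- nonnegative, so the suprema can be dropped. The equational axioms then become algebraic
  -- identities, and the metric ones are left for the cases below.
  cases h <;> refine eval_all_eq_zero (fun v => ?_) (fun v => ?_) <;>
    first
    | exact dist_nonneg
    | exact abs_nonneg _
    | exact le_max_right _ _
    | simp [r.eval_dist, r.eval_nrm, r.eval_dst, smul_smul, add_smul, mul_add, add_mul,
        mul_assoc, add_comm, add_assoc, smul_mul_assoc, mul_smul_comm]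
  case dist_eq => rw [dist_eq_norm, ← sub_eq_add_neg, sub_self]
  case norm_add => exact norm_add_le _ _
  case norm_smul => rw [norm_smul, sub_self]
  case norm_mul => exact norm_mul_le _ _
  case cstar => rw [CStarRing.norm_star_mul_self, sub_self]
  case norm_le => exact norm_le _ _
  case poly => rw [r.val_polyTerm, r.val_tpoly, poly]; rfl

end CStarLang

namespace CStarLang

/-! ### The C*-algebra of a model -/

variable {Q : ℕ+ → ℕ → StarPoly} {M : MetricStructure.{u} (CStarLang Q)}

/-- Strips the suprema from an axiom, so that it can be used at any chosen elements. -/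
lemma eval_eq_zero_of_satisfies (hM : Satisfies M (TCStar Q)) {n : ℕ+} {φ : Fm Q}
    (h : Axioms Q (all n φ)) (h0 : ∀ v, 0 ≤ φ.eval M v) (v : Assignment M) : φ.eval M v = 0 :=
  (Formula.eval_sup₃_eq_zero_iff h0).1 (hM ⟨_, h.closed⟩ h) v

lemma eval_tadd {n : ℕ+} (σ τ : Tm Q n) (v : Assignment M) :
    (tadd σ τ).eval M v = fadd (σ.eval M v) (τ.eval M v) := func_add n _

lemma eval_tmul {n : ℕ+} (σ τ : Tm Q n) (v : Assignment M) :
    (tmul σ τ).eval M v = fmul (σ.eval M v) (τ.eval M v) := func_mul n _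

lemma eval_tstar {n : ℕ+} (τ : Tm Q n) (v : Assignment M) :
    (tstar τ).eval M v = fstar (τ.eval M v) := func_star n _

lemma eval_tzero (n : ℕ+) (v : Assignment M) : (tzero n : Tm Q n).eval M v = fzero M n :=
  func_zero n _

lemma eval_tsmul (lam : ℂ) {n : ℕ+} (τ : Tm Q n) (v : Assignment M) :
    (tsmul lam τ).eval M v = fsmul lam (τ.eval M v) := func_smul lam n _

lemma eval_tincl {m n : ℕ+} (h : m < n) (τ : Tm Q m) (v : Assignment M) :
    (tincl h τ).eval M v = fincl h (τ.eval M v) := func_incl h _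

lemma eval_tvar (n : ℕ+) (k : ℕ) (v : Assignment M) : (tvar n k : Tm Q n).eval M v = v n k := rfl

/-- The sorts of a model, with the inclusions. -/
def chain (hM : Satisfies M (TCStar Q)) : BallChain.{u} where
  C n := Car M n
  incl h := fincl h
  incl_incl {m n k} h h' x := by
    -- Writing the given element as the value of a variable lets the axiom speak of it.
    obtain ⟨v, rfl, -⟩ := exists_assignment M m x x x
    have := dist_eq_zero.1 (eval_eq_zero_of_satisfies hM (.incl_incl m n k h h')
      (fun _ => dist_nonneg) v)
    simpa only [eval_tincl, eval_tvar] using this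
  dist_incl {m n} h x y := by
    obtain ⟨v, rfl, rfl, -⟩ := exists_assignment M m x y y
    have := sub_eq_zero.1 (abs_eq_zero.1 (eval_eq_zero_of_satisfies hM (.incl_dist m n h)
      (fun _ => abs_nonneg _) v))
    change dist ((tincl h (tvar m 0)).eval M v) ((tincl h (tvar m 1)).eval M v) =
      dist (v m 0) (v m 1) at this
    simpa only [eval_tincl, eval_tvar] using this

/-- The union of the sorts of a model. -/
def Union (hM : Satisfies M (TCStar Q)) : Type u := (chain hM).Lim

namespace Union

variable {hM : Satisfies M (TCStar Q)}

noncomputable instance : MetricSpace (Union hM) := inferInstanceAs (MetricSpace (chain hM).Lim)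

/-- The embedding of a sort. -/
noncomputable def ι (n : ℕ+) (x : Car M n) : Union hM := (chain hM).ι n x

lemma ι_incl {m n : ℕ+} (h : m < n) (x : Car M m) :
    (ι n (fincl h x) : Union hM) = ι m x := BallChain.ι_incl (S := chain hM) h x

lemma exists_ι₃ (a b c : Union hM) : ∃ n x y z, ι n x = a ∧ ι n y = b ∧ ι n z = c :=
  BallChain.exists_ι₃ (S := chain hM) a b c

/-- An axiom that compares two terms identifies their values in the union. -/
lemma ι_eq_of_axiom {n j k : ℕ+} {σ : Tm Q j} {τ : Tm Q k} (h : Axioms Q (all n (dst σ τ)))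
    (v : Assignment M) : (ι j (σ.eval M v) : Union hM) = ι k (τ.eval M v) := by
  have := dist_eq_zero.1 (eval_eq_zero_of_satisfies hM h (fun _ => dist_nonneg) v)
  rw [eval_tincl, eval_tincl] at this
  rw [← ι_incl (PNat.lt_add_right j k), this, ι_incl]

noncomputable instance : Zero (Union hM) := ⟨ι 1 (fzero M 1)⟩

noncomputable instance : Add (Union hM) :=
  ⟨BallChain.lift₂ (S := chain hM) fun n x y => (ι _ (fadd (n := n) x y) : Union hM)⟩

noncomputable instance : Mul (Union hM) :=
  ⟨BallChain.lift₂ (S := chain hM) fun n x y => (ι _ (fmul (n := n) x y) : Union hM)⟩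

noncomputable instance : Star (Union hM) :=
  ⟨BallChain.lift₁ (S := chain hM) fun n x => (ι _ (fstar (n := n) x) : Union hM)⟩

noncomputable instance : SMul ℂ (Union hM) :=
  ⟨fun lam => BallChain.lift₁ (S := chain hM) fun n x => (ι _ (fsmul lam (n := n) x) : Union hM)⟩

lemma ι_zero (n : ℕ+) : (ι n (fzero M n) : Union hM) = 0 := by
  -- The zero of the union is that of `S_1` by definition; there is no inclusion symbol from `S_1`
  -- to itself, hence the separate case.
  rcases (one_le (a := n)).eq_or_lt with rfl | h
  · rfl
  · have := dist_eq_zero.1 (eval_eq_zero_of_satisfies hM (.incl_zero 1 n h) (fun _ => dist_nonneg)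
      fun _ _ => Classical.arbitrary _)
    rw [eval_tincl] at this
    rw [eval_tzero, eval_tzero] at this
    rw [← this, ι_incl]
    rfl

/-- Well-definedness is the axiom `incl_add`: the sum formed in `S_m` and the one formed after
inclusion into `S_n` lie in different sorts, but have the same image in the union. The other
operations are treated alike. -/
lemma ι_add {n : ℕ+} (x y : Car M n) : (ι _ (fadd x y) : Union hM) = ι n x + ι n y := by
  refine (BallChain.lift₂_ι (S := chain hM) (f := fun n x y => (ι _ (fadd (n := n) x y) : Union hM))
    (fun {m n} h x y => ?_) n x y).symm
  obtain ⟨v, rfl, rfl, -⟩ := exists_assignment M m x y y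
  have := ι_eq_of_axiom (hM := hM) (.incl_add m n h) v
  rwa [eval_tadd, eval_tadd, eval_tincl, eval_tincl] at this

lemma ι_mul {n : ℕ+} (x y : Car M n) : (ι _ (fmul x y) : Union hM) = ι n x * ι n y := by
  refine (BallChain.lift₂_ι (S := chain hM) (f := fun n x y => (ι _ (fmul (n := n) x y) : Union hM))
    (fun {m n} h x y => ?_) n x y).symm
  obtain ⟨v, rfl, rfl, -⟩ := exists_assignment M m x y y
  have := ι_eq_of_axiom (hM := hM) (.incl_mul m n h) v
  rwa [eval_tmul, eval_tmul, eval_tincl, eval_tincl] at this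

lemma ι_star {n : ℕ+} (x : Car M n) : (ι _ (fstar x) : Union hM) = star (ι n x) := by
  refine (BallChain.lift₁_ι (S := chain hM) (f := fun n x => (ι _ (fstar (n := n) x) : Union hM))
    (fun {m n} h x => ?_) n x).symm
  obtain ⟨v, rfl, -⟩ := exists_assignment M m x x x
  have := ι_eq_of_axiom (hM := hM) (.incl_star m n h) v
  rwa [eval_tstar, eval_tstar, eval_tincl] at this

lemma ι_smul (lam : ℂ) {n : ℕ+} (x : Car M n) :
    (ι _ (fsmul lam x) : Union hM) = lam • ι n x := by
  refine (BallChain.lift₁_ι (S := chain hM)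
    (f := fun n x => (ι _ (fsmul lam (n := n) x) : Union hM)) (fun {m n} h x => ?_) n x).symm
  obtain ⟨v, rfl, -⟩ := exists_assignment M m x x x
  have := ι_eq_of_axiom (hM := hM) (.incl_smul lam m n h) v
  rwa [eval_tsmul, eval_tsmul, eval_tincl] at this

variable (hM) in
/-- A model is realized in the union of its sorts. -/
noncomputable def realization : Realization M (Union hM) where
  toFun := ι
  dist_eq x y := BallChain.dist_ι (S := chain hM) x y
  add := ι_add
  mul := ι_mul
  star := ι_star
  zero := ι_zero
  smul := ι_smul
  incl := ι_incl

/-- The axioms, with three variables, hold for any three elements of the union. -/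
lemma exists_val (a b c : Union hM) : ∃ (n : ℕ+) (v : Assignment M),
    (realization hM).toFun n (v n 0) = a ∧ (realization hM).toFun n (v n 1) = b ∧
      (realization hM).toFun n (v n 2) = c := by
  obtain ⟨n, x, y, z, rfl, rfl, rfl⟩ := exists_ι₃ a b c
  obtain ⟨v, rfl, rfl, rfl⟩ := exists_assignment M n x y z
  exact ⟨n, v, rfl, rfl, rfl⟩

lemma val_eq_of_axiom {n j k : ℕ+} {σ : Tm Q j} {τ : Tm Q k} (h : Axioms Q (all n (dst σ τ)))
    (v : Assignment M) : (realization hM).val v σ = (realization hM).val v τ :=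
  ι_eq_of_axiom h v

/-- Each law concerns at most three elements; these are values of variables of one sort `S_n`, and
the axiom for that `n`, evaluated in the union, is the law. -/
lemma vectorLaws : VectorLaws (Union hM) where
  add_comm a b := by
    obtain ⟨n, v, rfl, rfl, -⟩ := exists_val a b b
    simpa using val_eq_of_axiom (hM := hM) (.add_comm n) v
  add_assoc a b c := by
    obtain ⟨n, v, rfl, rfl, rfl⟩ := exists_val a b c
    simpa using val_eq_of_axiom (hM := hM) (.add_assoc n) v
  add_zero a := by
    obtain ⟨n, v, rfl, -⟩ := exists_val a a a
    simpa using val_eq_of_axiom (hM := hM) (.add_zero n) v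
  add_neg a := by
    obtain ⟨n, v, rfl, -⟩ := exists_val a a a
    simpa using val_eq_of_axiom (hM := hM) (.add_neg n) v
  one_smul a := by
    obtain ⟨n, v, rfl, -⟩ := exists_val a a a
    simpa using val_eq_of_axiom (hM := hM) (.one_smul n) v
  mul_smul l m a := by
    obtain ⟨n, v, rfl, -⟩ := exists_val a a a
    simpa using val_eq_of_axiom (hM := hM) (.mul_smul l m n) v
  smul_add l a b := by
    obtain ⟨n, v, rfl, rfl, -⟩ := exists_val a b b
    simpa using val_eq_of_axiom (hM := hM) (.smul_add l n) v
  add_smul l m a := by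
    obtain ⟨n, v, rfl, -⟩ := exists_val a a a
    simpa using val_eq_of_axiom (hM := hM) (.add_smul l m n) v
  dist_eq a b := by
    obtain ⟨n, v, rfl, rfl, -⟩ := exists_val a b b
    have := eval_eq_zero_of_satisfies hM (.dist_eq n) (fun _ => abs_nonneg _) v
    simpa [(realization hM).eval_dist, (realization hM).eval_nrm, sub_eq_zero] using this

lemma union_mul_add (a b c : Union hM) : a * (b + c) = a * b + a * c := by
  obtain ⟨n, v, rfl, rfl, rfl⟩ := exists_val a b c
  simpa using val_eq_of_axiom (hM := hM) (.mul_add n) v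

lemma union_add_mul (a b c : Union hM) : (a + b) * c = a * c + b * c := by
  obtain ⟨n, v, rfl, rfl, rfl⟩ := exists_val a b c
  simpa using val_eq_of_axiom (hM := hM) (.add_mul n) v

/-- Formulated with the distance from `0`, since this is what the axioms measure; the norm
introduced below is this distance by definition. -/
lemma union_dist_mul_le (a b : Union hM) : dist (a * b) 0 ≤ dist a 0 * dist b 0 := by
  obtain ⟨n, v, rfl, rfl, -⟩ := exists_val a b b
  have := eval_eq_zero_of_satisfies hM (.norm_mul n) (fun _ => le_max_right _ _) v
  simpa [(realization hM).eval_nrm] using this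

lemma union_dist_star_mul (a : Union hM) : dist (star a * a) 0 = dist a 0 * dist a 0 := by
  obtain ⟨n, v, rfl, -⟩ := exists_val a a a
  have := eval_eq_zero_of_satisfies hM (.cstar n) (fun _ => abs_nonneg _) v
  simpa [(realization hM).eval_nrm, sub_eq_zero] using this

lemma union_dist_smul (l : ℂ) (a : Union hM) : dist (l • a) 0 = ‖l‖ * dist a 0 := by
  obtain ⟨n, v, rfl, -⟩ := exists_val a a a
  have := eval_eq_zero_of_satisfies hM (.norm_smul l n) (fun _ => abs_nonneg _) v
  simpa [(realization hM).eval_nrm, sub_eq_zero] using this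

noncomputable instance : NonUnitalNormedRing (Union hM) :=
  letI := (vectorLaws (hM := hM)).normedAddCommGroup
  { vectorLaws.normedAddCommGroup with
    mul := (· * ·)
    left_distrib := union_mul_add
    right_distrib := union_add_mul
    zero_mul := fun a => by
      have := union_add_mul 0 0 a
      rwa [add_zero, left_eq_add] at this
    mul_zero := fun a => by
      have := union_mul_add a 0 0
      rwa [add_zero, left_eq_add] at this
    mul_assoc := fun a b c => by
      obtain ⟨n, v, rfl, rfl, rfl⟩ := exists_val a b c
      simpa using val_eq_of_axiom (hM := hM) (.mul_assoc n) v
    norm_mul_le := union_dist_mul_le }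

noncomputable instance : NormedSpace ℂ (Union hM) :=
  { vectorLaws.module with norm_smul_le := fun l a => (union_dist_smul l a).le }

instance : IsScalarTower ℂ (Union hM) (Union hM) :=
  ⟨fun l a b => by
    obtain ⟨n, v, rfl, rfl, -⟩ := exists_val a b b
    simpa using val_eq_of_axiom (hM := hM) (.smul_mul l n) v⟩

instance : SMulCommClass ℂ (Union hM) (Union hM) :=
  ⟨fun l a b => by
    obtain ⟨n, v, rfl, rfl, -⟩ := exists_val a b b
    simpa using (val_eq_of_axiom (hM := hM) (.mul_smul_comm l n) v).symm⟩

noncomputable instance : StarRing (Union hM) where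
  star_involutive a := by
    obtain ⟨n, v, rfl, -⟩ := exists_val a a a
    simpa using val_eq_of_axiom (hM := hM) (.star_star n) v
  star_mul a b := by
    obtain ⟨n, v, rfl, rfl, -⟩ := exists_val a b b
    simpa using val_eq_of_axiom (hM := hM) (.star_mul n) v
  star_add a b := by
    obtain ⟨n, v, rfl, rfl, -⟩ := exists_val a b b
    simpa using val_eq_of_axiom (hM := hM) (.star_add n) v

instance : StarModule ℂ (Union hM) :=
  ⟨fun l a => by
    obtain ⟨n, v, rfl, -⟩ := exists_val a a a
    simpa using val_eq_of_axiom (hM := hM) (.star_smul l n) v⟩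

instance : CStarRing (Union hM) := ⟨fun a => (union_dist_star_mul a).ge⟩

end Union

open UniformSpace

noncomputable instance (hM : Satisfies M (TCStar Q)) :
    NonUnitalCStarAlgebra (Completion (Union hM)) := completionCStar _

/-- A model is realized in the C*-algebra that completes the union of its sorts. -/
noncomputable def completionRealization (hM : Satisfies M (TCStar Q)) :
    Realization M (Completion (Union hM)) where
  toFun n x := ((Union.realization hM).toFun n x : Union hM)
  dist_eq x y := by rw [Completion.dist_eq, Realization.dist_eq]
  add x y := by rw [Realization.add, Completion.coe_add]
  mul x y := by rw [Realization.mul]; exact completion_coe_mul _ _ _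
  star x := by rw [Realization.star]; exact completion_coe_star _ _
  zero n := by rw [Realization.zero, Completion.coe_zero]
  smul l n x := by rw [Realization.smul, Completion.coe_smul]
  incl h x := by rw [Realization.incl]

/-- The axiom `poly` equates the symbol with a term, and in a C*-algebra that term has the value of
the polynomial. Consequently the values of q^n_k on `S_n` lie in the image of `S_1`. -/
lemma Realization.poly_of_satisfies (hM : Satisfies M (TCStar Q)) {A : Type u}
    [NonUnitalCStarAlgebra A] (r : Realization M A) {n : ℕ+} (k : ℕ) (x : Car M n) :
    r.toFun 1 (fpoly k x) = (Q n k).eval (r.toFun n x) := by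
  obtain ⟨v, rfl, -⟩ := exists_assignment M n x x x
  have := eval_eq_zero_of_satisfies hM (.poly n k) (fun _ => dist_nonneg) v
  rw [r.eval_dst, dist_eq_zero, r.val_polyTerm, r.val_tpoly] at this
  exact this

lemma Realization.norm_le_of_satisfies (hM : Satisfies M (TCStar Q)) {A : Type u}
    [NonUnitalCStarAlgebra A] (r : Realization M A) {n : ℕ+} (x : Car M n) :
    ‖r.toFun n x‖ ≤ n := by
  obtain ⟨v, rfl, -⟩ := exists_assignment M n x x x
  have := eval_eq_zero_of_satisfies hM (.norm_le n) (fun _ => le_max_right _ _) v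
  simpa [r.eval_nrm] using this

end CStarLang

/-! ### Balls -/

/-- A closed set that contains the open unit ball of a dense set contains the closed unit ball. -/
lemma mem_of_norm_le_one_of_dense {E : Type u} [NormedAddCommGroup E] [NormedSpace ℂ E]
    {s D : Set E} (hs : IsClosed s) (hD : Dense D) (h : ∀ a ∈ D, ‖a‖ < 1 → a ∈ s) {a : E}
    (ha : ‖a‖ ≤ 1) : a ∈ s := by
  -- A dense set meets an open ball in a dense subset of it. The closed ball is reached afterwards,
  -- as the closure of the open one in a real normed space.
  have h1 : Metric.ball (0 : E) 1 ⊆ s := by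
    refine (hD.open_subset_closure_inter Metric.isOpen_ball).trans
      (hs.closure_subset_iff.2 fun b hb => h b hb.2 (by simpa using hb.1))
  have h2 := hs.closure_subset_iff.2 h1
  let : NormedSpace ℝ E := NormedSpace.restrictScalars ℝ ℂ E
  rw [closure_ball _ one_ne_zero] at h2
  exact h2 (by simpa using ha)

/-- Multiplication by `n` leads from `S_1` to exactly `S_n`, so a statement on the unit ball can be
scaled up inside the structure. -/
lemma scalCod_natCast (n : ℕ+) : scalCod ((n : ℕ) : ℂ) 1 = n := by
  refine PNat.eq ?_
  change max 1 ⌈‖((n : ℕ) : ℂ)‖ * ((1 : ℕ+) : ℕ)⌉₊ = (n : ℕ)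
  simp [Nat.one_le_iff_ne_zero]

/-- Multiplication by `1/n` leads from `S_n` to exactly `S_1`; this transfers the norm bound from
`S_1` to all sorts of a model of T_HS. -/
lemma scalCod_inv_natCast (n : ℕ+) : scalCod ((n : ℕ) : ℂ)⁻¹ n = 1 := by
  refine PNat.eq ?_
  change max 1 ⌈‖((n : ℕ) : ℂ)⁻¹‖ * (n : ℕ)⌉₊ = 1
  have : ((n : ℕ) : ℝ) ≠ 0 := by exact_mod_cast n.ne_zero
  simp [this]

lemma norm_inv_smul_le_one {E : Type u} [NormedAddCommGroup E] [NormedSpace ℂ E] {n : ℕ+} {a : E}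
    (ha : ‖a‖ ≤ n) : ‖((n : ℕ) : ℂ)⁻¹ • a‖ ≤ 1 := by
  have h : (0 : ℝ) < (n : ℕ) := by exact_mod_cast n.pos
  rw [norm_smul, norm_inv, Complex.norm_natCast, inv_mul_le_iff₀ h, mul_one]
  exact ha

lemma smul_inv_smul_natCast {E : Type u} [AddCommGroup E] [Module ℂ E] (n : ℕ+) (a : E) :
    ((n : ℕ) : ℂ) • ((n : ℕ) : ℂ)⁻¹ • a = a :=
  smul_inv_smul₀ (by exact_mod_cast n.ne_zero) a

lemma exists_norm_le {E F : Type u} [SeminormedAddCommGroup E] [SeminormedAddCommGroup F]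
    (a : E) (b : F) : ∃ n : ℕ+, ‖a‖ ≤ n ∧ ‖b‖ ≤ n := by
  obtain ⟨n, hn⟩ := exists_nat_ge (max ‖a‖ ‖b‖)
  have h : max ‖a‖ ‖b‖ ≤ ((n.succPNat : ℕ) : ℝ) := hn.trans (by simp)
  exact ⟨n.succPNat, (le_max_left _ _).trans h, (le_max_right _ _).trans h⟩

/-- A family of maps of balls that are compatible with the inclusions comes from a map. -/
lemma exists_map_of_balls {E F : Type u} [SeminormedAddCommGroup E] [SeminormedAddCommGroup F]
    (T : ∀ n : ℕ+, Ball E n → Ball F n)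
    (hT : ∀ {m n : ℕ+} (_ : m < n) (x : Ball E m) (y : Ball E n), x.1 = y.1 →
      (T m x).1 = (T n y).1) :
    ∃ g : E → F, ∀ (n : ℕ+) (a : E) (h : ‖a‖ ≤ n), g a = (T n ⟨a, h⟩).1 := by
  -- Any radius that contains `a` may be chosen: the values for `N a` and for `n` agree with the one
  -- for `N a + n`.
  choose N hN using fun a : E => exists_norm_le a a
  refine ⟨fun a => (T (N a) ⟨a, (hN a).1⟩).1, fun n a h => ?_⟩
  have h' : ‖a‖ ≤ ((N a + n : ℕ+) : ℝ) := h.trans (by push_cast; simp)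
  exact (hT (PNat.lt_add_right (N a) n) _ ⟨a, h'⟩ rfl).trans
    (hT (PNat.lt_add_left n (N a)) _ ⟨a, h'⟩ rfl).symm

/-! ### Models of T_C* are dissections, and conversely. -/

namespace CStarLang

variable {Q : ℕ+ → ℕ → StarPoly} {M : MetricStructure.{u} (CStarLang Q)}

namespace Realization

/-- The sorts are complete and embedded isometrically. -/
lemma isClosed_range {A : Type u} [MetricSpace A] [Add A] [Mul A] [Star A] [Zero A] [SMul ℂ A]
    (r : Realization M A) (n : ℕ+) : IsClosed (Set.range (r.toFun n)) :=
  (Isometry.of_dist_eq r.dist_eq).isClosedEmbedding.isClosed_range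

/-- `a / n` lies in the unit ball, hence comes from `S_1`, and multiplication by `n` in the
structure carries its preimage to `S_n`. -/
lemma exists_eq_of_norm_le {A : Type u} [NonUnitalCStarAlgebra A] (r : Realization M A)
    (h : ∀ a : A, ‖a‖ ≤ 1 → a ∈ Set.range (r.toFun 1)) {n : ℕ+} {a : A} (ha : ‖a‖ ≤ n) :
    ∃ x, r.toFun n x = a := by
  obtain ⟨x, hx⟩ := h _ (norm_inv_smul_le_one ha)
  have e := r.smul ((n : ℕ) : ℂ) x
  rw [hx, smul_inv_smul_natCast] at e
  -- The sort `scalCod n 1` equals `n` only by a theorem; under the existential quantifier it can be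
  -- rewritten.
  have h' : ∃ y : Car M (scalCod ((n : ℕ) : ℂ) 1), r.toFun _ y = a := ⟨_, e⟩
  rwa [scalCod_natCast] at h'

end Realization

/-- The balls of the completed union of a model are its sorts. -/
lemma exists_completionRealization_eq (hQ : IsRetractingFamily.{u} Q)
    (hM : Satisfies M (TCStar Q)) {n : ℕ+} {a : UniformSpace.Completion (Union hM)}
    (ha : ‖a‖ ≤ n) : ∃ x, (completionRealization hM).toFun n x = a := by
  refine (completionRealization hM).exists_eq_of_norm_le (fun a ha => ?_) ha
  refine mem_of_norm_le_one_of_dense ((completionRealization hM).isClosed_range 1)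
    (UniformSpace.Completion.denseRange_coe (α := Union hM)) ?_ ha
  rintro _ ⟨b, rfl⟩ hb
  obtain ⟨n, v, rfl, -⟩ := Union.exists_val b b b
  -- The purpose of the q^n_k: `b` comes from some `S_n`, the elements q^n_k(b) come from `S_1`, and
  -- they converge to `b` since ‖b‖ ≤ 1.
  refine ((completionRealization hM).isClosed_range 1).mem_of_tendsto
    (hQ.tendsto n _ _ hb.le) (Eventually.of_forall fun k => ⟨fpoly k (v n 0), ?_⟩)
  exact (completionRealization hM).poly_of_satisfies hM k _

/-- A model of the theory is isomorphic to the dissection of a C*-algebra. -/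
theorem exists_isomorphic (hQ : IsRetractingFamily.{u} Q) (hM : Satisfies M (TCStar Q)) :
    ∃ A : CStarCat.{u}, Isomorphic M ((dissection hQ).obj A) := by
  let r := completionRealization hM
  refine ⟨⟨UniformSpace.Completion (Union hM)⟩, ?_⟩
  let ρ : Hom M (dissObj hQ ⟨UniformSpace.Completion (Union hM)⟩) :=
    { toFun := fun (n : ℕ+) x => ⟨r.toFun n x, r.norm_le_of_satisfies hM x⟩
      map_func := fun f a => by
        cases f with
        | add n => exact Subtype.ext ((congrArg _ (func_add n a)).trans (r.add _ _))
        | mul n => exact Subtype.ext ((congrArg _ (func_mul n a)).trans (r.mul _ _))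
        | star n => exact Subtype.ext ((congrArg _ (func_star n a)).trans (r.star _))
        | zero n => exact Subtype.ext ((congrArg _ (func_zero n a)).trans (r.zero _))
        | smul l n => exact Subtype.ext ((congrArg _ (func_smul l n a)).trans (r.smul l _))
        | incl m n h => exact Subtype.ext ((congrArg _ (func_incl h a)).trans (r.incl h _))
        | poly n k =>
          exact Subtype.ext ((congrArg _ (func_poly n k a)).trans (r.poly_of_satisfies hM k _))
      map_rel := fun R => R.elim
      map_dist := fun n x y => (r.dist_eq x y).le }
  refine ⟨ρ, fun R => R.elim, fun n x y => r.dist_eq x y, fun n y => ?_⟩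
  obtain ⟨x, hx⟩ := exists_completionRealization_eq hQ hM y.2
  exact ⟨x, Subtype.ext hx⟩

/-- The dissection of a C*-algebra is realized in the algebra. -/
def dissRealization (hQ : IsRetractingFamily.{u} Q) (A : CStarCat.{u}) :
    Realization ((dissection hQ).obj A) A.carrier where
  toFun n (x : Ball A.carrier n) := x.1
  dist_eq _ _ := rfl
  add _ _ := rfl
  mul _ _ := rfl
  star _ := rfl
  zero _ := rfl
  smul _ _ _ := rfl
  incl _ _ := rfl

theorem satisfies_dissection (hQ : IsRetractingFamily.{u} Q) (A : CStarCat.{u}) :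
    Satisfies ((dissection hQ).obj A) (TCStar Q) :=
  (dissRealization hQ A).satisfies
    (fun n x => Subtype.property (p := fun a : A.carrier => ‖a‖ ≤ n) x)
    fun _ _ _ => rfl

theorem satisfies_iff (hQ : IsRetractingFamily.{u} Q) (M : MetricStructure.{u} (CStarLang Q)) :
    Satisfies M (TCStar Q) ↔ ∃ A : CStarCat.{u}, Isomorphic M ((dissection hQ).obj A) :=
  ⟨exists_isomorphic hQ, fun ⟨A, h⟩ => h.satisfies (satisfies_dissection hQ A)⟩

/-! ### The dissection functor is fully faithful -/

variable (hQ : IsRetractingFamily.{u} Q)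

instance : (dissection hQ).Faithful where
  map_injective {A B φ ψ} h := by
    refine NonUnitalStarAlgHom.ext fun a => ?_
    obtain ⟨n, hn, -⟩ := exists_norm_le a a
    have := congrFun (congrFun (congrArg Hom.toFun h) n) (⟨a, hn⟩ : Ball A.carrier n)
    exact congrArg Subtype.val this

/-- Compatibility with the inclusion symbols glues the components to one map, and compatibility with
the other symbols makes it a *-homomorphism. Morphisms of C*-algebras are purely algebraic, so no
continuity has to be checked. -/
instance : (dissection hQ).Full where
  map_surjective {A B} (f : Hom (dissObj hQ A) (dissObj hQ B)) := by
    let T (n : ℕ+) (x : Ball A.carrier n) : Ball B.carrier n := f.toFun n x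
    obtain ⟨g, hg⟩ := exists_map_of_balls T fun {m n} h ⟨a, ha⟩ ⟨b, hb⟩ hab => by
      obtain rfl : a = b := hab
      exact (congrArg Subtype.val
        (f.map_func (.incl m n h) (fun _ => ⟨a, ha⟩ : Fin 1 → Ball A.carrier m))).symm
    have hg' (n : ℕ+) (x : Ball A.carrier n) : (T n x).1 = g x.1 := (hg n x.1 x.2).symm
    let φ : A.carrier →⋆ₙₐ[ℂ] B.carrier :=
      { toFun := g
        map_smul' := fun l a => by
          obtain ⟨n, ha, -⟩ := exists_norm_le a a
          have := congrArg Subtype.val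
            (f.map_func (.smul l n) (fun _ => ⟨a, ha⟩ : Fin 1 → Ball A.carrier n))
          exact ((hg' _ _).symm.trans this).trans (congrArg (l • ·) (hg' n ⟨a, ha⟩))
        map_zero' := by
          have := congrArg Subtype.val
            (f.map_func (.zero 1) (fun i => i.elim0 : Fin 0 → Ball A.carrier 1))
          exact (hg' _ _).symm.trans this
        map_add' := fun a b => by
          obtain ⟨n, ha, hb⟩ := exists_norm_le a b
          have := congrArg Subtype.val
            (f.map_func (.add n) (![⟨a, ha⟩, ⟨b, hb⟩] : Fin 2 → Ball A.carrier n))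
          exact ((hg' _ _).symm.trans this).trans
            (congrArg₂ (· + ·) (hg' n ⟨a, ha⟩) (hg' n ⟨b, hb⟩))
        map_mul' := fun a b => by
          obtain ⟨n, ha, hb⟩ := exists_norm_le a b
          have := congrArg Subtype.val
            (f.map_func (.mul n) (![⟨a, ha⟩, ⟨b, hb⟩] : Fin 2 → Ball A.carrier n))
          exact ((hg' _ _).symm.trans this).trans
            (congrArg₂ (· * ·) (hg' n ⟨a, ha⟩) (hg' n ⟨b, hb⟩))
        map_star' := fun a => by
          obtain ⟨n, ha, -⟩ := exists_norm_le a a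
          have := congrArg Subtype.val
            (f.map_func (.star n) (fun _ => ⟨a, ha⟩ : Fin 1 → Ball A.carrier n))
          exact ((hg' _ _).symm.trans this).trans (congrArg star (hg' n ⟨a, ha⟩)) }
    refine ⟨φ, Hom.ext (funext fun n => funext fun x => Subtype.ext ?_)⟩
    exact (hg' n x).symm

end CStarLang

/-! ### Existence of retracting families -/

open Polynomial in
/-- Polynomials `p` for which `t p(t^2)` maps `[-r, r]` to `[-1, 1]` and is close to `t` on
`[-1, 1]`. -/
lemma exists_retracting_polynomial {r δ : ℝ} (hr : 1 ≤ r) (hδ : 0 < δ) :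
    ∃ p : ℝ[X], (∀ t ∈ Set.Icc 0 (r ^ 2), t * p.eval t ^ 2 ≤ 1) ∧
      ∀ t ∈ Set.Icc (0 : ℝ) 1, |p.eval t - 1| ≤ δ := by
  -- With s = √t, the product s / max(1, s) retracts [0, ∞) onto [0, 1]; `p` is to approximate the
  -- second factor as a function of t = s².
  have hc : Continuous fun t : ℝ => (max 1 √t)⁻¹ :=
    (continuous_const.max Real.continuous_sqrt).inv₀ fun t => by positivity
  -- Chosen so that `ε + r * ε = δ`: approximation costs ε, and the rescaling below costs r ε.
  set ε := δ / (r + 1)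
  have hε : 0 < ε := by positivity
  obtain ⟨p, hp⟩ := exists_polynomial_near_of_continuousOn 0 (r ^ 2) _ hc.continuousOn ε hε
  have hs : 0 < 1 + r * ε := by positivity
  -- For √t ≤ r the approximation can push √t |p(t)| up to 1 + r ε; dividing by this number restores
  -- the bound 1 exactly.
  refine ⟨C (1 + r * ε)⁻¹ * p, fun t ht => ?_, fun t ht => ?_⟩
  · have h1 := hp t ht
    have hst : √t ≤ r := Real.sqrt_le_iff.2 ⟨by linarith, ht.2⟩
    have hg : √t * (max 1 √t)⁻¹ ≤ 1 := by
      rw [← div_eq_mul_inv, div_le_one (by positivity)]; exact le_max_right _ _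
    have hg0 : 0 ≤ (max 1 √t)⁻¹ := by positivity
    have h2 : √t * |p.eval t| ≤ 1 + r * ε := by
      have : |p.eval t| ≤ (max 1 √t)⁻¹ + ε := by
        have := abs_sub_abs_le_abs_sub (p.eval t) (max 1 √t)⁻¹
        rw [abs_of_nonneg hg0] at this
        linarith
      have := mul_le_mul_of_nonneg_left this (Real.sqrt_nonneg t)
      nlinarith
    have h3 : √t * |(C (1 + r * ε)⁻¹ * p).eval t| ≤ 1 := by
      rw [eval_mul, eval_C, abs_mul, abs_of_pos (inv_pos.2 hs), mul_left_comm,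
        inv_mul_le_iff₀ hs, mul_one]
      exact h2
    have h4 : t * (C (1 + r * ε)⁻¹ * p).eval t ^ 2 =
        (√t * |(C (1 + r * ε)⁻¹ * p).eval t|) ^ 2 := by
      rw [mul_pow, Real.sq_sqrt ht.1, sq_abs]
    rw [h4]
    exact pow_le_one₀ (by positivity) h3
  · have h1 := hp t ⟨ht.1, ht.2.trans (one_le_pow₀ hr)⟩
    have e : (max 1 √t)⁻¹ = 1 := by
      rw [max_eq_left (Real.sqrt_le_one.2 ht.2), inv_one]
    have e' : (C (1 + r * ε)⁻¹ * p).eval t - 1 = (1 + r * ε)⁻¹ * ((p.eval t - 1) - r * ε) := by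
      rw [eval_mul, eval_C]; field_simp; ring
    rw [e] at h1
    rw [e', abs_mul, abs_of_pos (inv_pos.2 hs), inv_mul_le_iff₀ hs]
    have h2 : |p.eval t - 1 - r * ε| ≤ ε + r * ε := by
      refine (abs_sub _ _).trans ?_
      rw [abs_of_nonneg (by positivity : 0 ≤ r * ε)]
      linarith
    have h3 : ε + r * ε = δ := by
      simp only [ε]; field_simp; ring
    rw [h3] at h2
    nlinarith [mul_pos (mul_pos (zero_lt_one.trans_le hr) hε) hδ]

open Polynomial in
/-- The `*`-polynomial `a ↦ a p(a^* a)`. -/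
lemma exists_starPoly (p : ℝ[X]) : ∃ q : StarPoly, ∀ (B : Type u) [CStarAlgebra B] (x : B),
    q.eval x = x * aeval (star x * x) p := by
  induction p using Polynomial.induction_on with
  | C r => exact ⟨.smul r .X, fun B _ x => by
      simp [StarPoly.eval, Algebra.algebraMap_eq_smul_one]⟩
  | add p q hp hq =>
    obtain ⟨p', hp⟩ := hp
    obtain ⟨q', hq⟩ := hq
    exact ⟨.add p' q', fun B _ x => by simp [StarPoly.eval, hp, hq, mul_add]⟩
  | monomial n r h =>
    obtain ⟨q, hq⟩ := h
    -- One more factor a*a on the right raises the degree of `p` by one. The factor `x` in front is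
    -- what keeps constants out, starting from `r • x`.
    refine ⟨.mul q (.mul (.star .X) .X), fun B _ x => ?_⟩
    rw [pow_succ, ← mul_assoc, map_mul, aeval_X, ← mul_assoc x, ← hq B x]
    rfl

/-- Elements x*x have nonnegative spectrum, bounded by ‖x*x‖ = ‖x‖². -/
lemma spectrum_star_mul_self_subset {B : Type u} [CStarAlgebra B] {x : B} {r : ℝ} (hx : ‖x‖ ≤ r) :
    spectrum ℝ (star x * x) ⊆ Set.Icc 0 (r ^ 2) := by
  nontriviality B
  refine fun t ht => ⟨spectrum_star_mul_self_nonneg t ht, ?_⟩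
  have h1 := spectrum.norm_le_norm_of_mem ht
  rw [CStarRing.norm_star_mul_self] at h1
  nlinarith [norm_nonneg x, Real.le_norm_self t]

open Polynomial in
-- A polynomial in the self-adjoint element x*x is given by the continuous functional calculus, so
-- its norm is bounded by the values on the spectrum.
lemma norm_aeval_le {B : Type u} [CStarAlgebra B] {x : B} {r c : ℝ} (hc : 0 ≤ c) (hx : ‖x‖ ≤ r)
    {p : ℝ[X]} (hp : ∀ t ∈ Set.Icc 0 (r ^ 2), |p.eval t| ≤ c) :
    ‖aeval (star x * x) p‖ ≤ c := by
  rw [← cfc_polynomial p (star x * x) (.star_mul_self x)]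
  exact norm_cfc_le hc fun t ht => hp t (spectrum_star_mul_self_subset hx ht)

open Polynomial in
-- With h = x*x, the C*-identity gives ‖x p(h)‖² = ‖p(h) h p(h)‖, the norm of the polynomial t p(t)²
-- at h. This explains the form of the hypothesis on `p`.
lemma norm_mul_aeval_le {B : Type u} [CStarAlgebra B] {x : B} {r : ℝ} (hx : ‖x‖ ≤ r) {p : ℝ[X]}
    (hp : ∀ t ∈ Set.Icc 0 (r ^ 2), t * p.eval t ^ 2 ≤ 1) :
    ‖x * aeval (star x * x) p‖ ≤ 1 := by
  have hs : star (aeval (star x * x) p) = aeval (star x * x) p := by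
    rw [← cfc_polynomial p (star x * x) (.star_mul_self x)]
    exact (cfc_predicate _ _ : IsSelfAdjoint _).star_eq
  have h : star (x * aeval (star x * x) p) * (x * aeval (star x * x) p) =
      aeval (star x * x) (p * (X * p)) := by
    rw [star_mul, hs, map_mul, map_mul, aeval_X]
    noncomm_ring
  have h1 : ‖star (x * aeval (star x * x) p) * (x * aeval (star x * x) p)‖ ≤ 1 := by
    rw [h]
    refine norm_aeval_le zero_le_one hx fun t ht => ?_
    rw [eval_mul, eval_mul, eval_X,
      abs_of_nonneg (by nlinarith [mul_nonneg ht.1 (sq_nonneg (p.eval t))])]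
    linarith [hp t ht]
  rw [CStarRing.norm_star_mul_self] at h1
  nlinarith [norm_nonneg (x * aeval (star x * x) p)]

/-- Retracting families exist. -/
theorem exists_isRetractingFamily : ∃ Q : ℕ+ → ℕ → StarPoly, IsRetractingFamily.{u} Q := by
  -- Radius r = n and tolerance δ = 1/(k+1).
  choose p hp hp' using fun (n : ℕ+) (k : ℕ) =>
    exists_retracting_polynomial (one_le_pnat n) (Nat.one_div_pos_of_nat (α := ℝ) (n := k))
  choose q hq using exists_starPoly.{u}
  -- The functional calculus is used in the unitization, which contains `A` isometrically; without
  -- constant terms, *-polynomials have the same value in both algebras.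
  have key : ∀ (s : StarPoly) (A : Type u) [NonUnitalCStarAlgebra A] (a : A),
      ((s.eval a : A) : Unitization ℂ A) = s.eval (a : Unitization ℂ A) := fun s A _ a =>
    s.map_eval (Unitization.inrNonUnitalStarAlgHom ℂ A) a
  refine ⟨fun n k => q (p n k), fun n k A _ a ha => ?_, fun n A _ a ha => ?_⟩
  · rw [← Unitization.norm_inr (𝕜 := ℂ), key, hq]
    exact norm_mul_aeval_le (by rwa [Unitization.norm_inr]) (hp n k)
  · refine tendsto_iff_norm_sub_tendsto_zero.2 (squeeze_zero (fun _ => norm_nonneg _) (fun k => ?_)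
      tendsto_one_div_add_atTop_nhds_zero_nat)
    rw [← Unitization.norm_inr (𝕜 := ℂ), Unitization.inr_sub, key, hq]
    set x : Unitization ℂ A := Unitization.inr a
    have hx : ‖x‖ ≤ 1 := by rwa [Unitization.norm_inr]
    -- On the unit ball the error is x (p - 1)(x*x), and the spectrum of x*x lies in [0, 1], where p
    -- - 1 is at most 1/(k+1).
    have e : x * Polynomial.aeval (star x * x) (p n k) - x =
        x * Polynomial.aeval (star x * x) (p n k - 1) := by
      rw [map_sub, map_one, mul_sub, mul_one]
    rw [e]
    have h := norm_aeval_le (p := p n k - 1) (c := 1 / ((k : ℝ) + 1)) (by positivity) hx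
      fun t ht => by simpa using hp' n k t (by simpa using ht)
    calc _ ≤ ‖x‖ * ‖Polynomial.aeval (star x * x) (p n k - 1)‖ := norm_mul_le _ _
      _ ≤ 1 * (1 / ((k : ℝ) + 1)) := mul_le_mul hx h (norm_nonneg _) zero_le_one
      _ = _ := one_mul _

/-! ### Realizations of structures for the language of Hilbert spaces -/

namespace HilbLang

section func

variable (M : MetricStructure.{u} HilbLang)

/-- The interpretation of a sort. -/
abbrev Car (n : ℕ+) : Type u := M.Carrier (n : HilbLang.Srt)

instance (n : ℕ+) : MetricSpace (Car M n) := M.metric n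

instance (n : ℕ+) : CompleteSpace (Car M n) := M.complete n

instance (n : ℕ+) : Nonempty (Car M n) := M.nonempty n

variable {M}

/-- The interpretation of `+_n`. -/
def fadd {n : ℕ+} (x y : Car M n) : Car M (2 * n) :=
  M.func (HilbFunc.add n) (![x, y] : Fin 2 → Car M n)

variable (M) in
/-- The interpretation of `0_n`. -/
def fzero (n : ℕ+) : Car M n := M.func (HilbFunc.zero n) fun i => Fin.elim0 i

/-- The interpretation of `lam_n`. -/
def fsmul (lam : ℂ) {n : ℕ+} (x : Car M n) : Car M (scalCod lam n) :=
  M.func (HilbFunc.smul lam n) fun _ => x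

/-- The interpretation of `i_{m,n}`. -/
def fincl {m n : ℕ+} (h : m < n) (x : Car M m) : Car M n :=
  M.func (HilbFunc.incl m n h) fun _ => x

/-- The inner product given by the interpretations of its real and imaginary part. -/
noncomputable def finner {n : ℕ+} (x y : Car M n) : ℂ :=
  ⟨M.rel (HilbRel.re n) (![x, y] : Fin 2 → Car M n),
    M.rel (HilbRel.im n) (![x, y] : Fin 2 → Car M n)⟩

lemma func_add (n : ℕ+) (a : Fin 2 → Car M n) :
    M.func (HilbFunc.add n) a = fadd (a 0) (a 1) :=
  congrArg (M.func (HilbFunc.add n)) (funext fun i : Fin 2 => by fin_cases i <;> rfl)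

lemma func_zero (n : ℕ+) (a : Fin 0 → Car M n) : M.func (HilbFunc.zero n) a = fzero M n :=
  congrArg (M.func (HilbFunc.zero n)) (funext fun i : Fin 0 => i.elim0)

lemma func_smul (lam : ℂ) (n : ℕ+) (a : Fin 1 → Car M n) :
    M.func (HilbFunc.smul lam n) a = fsmul lam (a 0) :=
  congrArg (M.func (HilbFunc.smul lam n)) (funext fun i : Fin 1 => by fin_cases i; rfl)

lemma func_incl {m n : ℕ+} (h : m < n) (a : Fin 1 → Car M m) :
    M.func (HilbFunc.incl m n h) a = fincl h (a 0) :=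
  congrArg (M.func (HilbFunc.incl m n h)) (funext fun i : Fin 1 => by fin_cases i; rfl)

lemma rel_re (n : ℕ+) (a : Fin 2 → Car M n) :
    M.rel (HilbRel.re n) a = (finner (a 0) (a 1)).re :=
  congrArg (M.rel (HilbRel.re n)) (funext fun i : Fin 2 => by fin_cases i <;> rfl)

lemma rel_im (n : ℕ+) (a : Fin 2 → Car M n) :
    M.rel (HilbRel.im n) a = (finner (a 0) (a 1)).im :=
  congrArg (M.rel (HilbRel.im n)) (funext fun i : Fin 2 => by fin_cases i <;> rfl)

end func

/-- Compatible isometric maps of the sorts of a structure to a space with operations, under which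
the symbols of the language become the operations. -/
structure Realization (M : MetricStructure.{u} HilbLang) (A : Type u) [MetricSpace A] [Add A]
    [Zero A] [SMul ℂ A] [Inner ℂ A] where
  toFun : ∀ n, Car M n → A
  dist_eq : ∀ {n : ℕ+} (x y : Car M n), dist (toFun n x) (toFun n y) = dist x y
  add : ∀ {n : ℕ+} (x y : Car M n), toFun _ (fadd x y) = toFun n x + toFun n y
  zero : ∀ n : ℕ+, toFun n (fzero M n) = 0
  smul : ∀ (lam : ℂ) {n : ℕ+} (x : Car M n), toFun _ (fsmul lam x) = lam • toFun n x
  incl : ∀ {m n : ℕ+} (h : m < n) (x : Car M m), toFun n (fincl h x) = toFun m x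
  inner : ∀ {n : ℕ+} (x y : Car M n), finner x y = inner ℂ (toFun n x) (toFun n y)

namespace Realization

variable {M : MetricStructure.{u} HilbLang} {A : Type u} [MetricSpace A] [Add A]
    [Zero A] [SMul ℂ A] [Inner ℂ A] (r : Realization M A) (v : Assignment M)

/-- The realization of the value of a term. -/
noncomputable def val {n : ℕ+} (τ : Tm n) : A := r.toFun n (τ.eval M v)

@[simp] lemma val_tvar (n : ℕ+) (k : ℕ) : r.val v (tvar n k) = r.toFun n (v n k) := rfl

@[simp] lemma val_tadd {n : ℕ+} (σ τ : Tm n) :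
    r.val v (tadd σ τ) = r.val v σ + r.val v τ :=
  (congrArg _ (func_add n _)).trans (r.add _ _)

@[simp] lemma val_tzero (n : ℕ+) : r.val v (tzero n) = 0 :=
  (congrArg _ (func_zero n _)).trans (r.zero n)

@[simp] lemma val_tsmul (lam : ℂ) {n : ℕ+} (τ : Tm n) :
    r.val v (tsmul lam τ) = lam • r.val v τ :=
  (congrArg _ (func_smul lam n _)).trans (r.smul lam _)

@[simp] lemma val_tincl {m n : ℕ+} (h : m < n) (τ : Tm m) :
    r.val v (tincl h τ) = r.val v τ :=
  (congrArg _ (func_incl h _)).trans (r.incl h _)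

@[simp] lemma val_tadd' {m n : ℕ+} (σ : Tm m) (τ : Tm n) :
    r.val v (tadd' σ τ) = r.val v σ + r.val v τ := by
  rw [tadd', val_tadd, val_tincl, val_tincl]

lemma eval_dst₀ {n : ℕ+} (σ τ : Tm n) :
    (dst₀ σ τ).eval M v = dist (r.val v σ) (r.val v τ) :=
  (r.dist_eq _ _).symm

lemma eval_dst {m n : ℕ+} (σ : Tm m) (τ : Tm n) :
    (dst σ τ).eval M v = dist (r.val v σ) (r.val v τ) := by
  rw [dst, r.eval_dst₀, val_tincl, val_tincl]

lemma eval_nrm {n : ℕ+} (τ : Tm n) : (nrm τ).eval M v = dist (r.val v τ) 0 := by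
  rw [nrm, r.eval_dst₀, val_tzero]

lemma eval_re₀ {n : ℕ+} (σ τ : Tm n) :
    (re₀ σ τ).eval M v = (Inner.inner ℂ (r.val v σ) (r.val v τ)).re :=
  (rel_re n _).trans (congrArg _ (r.inner _ _))

lemma eval_im₀ {n : ℕ+} (σ τ : Tm n) :
    (im₀ σ τ).eval M v = (Inner.inner ℂ (r.val v σ) (r.val v τ)).im :=
  (rel_im n _).trans (congrArg _ (r.inner _ _))

lemma eval_re {m n : ℕ+} (σ : Tm m) (τ : Tm n) :
    (re σ τ).eval M v = (Inner.inner ℂ (r.val v σ) (r.val v τ)).re := by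
  rw [re, r.eval_re₀, val_tincl, val_tincl]

lemma eval_im {m n : ℕ+} (σ : Tm m) (τ : Tm n) :
    (im σ τ).eval M v = (Inner.inner ℂ (r.val v σ) (r.val v τ)).im := by
  rw [im, r.eval_im₀, val_tincl, val_tincl]

/-- The infimum changes only a variable of sort `S_1`, and `n ≠ 1`, so `x` keeps its value: the
formula is the distance of `x` from the image of `S_1`. -/
lemma eval_inf {n : ℕ+} (h : 1 < n) :
    (Formula.inf (L := HilbLang) (1 : ℕ+) 1 (dst₀ (tvar n 0) (tincl h (tvar 1 1)))).eval M v =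
      ⨅ y : Car M 1, dist (r.toFun n (v n 0)) (r.toFun 1 y) := by
  refine iInf_congr fun y => (r.eval_dst₀ _ _ _).trans ?_
  rw [val_tincl]
  exact congrArg₂ (fun a b => dist (r.toFun n a) (r.toFun 1 b))
    (v.update_of_sort_ne (s := (1 : ℕ+)) h.ne' 1 y 0) (Assignment.update_same v (1 : ℕ+) 1 y)

end Realization

lemma eval_all_eq_zero {M : MetricStructure.{u} HilbLang} {n : ℕ+} {φ : Fm}
    (h0 : ∀ v, 0 ≤ φ.eval M v) (h : ∀ v, φ.eval M v = 0) (v : Assignment M) :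
    (all n φ).eval M v = 0 := (Formula.eval_sup₃_eq_zero_iff h0).2 h v

lemma unit_ball_nonneg {M : MetricStructure.{u} HilbLang} (φ ψ : Fm) {n k : ℕ+} (σ τ : Tm n)
    (v : Assignment M) : 0 ≤ (Formula.min (.dotminus φ ψ)
      (.inf (L := HilbLang) k 1 (dst₀ σ τ))).eval M v :=
  le_min (le_max_right _ _) (Real.iInf_nonneg fun _ => dist_nonneg)

/-- A structure realized in the balls of an inner product space is a model of the theory. -/
theorem Realization.satisfies {M : MetricStructure.{u} HilbLang} {A : Type u}
    [NormedAddCommGroup A] [InnerProductSpace ℂ A] (r : Realization M A)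
    (norm_le : ∀ x : Car M 1, ‖r.toFun 1 x‖ ≤ 1)
    (surj : ∀ a : A, ‖a‖ ≤ 1 → ∃ x, r.toFun 1 x = a) :
    Satisfies M THilb := by
  rintro ⟨φ, hφ⟩ (h : Axioms φ)
  change ∀ v, φ.eval M v = 0
  cases h <;> refine eval_all_eq_zero (fun v => ?_) (fun v => ?_) <;>
    first
    | exact dist_nonneg
    | exact abs_nonneg _
    | exact le_max_right _ _
    | exact unit_ball_nonneg _ _ _ _ _
    | simp [r.eval_dst₀, r.eval_nrm, r.eval_dst, r.eval_re₀, r.eval_im₀, r.eval_re, r.eval_im,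
        smul_smul, add_smul, add_comm, add_assoc]
  case re_symm => rw [← inner_conj_symm, Complex.conj_re, sub_self]
  case im_symm => rw [← inner_conj_symm, Complex.conj_im, neg_add_cancel]
  case re_smul => ring
  case norm_sq => rw [← Complex.ofReal_pow, Complex.ofReal_re, sq, sub_self]
  case dist_eq => rw [dist_eq_norm, ← sub_eq_add_neg, sub_self]
  case norm_le => exact norm_le _
  case unit_ball n hn =>
    rw [r.eval_inf v hn]
    have h0 : 0 ≤ ⨅ y : Car M 1, dist (r.toFun n (v n 0)) (r.toFun 1 y) :=
      Real.iInf_nonneg fun _ => dist_nonneg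
    -- If ‖x‖ ≤ 1, then `x` comes from `S_1` and the infimum vanishes; otherwise max(1 - ‖x‖, 0)
    -- does.
    rcases le_total ‖r.toFun n (v n 0)‖ 1 with h1 | h1
    · obtain ⟨x, hx⟩ := surj _ h1
      have h2 : ⨅ y : Car M 1, dist (r.toFun n (v n 0)) (r.toFun 1 y) ≤ 0 :=
        (ciInf_le ⟨0, by rintro _ ⟨y, rfl⟩; exact dist_nonneg⟩ x).trans (by rw [hx, dist_self])
      rw [le_antisymm h2 h0, min_eq_right (le_max_right _ _)]
    · rw [max_eq_right (by linarith), min_eq_left h0]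

end HilbLang

namespace HilbLang

/-! ### The Hilbert space of a model -/

variable {M : MetricStructure.{u} (HilbLang)}

lemma eval_eq_zero_of_satisfies (hM : Satisfies M (THilb)) {n : ℕ+} {φ : Fm}
    (h : Axioms (all n φ)) (h0 : ∀ v, 0 ≤ φ.eval M v) (v : Assignment M) : φ.eval M v = 0 :=
  (Formula.eval_sup₃_eq_zero_iff h0).1 (hM ⟨_, h.closed⟩ h) v

lemma eval_tadd {n : ℕ+} (σ τ : Tm n) (v : Assignment M) :
    (tadd σ τ).eval M v = fadd (σ.eval M v) (τ.eval M v) := func_add n _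

lemma eval_tzero (n : ℕ+) (v : Assignment M) : (tzero n : Tm n).eval M v = fzero M n :=
  func_zero n _

lemma eval_tsmul (lam : ℂ) {n : ℕ+} (τ : Tm n) (v : Assignment M) :
    (tsmul lam τ).eval M v = fsmul lam (τ.eval M v) := func_smul lam n _

lemma eval_tincl {m n : ℕ+} (h : m < n) (τ : Tm m) (v : Assignment M) :
    (tincl h τ).eval M v = fincl h (τ.eval M v) := func_incl h _

lemma eval_tvar (n : ℕ+) (k : ℕ) (v : Assignment M) : (tvar n k : Tm n).eval M v = v n k := rfl

lemma eval_re₀ {n : ℕ+} (σ τ : Tm n) (v : Assignment M) :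
    (re₀ σ τ).eval M v = (finner (σ.eval M v) (τ.eval M v)).re := rel_re n _

lemma eval_im₀ {n : ℕ+} (σ τ : Tm n) (v : Assignment M) :
    (im₀ σ τ).eval M v = (finner (σ.eval M v) (τ.eval M v)).im := rel_im n _

/-- The sorts of a model, with the inclusions. -/
def chain (hM : Satisfies M (THilb)) : BallChain.{u} where
  C n := Car M n
  incl h := fincl h
  incl_incl {m n k} h h' x := by
    obtain ⟨v, rfl, -⟩ := exists_assignment M m x x x
    have := dist_eq_zero.1 (eval_eq_zero_of_satisfies hM (.incl_incl m n k h h')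
      (fun _ => dist_nonneg) v)
    simpa only [eval_tincl, eval_tvar] using this
  dist_incl {m n} h x y := by
    obtain ⟨v, rfl, rfl, -⟩ := exists_assignment M m x y y
    have := sub_eq_zero.1 (abs_eq_zero.1 (eval_eq_zero_of_satisfies hM (.incl_dist m n h)
      (fun _ => abs_nonneg _) v))
    change dist ((tincl h (tvar m 0)).eval M v) ((tincl h (tvar m 1)).eval M v) =
      dist (v m 0) (v m 1) at this
    simpa only [eval_tincl, eval_tvar] using this

/-- The union of the sorts of a model. -/
def Union (hM : Satisfies M (THilb)) : Type u := (chain hM).Lim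

namespace Union

variable {hM : Satisfies M (THilb)}

noncomputable instance : MetricSpace (Union hM) := inferInstanceAs (MetricSpace (chain hM).Lim)

/-- The embedding of a sort. -/
noncomputable def ι (n : ℕ+) (x : Car M n) : Union hM := (chain hM).ι n x

lemma ι_incl {m n : ℕ+} (h : m < n) (x : Car M m) :
    (ι n (fincl h x) : Union hM) = ι m x := BallChain.ι_incl (S := chain hM) h x

lemma exists_ι₃ (a b c : Union hM) : ∃ n x y z, ι n x = a ∧ ι n y = b ∧ ι n z = c :=
  BallChain.exists_ι₃ (S := chain hM) a b c

/-- An axiom that compares two terms identifies their values in the union. -/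
lemma ι_eq_of_axiom {n j k : ℕ+} {σ : Tm j} {τ : Tm k} (h : Axioms (all n (dst σ τ)))
    (v : Assignment M) : (ι j (σ.eval M v) : Union hM) = ι k (τ.eval M v) := by
  have := dist_eq_zero.1 (eval_eq_zero_of_satisfies hM h (fun _ => dist_nonneg) v)
  rw [eval_tincl, eval_tincl] at this
  rw [← ι_incl (PNat.lt_add_right j k), this, ι_incl]

noncomputable instance : Zero (Union hM) := ⟨ι 1 (fzero M 1)⟩

noncomputable instance : Add (Union hM) :=
  ⟨BallChain.lift₂ (S := chain hM) fun n x y => (ι _ (fadd (n := n) x y) : Union hM)⟩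

noncomputable instance : SMul ℂ (Union hM) :=
  ⟨fun lam => BallChain.lift₁ (S := chain hM) fun n x => (ι _ (fsmul lam (n := n) x) : Union hM)⟩

lemma ι_zero (n : ℕ+) : (ι n (fzero M n) : Union hM) = 0 := by
  rcases (one_le (a := n)).eq_or_lt with rfl | h
  · rfl
  · have := dist_eq_zero.1 (eval_eq_zero_of_satisfies hM (.incl_zero 1 n h) (fun _ => dist_nonneg)
      fun _ _ => Classical.arbitrary _)
    rw [eval_tincl] at this
    rw [eval_tzero, eval_tzero] at this
    rw [← this, ι_incl]
    rfl

lemma ι_add {n : ℕ+} (x y : Car M n) : (ι _ (fadd x y) : Union hM) = ι n x + ι n y := by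
  refine (BallChain.lift₂_ι (S := chain hM) (f := fun n x y => (ι _ (fadd (n := n) x y) : Union hM))
    (fun {m n} h x y => ?_) n x y).symm
  obtain ⟨v, rfl, rfl, -⟩ := exists_assignment M m x y y
  have := ι_eq_of_axiom (hM := hM) (.incl_add m n h) v
  rwa [eval_tadd, eval_tadd, eval_tincl, eval_tincl] at this

lemma ι_smul (lam : ℂ) {n : ℕ+} (x : Car M n) :
    (ι _ (fsmul lam x) : Union hM) = lam • ι n x := by
  refine (BallChain.lift₁_ι (S := chain hM)
    (f := fun n x => (ι _ (fsmul lam (n := n) x) : Union hM)) (fun {m n} h x => ?_) n x).symm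
  obtain ⟨v, rfl, -⟩ := exists_assignment M m x x x
  have := ι_eq_of_axiom (hM := hM) (.incl_smul lam m n h) v
  rwa [eval_tsmul, eval_tsmul, eval_tincl] at this

noncomputable instance : Inner ℂ (Union hM) :=
  ⟨BallChain.lift₂ (S := chain hM) fun n x y => finner (n := n) x y⟩

/-- The axioms `incl_re` and `incl_im` make the inner product independent of the sort in which it is
formed. -/
lemma inner_ι {n : ℕ+} (x y : Car M n) :
    inner ℂ (ι n x : Union hM) (ι n y) = finner x y := by
  refine BallChain.lift₂_ι (S := chain hM) (f := fun n x y => finner (n := n) x y)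
    (fun {m n} h x y => ?_) n x y
  obtain ⟨v, rfl, rfl, -⟩ := exists_assignment M m x y y
  have h1 := sub_eq_zero.1 (abs_eq_zero.1 (eval_eq_zero_of_satisfies hM (.incl_re m n h)
    (fun _ => abs_nonneg _) v))
  have h2 := sub_eq_zero.1 (abs_eq_zero.1 (eval_eq_zero_of_satisfies hM (.incl_im m n h)
    (fun _ => abs_nonneg _) v))
  change (re₀ _ _).eval M v = (re₀ _ _).eval M v at h1
  change (im₀ _ _).eval M v = (im₀ _ _).eval M v at h2
  rw [eval_re₀, eval_re₀, eval_tincl, eval_tincl] at h1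
  rw [eval_im₀, eval_im₀, eval_tincl, eval_tincl] at h2
  exact (Complex.ext h1 h2).symm

variable (hM) in
/-- A model is realized in the union of its sorts. -/
noncomputable def realization : Realization M (Union hM) where
  toFun := ι
  dist_eq x y := BallChain.dist_ι (S := chain hM) x y
  add := ι_add
  zero := ι_zero
  smul := ι_smul
  incl := ι_incl
  inner x y := (inner_ι x y).symm

/-- The axioms, with three variables, hold for any three elements of the union. -/
lemma exists_val (a b c : Union hM) : ∃ (n : ℕ+) (v : Assignment M),
    (realization hM).toFun n (v n 0) = a ∧ (realization hM).toFun n (v n 1) = b ∧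
      (realization hM).toFun n (v n 2) = c := by
  obtain ⟨n, x, y, z, rfl, rfl, rfl⟩ := exists_ι₃ a b c
  obtain ⟨v, rfl, rfl, rfl⟩ := exists_assignment M n x y z
  exact ⟨n, v, rfl, rfl, rfl⟩

lemma val_eq_of_axiom {n j k : ℕ+} {σ : Tm j} {τ : Tm k} (h : Axioms (all n (dst σ τ)))
    (v : Assignment M) : (realization hM).val v σ = (realization hM).val v τ :=
  ι_eq_of_axiom h v

lemma vectorLaws : VectorLaws (Union hM) where
  add_comm a b := by
    obtain ⟨n, v, rfl, rfl, -⟩ := exists_val a b b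
    simpa using val_eq_of_axiom (hM := hM) (.add_comm n) v
  add_assoc a b c := by
    obtain ⟨n, v, rfl, rfl, rfl⟩ := exists_val a b c
    simpa using val_eq_of_axiom (hM := hM) (.add_assoc n) v
  add_zero a := by
    obtain ⟨n, v, rfl, -⟩ := exists_val a a a
    simpa using val_eq_of_axiom (hM := hM) (.add_zero n) v
  add_neg a := by
    obtain ⟨n, v, rfl, -⟩ := exists_val a a a
    simpa using val_eq_of_axiom (hM := hM) (.add_neg n) v
  one_smul a := by
    obtain ⟨n, v, rfl, -⟩ := exists_val a a a
    simpa using val_eq_of_axiom (hM := hM) (.one_smul n) v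
  mul_smul l m a := by
    obtain ⟨n, v, rfl, -⟩ := exists_val a a a
    simpa using val_eq_of_axiom (hM := hM) (.mul_smul l m n) v
  smul_add l a b := by
    obtain ⟨n, v, rfl, rfl, -⟩ := exists_val a b b
    simpa using val_eq_of_axiom (hM := hM) (.smul_add l n) v
  add_smul l m a := by
    obtain ⟨n, v, rfl, -⟩ := exists_val a a a
    simpa using val_eq_of_axiom (hM := hM) (.add_smul l m n) v
  dist_eq a b := by
    obtain ⟨n, v, rfl, rfl, -⟩ := exists_val a b b
    have := eval_eq_zero_of_satisfies hM (.dist_eq n) (fun _ => abs_nonneg _) v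
    simpa [(realization hM).eval_dst₀, (realization hM).eval_nrm, sub_eq_zero] using this

lemma conj_inner_symm_union (a b : Union hM) : (starRingEnd ℂ) (inner ℂ b a) = inner ℂ a b := by
  obtain ⟨n, v, rfl, rfl, -⟩ := exists_val a b b
  have h1 := eval_eq_zero_of_satisfies hM (.re_symm n) (fun _ => abs_nonneg _) v
  have h2 := eval_eq_zero_of_satisfies hM (.im_symm n) (fun _ => abs_nonneg _) v
  refine Complex.ext ?_ ?_
  · refine Eq.symm ?_
    simpa [(realization hM).eval_re₀, sub_eq_zero] using h1
  · refine Eq.symm ?_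
    simpa [(realization hM).eval_im₀, add_eq_zero_iff_eq_neg] using h2

lemma inner_add_right_union (a b c : Union hM) :
    inner ℂ a (b + c) = inner ℂ a b + inner ℂ a c := by
  obtain ⟨n, v, rfl, rfl, rfl⟩ := exists_val a b c
  have h1 := eval_eq_zero_of_satisfies hM (.re_add n) (fun _ => abs_nonneg _) v
  have h2 := eval_eq_zero_of_satisfies hM (.im_add n) (fun _ => abs_nonneg _) v
  refine Complex.ext ?_ ?_
  · simpa [(realization hM).eval_re₀, (realization hM).eval_re, sub_eq_zero] using h1
  · simpa [(realization hM).eval_im₀, (realization hM).eval_im, sub_eq_zero] using h2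

lemma inner_smul_right_union (l : ℂ) (a b : Union hM) : inner ℂ a (l • b) = l * inner ℂ a b := by
  obtain ⟨n, v, rfl, rfl, -⟩ := exists_val a b b
  have h1 := eval_eq_zero_of_satisfies hM (.re_smul l n) (fun _ => abs_nonneg _) v
  have h2 := eval_eq_zero_of_satisfies hM (.im_smul l n) (fun _ => abs_nonneg _) v
  refine Complex.ext ?_ ?_
  · simpa [(realization hM).eval_re₀, (realization hM).eval_im₀, (realization hM).eval_re,
      sub_eq_zero, ← sub_eq_add_neg] using h1
  · simpa [(realization hM).eval_im₀, (realization hM).eval_re₀, (realization hM).eval_im,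
      sub_eq_zero] using h2

lemma dist_sq_union (a : Union hM) : dist a 0 * dist a 0 = (inner ℂ a a).re := by
  obtain ⟨n, v, rfl, -⟩ := exists_val a a a
  have := eval_eq_zero_of_satisfies hM (.norm_sq n) (fun _ => abs_nonneg _) v
  simpa [(realization hM).eval_nrm, (realization hM).eval_re₀, sub_eq_zero] using this

/-- Homogeneity of the norm is no axiom here; it follows from ‖la‖² = ⟨la, la⟩ = |l|² ‖a‖². -/
lemma dist_smul_union (l : ℂ) (a : Union hM) : dist (l • a) 0 = ‖l‖ * dist a 0 := by
  have h : inner ℂ (l • a) (l • a) = (Complex.normSq l : ℂ) * inner ℂ a a := by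
    rw [inner_smul_right_union, ← conj_inner_symm_union, inner_smul_right_union, map_mul,
      conj_inner_symm_union, ← mul_assoc, Complex.mul_conj]
  have h1 := dist_sq_union (l • a)
  rw [h, Complex.re_ofReal_mul, ← dist_sq_union, Complex.normSq_eq_norm_sq] at h1
  refine (mul_self_inj dist_nonneg (by positivity)).1 ?_
  linarith

noncomputable instance : NormedAddCommGroup (Union hM) := vectorLaws.normedAddCommGroup

noncomputable instance : NormedSpace ℂ (Union hM) :=
  { vectorLaws.module with norm_smul_le := fun l a => (dist_smul_union l a).le }

noncomputable instance : InnerProductSpace ℂ (Union hM) where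
  norm_sq_eq_re_inner a := by
    rw [sq]
    exact dist_sq_union a
  conj_inner_symm := conj_inner_symm_union
  -- The axioms concern the second variable; conjugate symmetry moves them to the first.
  add_left a b c := by
    rw [← conj_inner_symm_union, inner_add_right_union, map_add,
      conj_inner_symm_union, conj_inner_symm_union]
  smul_left a b l := by
    rw [← conj_inner_symm_union, inner_smul_right_union, map_mul, conj_inner_symm_union]

end Union

open UniformSpace

/-- A model is realized in the Hilbert space that completes the union of its sorts. -/
noncomputable def completionRealization (hM : Satisfies M THilb) :
    Realization M (Completion (Union hM)) where
  toFun n x := ((Union.realization hM).toFun n x : Union hM)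
  dist_eq x y := by rw [Completion.dist_eq, Realization.dist_eq]
  add x y := by rw [Realization.add, Completion.coe_add]
  zero n := by rw [Realization.zero, Completion.coe_zero]
  smul l n x := by rw [Realization.smul, Completion.coe_smul]
  incl h x := by rw [Realization.incl]
  inner x y := by rw [Completion.inner_coe]; exact Realization.inner _ _ _

end HilbLang

/-! ### Models of T_HS are dissections, and conversely. -/

namespace HilbLang

variable {M : MetricStructure.{u} HilbLang}

namespace Realization

lemma isClosed_range {A : Type u} [MetricSpace A] [Add A] [Zero A] [SMul ℂ A] [Inner ℂ A]
    (r : Realization M A) (n : ℕ+) : IsClosed (Set.range (r.toFun n)) :=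
  (Isometry.of_dist_eq r.dist_eq).isClosedEmbedding.isClosed_range

variable {A : Type u} [NormedAddCommGroup A] [InnerProductSpace ℂ A] (r : Realization M A)

/-- The theory bounds norms only on `S_1`. But x / n belongs to `S_1` for `x` in `S_n`, since that
is the co-domain of the scalar 1/n, so ‖x‖ / n ≤ 1. -/
lemma norm_le_of_satisfies (hM : Satisfies M THilb) {n : ℕ+} (x : Car M n) :
    ‖r.toFun n x‖ ≤ n := by
  have h1 (y : Car M 1) : ‖r.toFun 1 y‖ ≤ 1 := by
    obtain ⟨v, rfl, -⟩ := exists_assignment M (1 : ℕ+) y y y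
    have := eval_eq_zero_of_satisfies hM .norm_le (fun _ => le_max_right _ _) v
    simpa [r.eval_nrm] using this
  have h2 : ∀ (k : ℕ+) (y : Car M k), k = 1 → ‖r.toFun k y‖ ≤ 1 := by
    rintro _ y rfl
    exact h1 y
  have h3 := h2 _ (fsmul ((n : ℕ) : ℂ)⁻¹ x) (scalCod_inv_natCast n)
  have h : (0 : ℝ) < (n : ℕ) := by exact_mod_cast n.pos
  rwa [r.smul, norm_smul, norm_inv, Complex.norm_natCast, inv_mul_le_iff₀ h, mul_one] at h3

/-- The Hilbert space substitute for the q^n_k. As ‖x‖ < 1, the term 1 - ‖x‖ of the minimum is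
positive, so the axiom `unit_ball` forces `x` to have distance 0 from the image of `S_1`, which is
closed. At norm 1 the axiom would give nothing. -/
lemma exists_eq_of_norm_lt_one (hM : Satisfies M THilb) {n : ℕ+} {x : Car M n}
    (hx : ‖r.toFun n x‖ < 1) : r.toFun n x ∈ Set.range (r.toFun 1) := by
  rcases (one_le (a := n)).eq_or_lt with rfl | h
  · exact ⟨x, rfl⟩
  obtain ⟨v, rfl, -⟩ := exists_assignment M n x x x
  have h0 := eval_eq_zero_of_satisfies hM (.unit_ball n h) (unit_ball_nonneg _ _ _ _) v
  rw [Formula.eval_min, r.eval_inf v h, Formula.eval_dotminus, Formula.eval_const, r.eval_nrm,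
    val_tvar, dist_zero_right] at h0
  have h1 : ⨅ y : Car M 1, dist (r.toFun n (v n 0)) (r.toFun 1 y) ≤ 0 := by
    refine (min_le_iff.1 h0.le).resolve_left fun h => ?_
    linarith [le_max_left (1 - ‖r.toFun n (v n 0)‖) 0]
  rw [← (r.isClosed_range 1).closure_eq, Metric.mem_closure_range_iff]
  exact fun ε hε => exists_lt_of_ciInf_lt (h1.trans_lt hε)

lemma exists_eq_of_norm_le (h : ∀ a : A, ‖a‖ ≤ 1 → a ∈ Set.range (r.toFun 1)) {n : ℕ+} {a : A}
    (ha : ‖a‖ ≤ n) : ∃ x, r.toFun n x = a := by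
  obtain ⟨x, hx⟩ := h _ (norm_inv_smul_le_one ha)
  have e := r.smul ((n : ℕ) : ℂ) x
  rw [hx, smul_inv_smul_natCast] at e
  have h' : ∃ y : Car M (scalCod ((n : ℕ) : ℂ) 1), r.toFun _ y = a := ⟨_, e⟩
  rwa [scalCod_natCast] at h'

end Realization

/-- The balls of the completed union of a model are its sorts. -/
lemma exists_completionRealization_eq (hM : Satisfies M THilb) {n : ℕ+}
    {a : UniformSpace.Completion (Union hM)} (ha : ‖a‖ ≤ n) :
    ∃ x, (completionRealization hM).toFun n x = a := by
  refine (completionRealization hM).exists_eq_of_norm_le (fun a ha => ?_) ha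
  refine mem_of_norm_le_one_of_dense ((completionRealization hM).isClosed_range 1)
    (UniformSpace.Completion.denseRange_coe (α := Union hM)) ?_ ha
  rintro _ ⟨b, rfl⟩ hb
  obtain ⟨n, v, rfl, -⟩ := Union.exists_val b b b
  exact (completionRealization hM).exists_eq_of_norm_lt_one hM hb

/-- A model of the theory is isomorphic to the dissection of a Hilbert space. -/
theorem exists_isomorphic (hM : Satisfies M THilb) :
    ∃ H : HilbCat.{u}, Isomorphic M (hilbDissection.obj H) := by
  let r := completionRealization hM
  refine ⟨⟨UniformSpace.Completion (Union hM)⟩, ?_⟩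
  have hrel : ∀ (R : HilbRel) (a : Fin 2 → Car M R.argSort),
      hilbRel (UniformSpace.Completion (Union hM)) R
        (fun i => ⟨r.toFun _ (a i), r.norm_le_of_satisfies hM (a i)⟩) = M.rel R a := by
    intro R a
    cases R with
    | re n => exact ((rel_re n a).trans (congrArg Complex.re (r.inner _ _))).symm
    | im n => exact ((rel_im n a).trans (congrArg Complex.im (r.inner _ _))).symm
  let ρ : Hom M (hilbObj ⟨UniformSpace.Completion (Union hM)⟩) :=
    { toFun := fun (n : ℕ+) x => ⟨r.toFun n x, r.norm_le_of_satisfies hM x⟩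
      map_func := fun f a => by
        cases f with
        | add n => exact Subtype.ext ((congrArg _ (func_add n a)).trans (r.add _ _))
        | zero n => exact Subtype.ext ((congrArg _ (func_zero n a)).trans (r.zero _))
        | smul l n => exact Subtype.ext ((congrArg _ (func_smul l n a)).trans (r.smul l _))
        | incl m n h => exact Subtype.ext ((congrArg _ (func_incl h a)).trans (r.incl h _))
      map_rel := fun R a => (hrel R a).le
      map_dist := fun n x y => (r.dist_eq x y).le }
  refine ⟨ρ, hrel, fun n x y => r.dist_eq x y, fun n y => ?_⟩
  obtain ⟨x, hx⟩ := exists_completionRealization_eq hM y.2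
  exact ⟨x, Subtype.ext hx⟩

/-- The dissection of a Hilbert space is realized in the space. -/
def dissRealization (H : HilbCat.{u}) : Realization (hilbDissection.obj H) H.carrier where
  toFun n (x : Ball H.carrier n) := x.1
  dist_eq _ _ := rfl
  add _ _ := rfl
  zero _ := rfl
  smul _ _ _ := rfl
  incl _ _ := rfl
  inner _ _ := rfl

theorem satisfies_dissection (H : HilbCat.{u}) : Satisfies (hilbDissection.obj H) THilb :=
  (dissRealization H).satisfies
    (fun x => (Subtype.property (p := fun a : H.carrier => ‖a‖ ≤ (1 : ℕ+)) x).trans_eq (by simp))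
    fun a ha => ⟨(⟨a, by simpa using ha⟩ : Ball H.carrier 1), rfl⟩

theorem satisfies_iff (M : MetricStructure.{u} HilbLang) :
    Satisfies M THilb ↔ ∃ H : HilbCat.{u}, Isomorphic M (hilbDissection.obj H) :=
  ⟨exists_isomorphic, fun ⟨H, h⟩ => h.satisfies (satisfies_dissection H)⟩

/-! ### The dissection functor is fully faithful -/

instance : hilbDissection.{u}.Faithful where
  map_injective {H K φ ψ} h := by
    refine LinearIsometry.ext fun a => ?_
    obtain ⟨n, hn, -⟩ := exists_norm_le a a
    have := congrFun (congrFun (congrArg Hom.toFun h) n) (⟨a, hn⟩ : Ball H.carrier n)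
    exact congrArg Subtype.val this

/-- The components glue to a linear map as for C*-algebras. Homomorphisms only bound Re⟨·,·⟩ from
above; linearity provides the reverse bound, hence an isometry. -/
instance : hilbDissection.{u}.Full where
  map_surjective {H K} (f : Hom (hilbObj H) (hilbObj K)) := by
    let T (n : ℕ+) (x : Ball H.carrier n) : Ball K.carrier n := f.toFun n x
    obtain ⟨g, hg⟩ := exists_map_of_balls T fun {m n} h ⟨a, ha⟩ ⟨b, hb⟩ hab => by
      obtain rfl : a = b := hab
      exact (congrArg Subtype.val
        (f.map_func (.incl m n h) (fun _ => ⟨a, ha⟩ : Fin 1 → Ball H.carrier m))).symm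
    have hg' (n : ℕ+) (x : Ball H.carrier n) : (T n x).1 = g x.1 := (hg n x.1 x.2).symm
    let φ : H.carrier →ₗ[ℂ] K.carrier :=
      { toFun := g
        map_smul' := fun l a => by
          obtain ⟨n, ha, -⟩ := exists_norm_le a a
          have := congrArg Subtype.val
            (f.map_func (.smul l n) (fun _ => ⟨a, ha⟩ : Fin 1 → Ball H.carrier n))
          exact ((hg' _ _).symm.trans this).trans (congrArg (l • ·) (hg' n ⟨a, ha⟩))
        map_add' := fun a b => by
          obtain ⟨n, ha, hb⟩ := exists_norm_le a b
          have := congrArg Subtype.val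
            (f.map_func (.add n) (![⟨a, ha⟩, ⟨b, hb⟩] : Fin 2 → Ball H.carrier n))
          exact ((hg' _ _).symm.trans this).trans
            (congrArg₂ (· + ·) (hg' n ⟨a, ha⟩) (hg' n ⟨b, hb⟩)) }
    have hre (a b : H.carrier) : (inner ℂ (φ a) (φ b)).re ≤ (inner ℂ a b).re := by
      obtain ⟨n, ha, hb⟩ := exists_norm_le a b
      have : (inner ℂ (T n ⟨a, ha⟩).1 (T n ⟨b, hb⟩).1).re ≤ (inner ℂ a b).re :=
        f.map_rel (.re n) (![⟨a, ha⟩, ⟨b, hb⟩] : Fin 2 → Ball H.carrier n)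
      rwa [hg', hg'] at this
    have hnorm (a : H.carrier) : ‖φ a‖ = ‖a‖ := by
      have h1 := hre a a
      -- Replacing the second argument by its negative reverses the inequality.
      have h2 := hre a (-a)
      rw [map_neg, inner_neg_right, inner_neg_right, Complex.neg_re, Complex.neg_re] at h2
      have h3 := le_antisymm h1 (neg_le_neg_iff.1 h2)
      rw [← sq_eq_sq₀ (norm_nonneg _) (norm_nonneg _), norm_sq_eq_re_inner (𝕜 := ℂ),
        norm_sq_eq_re_inner (𝕜 := ℂ)]
      exact h3
    refine ⟨(⟨φ, hnorm⟩ : H.carrier →ₗᵢ[ℂ] K.carrier),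
      Hom.ext (funext fun n => funext fun x => Subtype.ext ?_)⟩
    exact (hg' n x).symm

end HilbLang

end ContModel

/-! ### The main theorem. -/

theorem mainTheorem10 :
    -- `*`-polynomials `q^n_k` as required by the language of C*-algebras exist
    (∃ Q : ℕ+ → ℕ → ContModel.StarPoly, ContModel.IsRetractingFamily.{u} Q) ∧
    -- C*-algebras, for any choice of the `q^n_k`
    (∀ (Q : ℕ+ → ℕ → ContModel.StarPoly) (hQ : ContModel.IsRetractingFamily.{u} Q),
      (∀ M : ContModel.MetricStructure.{u} (ContModel.CStarLang Q),
        ContModel.Satisfies M (ContModel.TCStar Q) ↔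
          ∃ A : ContModel.CStarCat.{u},
            ContModel.Isomorphic M ((ContModel.dissection hQ).obj A)) ∧
      ∃ h : ∀ A : ContModel.CStarCat.{u},
          ContModel.isModel (ContModel.TCStar Q) ((ContModel.dissection hQ).obj A),
        ((ContModel.isModel (ContModel.TCStar Q)).lift
          (ContModel.dissection hQ) h).IsEquivalence) ∧
    -- Hilbert spaces
    ((∀ M : ContModel.MetricStructure.{u} ContModel.HilbLang,
        ContModel.Satisfies M ContModel.THilb ↔
          ∃ H : ContModel.HilbCat.{u},
            ContModel.Isomorphic M (ContModel.hilbDissection.obj H)) ∧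
      ∃ h : ∀ H : ContModel.HilbCat.{u},
          ContModel.isModel ContModel.THilb (ContModel.hilbDissection.obj H),
        ((ContModel.isModel ContModel.THilb).lift
          ContModel.hilbDissection h).IsEquivalence) := by
  refine ⟨ContModel.exists_isRetractingFamily, fun Q hQ => ⟨ContModel.CStarLang.satisfies_iff hQ,
      ContModel.CStarLang.satisfies_dissection hQ, ?_⟩,
    ContModel.HilbLang.satisfies_iff, ContModel.HilbLang.satisfies_dissection, ?_⟩
  · exact ContModel.isEquivalence_lift _ _ fun _ => ContModel.CStarLang.exists_isomorphic hQ
  · exact ContModel.isEquivalence_lift _ _ fun _ => ContModel.HilbLang.exists_isomorphic
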